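/- **Conventions.** A polynomial $W\in\mathbb C[x_1,\dots,x_N]$ is *invertible* if it has an isolated singularity at the origin, there are unique positive rational weights $q_1,\dots,q_N$ for which every monomial of $W$ has weighted degree one, and $W$ has exactly $N$ monomials. Its exponent matrix $A=(a_{ij})$ has as rows the exponent vectors of the monomials, and $W^T=\sum_i\prod_j x_j^{a_{ji}}$. For $g\in(\mathbb Q/\mathbb Z)^N$ let $\operatorname{age} g$ be the sum of the representatives of the $g_i$ in $[0,1)$, and let $g$ act by $x_i\mapsto e^{2\pi i g_i}x_i$. Let $G^{\max}_W\subset(\mathbb Q/\mathbb Z)^N$ be the group of those $g$ that preserve $W$, $\mathrm{SL}_W$ its subgroup of elements acting with determinant $1$, $\mathfrak j_W=(q_1,\dots,q_N)$ and $J_W=\langle\mathfrak j_W\rangle$. For $G\le G^{\max}_W$ put $G^T=\{g\in G^{\max}_{W^T}: gAh^{\mathsf T}\in\mathbb Z\ \text{for all } h\in G\}$. For $g\in G$ let $I_g$ be the set of indices $i$ with $g_i=0$, $N_g=|I_g|$, $W_g$ the restriction of $W$ to $\mathrm{Fix}(g)$, $\mathscr Q_g$ the Milnor ring of $W_g$ (the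 polynomial ring in the $x_i$, $i\in I_g$, modulo the partial derivatives of $W_g$), and $\omega_g=\bigwedge_{i\in I_g}dx_i$. As vector spaces $$\mathscr A_{W,G}=\mathscr B_{W,G}=\bigoplus_{g\in G}(\mathscr Q_g\,\omega_g)^G ,$$ where $G$ acts on both the polynomials and the form $\omega_g$. For a monomial form $\mu=\prod_{i\in I_g}x_i^{m_i}\,\omega_g$ put $\deg \mu=\sum_{i\in I_g}(m_i+1)q_i$; in the sector of $g$ the class of $\mu$ has bi-degree $$(\deg \mu+\operatorname{age} g-\operatorname{age}\mathfrak j_W,\ N_g-\deg \mu+\operatorname{age} g-\operatorname{age}\mathfrak j_W)\quad\text{in }\mathscr A_{W,G},$$ $$(\deg \mu+\operatorname{age} g-\operatorname{age}\mathfrak j_W,\ \deg \mu+\operatorname{age} g^{-1}-\operatorname{age}\mathfrak j_W)\quad\text{in }\mathscr B_{W,G}.$$ **Theorem.** Let $W_1=x_0^2+f_1(x_1,\dots,x_n)$ and $W_2=y_0^2+f_2(y_1,\dots,y_m)$ be invertible polynomials, each satisfying the Calabi–Yau condition $\operatorname{age}\mathfrak j_{W_i}=1$. Let $W=W_1+W_2$,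 and let $G$ be any group with $J_{W_1}\times J_{W_2}\le G\le \mathrm{SL}_{W_1}\times\mathrm{SL}_{W_2}$. Order the monomials of $W$ so that $W^T=W_1^T+W_2^T$ with $W_1^T$ and $W_2^T$ again of the form $x_0^2+\cdots$ and $y_0^2+\cdots$. Let $\sigma=(\tfrac12,0,\dots,0;\tfrac12,0,\dots,0)$ be the involution $x_0\mapsto -x_0$, $y_0\mapsto -y_0$, and for a group $H$ let $\sigma H$ denote the group generated by $H$ and $\sigma$. Then $W^T$ is again invertible, and there is an isomorphism of complex vector spaces $$\mathscr A_{W,\sigma G}\;\cong\;\mathscr B_{W^T,\sigma (G^T)}$$ which preserves the bi-degree, i.e. maps $\mathscr A_{W,\sigma G}^{p,q}$ onto $\mathscr B_{W^T,\sigma (G^T)}^{p,q}$ for all $p,q\in\mathbb Q$. -/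

import Mathlib

open MvPolynomial

noncomputable section

namespace BVLG

/-! ### The group `(ℚ/ℤ)^n` acting diagonally -/

/-- The group `ℚ/ℤ`. -/
abbrev QZ : Type := AddCircle (1 : ℚ)

/-- The representative of a class of `ℚ/ℤ` in `[0, 1)`. -/
def rep (x : QZ) : ℚ := (AddCircle.equivIco (1 : ℚ) 0 x : ℚ)

theorem rep_coe (a : ℚ) : rep (a : QZ) = Int.fract a := by
  have h := AddCircle.coe_equivIco_mk_apply (p := (1 : ℚ)) a
  rw [div_one, mul_one] at h
  exact h

/-- `x ↦ exp(2πi x)` on `ℚ/ℤ`. -/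
def expQZ (x : QZ) : ℂ := Complex.exp (2 * Real.pi * Complex.I * (rep x : ℂ))

theorem expQZ_coe (a : ℚ) :
    expQZ (a : QZ) = Complex.exp (2 * Real.pi * Complex.I * (a : ℂ)) := by
  have h : ((a : ℚ) : ℂ) = (Int.fract a : ℚ) + ((⌊a⌋ : ℤ) : ℂ) := by
    have := Int.fract_add_floor a
    exact_mod_cast this.symm
  rw [expQZ, rep_coe, h, mul_add, Complex.exp_add]
  have h2 : Complex.exp (2 * Real.pi * Complex.I * ((⌊a⌋ : ℤ) : ℂ)) = 1 := by
    rw [mul_comm]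
    exact Complex.exp_int_mul_two_pi_mul_I _
  rw [h2, mul_one]

theorem expQZ_zero : expQZ 0 = 1 := by
  have := expQZ_coe 0
  simpa using this

theorem expQZ_add (x y : QZ) : expQZ (x + y) = expQZ x * expQZ y := by
  induction x using QuotientAddGroup.induction_on with
  | H a =>
    induction y using QuotientAddGroup.induction_on with
    | H b =>
      have h1 := expQZ_coe (a + b)
      rw [AddCircle.coe_add] at h1
      rw [h1, expQZ_coe a, expQZ_coe b, ← Complex.exp_add]
      push_cast
      ring_nf

/-- The age of `g ∈ (ℚ/ℤ)^n`: the sum of the representatives of its entries in `[0, 1)`. -/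
def age {ι : Type} [Fintype ι] (g : ι → QZ) : ℚ := ∑ i, rep (g i)

/-- The action of `g ∈ (ℚ/ℤ)^n` on polynomials: `W(x) ↦ W(e^{2πi g₁} x₁, …, e^{2πi gₙ} xₙ)`. -/
def act {κ : Type} (g : κ → QZ) : MvPolynomial κ ℂ →ₐ[ℂ] MvPolynomial κ ℂ :=
  aeval fun i => C (expQZ (g i)) * X i

theorem act_zero {κ : Type} (p : MvPolynomial κ ℂ) : act (0 : κ → QZ) p = p := by
  have : act (0 : κ → QZ) = AlgHom.id ℂ _ := by
    ext i
    simp [act, expQZ_zero]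
  rw [this]
  rfl

theorem act_add {κ : Type} (g h : κ → QZ) (p : MvPolynomial κ ℂ) :
    act (g + h) p = act g (act h p) := by
  have : act (g + h) = (act g).comp (act h) := by
    apply MvPolynomial.algHom_ext
    intro i
    simp [act, expQZ_add]
    ring
  rw [this]
  rfl

/-! ### Admissible and invertible polynomials, symmetry groups -/

/-- `W` has an isolated singularity at the origin: the origin is a critical point, and no other
point of some neighbourhood of the origin is one. -/
def HasIsolatedSingularity {ι : Type} (W : MvPolynomial ι ℂ) : Prop :=
  (∀ i, eval (0 : ι → ℂ) (pderiv i W) = 0) ∧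
    ∀ᶠ x in nhdsWithin (0 : ι → ℂ) {0}ᶜ, ∃ i, eval x (pderiv i W) ≠ 0

/-- `q` is a system of positive rational weights for which every monomial of `W` has
weighted degree one. -/
def IsWeightSystem {ι : Type} (W : MvPolynomial ι ℂ) (q : ι → ℚ) : Prop :=
  (∀ i, 0 < q i) ∧ IsWeightedHomogeneous q W 1

/-- `W` is admissible (quasihomogeneous and nondegenerate): it has positive weights, they are
uniquely determined, and it has an isolated singularity at the origin. -/
def IsAdmissible {ι : Type} (W : MvPolynomial ι ℂ) : Prop :=
  HasIsolatedSingularity W ∧ ∃! q : ι → ℚ, IsWeightSystem W q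

/-- `W` is invertible: admissible, with as many monomials as variables. -/
def IsInvertible {ι : Type} [Fintype ι] (W : MvPolynomial ι ℂ) : Prop :=
  IsAdmissible W ∧ W.support.card = Fintype.card ι

open Classical in
/-- The weights `q` of `W` (they exist and are unique when `W` is admissible). -/
def weights {ι : Type} (W : MvPolynomial ι ℂ) : ι → ℚ :=
  if h : ∃ q : ι → ℚ, IsWeightSystem W q then h.choose else 0

/-- The exponential grading operator `𝔧_W = (q₁, …, qₙ)`. -/
def expGrading {ι : Type} (W : MvPolynomial ι ℂ) : ι → QZ := fun i => (weights W i : QZ)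

/-- The group `J_W` generated by the exponential grading operator. -/
def J {ι : Type} (W : MvPolynomial ι ℂ) : AddSubgroup (ι → QZ) :=
  AddSubgroup.zmultiples (expGrading W)

/-- The Calabi–Yau condition `age 𝔧_W = 1`. -/
def CalabiYau {ι : Type} [Fintype ι] (W : MvPolynomial ι ℂ) : Prop := age (expGrading W) = 1

/-- The maximal diagonal symmetry group `G_W^max`. -/
def Gmax {ι : Type} (W : MvPolynomial ι ℂ) : AddSubgroup (ι → QZ) where
  carrier := {g | act g W = W}
  zero_mem' := act_zero W
  add_mem' := by
    intro a b ha hb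
    simp only [Set.mem_ofPred_eq] at *
    rw [act_add, hb, ha]
  neg_mem' := by
    intro a ha
    simp only [Set.mem_ofPred_eq] at *
    conv_lhs => rw [← ha]
    rw [← act_add, neg_add_cancel, act_zero]

/-- `SL_W`: the elements of `G_W^max` whose diagonal matrix has determinant one. -/
def SL {ι : Type} [Fintype ι] (W : MvPolynomial ι ℂ) : AddSubgroup (ι → QZ) where
  carrier := {g | g ∈ Gmax W ∧ ∏ i, expQZ (g i) = 1}
  zero_mem' := ⟨(Gmax W).zero_mem, by simp [expQZ_zero]⟩
  add_mem' := by
    intro a b ha hb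
    refine ⟨(Gmax W).add_mem ha.1 hb.1, ?_⟩
    simp [expQZ_add, Finset.prod_mul_distrib, ha.2, hb.2]
  neg_mem' := by
    intro a ha
    refine ⟨(Gmax W).neg_mem ha.1, ?_⟩
    have h : ∏ i, expQZ ((-a) i) * expQZ (a i) = 1 := by
      simp [← expQZ_add, expQZ_zero]
    rwa [Finset.prod_mul_distrib, ha.2, mul_one] at h

/-! ### State spaces -/

/-- `I_g`: the variables fixed by `g`. -/
abbrev FixVar {ι : Type} (g : ι → QZ) : Type := {i : ι // g i = 0}

open Classical in
/-- `W_g`: the restriction of `W` to `Fix(g)`, a polynomial in the variables fixed by `g`. -/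
def restrictFix {ι : Type} (W : MvPolynomial ι ℂ) (g : ι → QZ) : MvPolynomial (FixVar g) ℂ :=
  aeval (fun i => if h : g i = 0 then (X ⟨i, h⟩ : MvPolynomial (FixVar g) ℂ) else 0) W

/-- The ideal generated by the partial derivatives. -/
def jacobianIdeal {κ : Type} (V : MvPolynomial κ ℂ) : Ideal (MvPolynomial κ ℂ) :=
  Ideal.span (Set.range fun i => pderiv i V)

/-- The Milnor ring `𝒬_V`. -/
abbrev MilnorRing {κ : Type} (V : MvPolynomial κ ℂ) : Type := MvPolynomial κ ℂ ⧸ jacobianIdeal V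

/-- The class of a polynomial in the Milnor ring, as a linear map. -/
def toMilnor {κ : Type} (V : MvPolynomial κ ℂ) : MvPolynomial κ ℂ →ₗ[ℂ] MilnorRing V :=
  (Ideal.Quotient.mkₐ ℂ (jacobianIdeal V)).toLinearMap

open Classical in
/-- The action of `h` on forms `p · ω_g`, where `p` is a polynomial in the variables fixed by `g`
and `ω_g` is the product of the `dxᵢ`, `i ∈ I_g`; the form `p · ω_g` is recorded by `p`. -/
def formAct {ι : Type} [Fintype ι] (g h : ι → QZ) :
    MvPolynomial (FixVar g) ℂ →ₗ[ℂ] MvPolynomial (FixVar g) ℂ :=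
  (∏ i : FixVar g, expQZ (h i)) • (act fun i : FixVar g => h i).toLinearMap

/-- The sector `(𝒬_g ω_g)^G`: the classes `[p] ω_g` with `[h · p] ω_g = [p] ω_g` for all
`h ∈ G`. -/
def sector {ι : Type} [Fintype ι] (W : MvPolynomial ι ℂ) (G : AddSubgroup (ι → QZ))
    (g : ι → QZ) : Submodule ℂ (MilnorRing (restrictFix W g)) :=
  (⨅ h ∈ G, LinearMap.eqLocus (toMilnor (restrictFix W g) ∘ₗ formAct g h)
    (toMilnor (restrictFix W g))).map (toMilnor (restrictFix W g))

/-- The vector space `⨁_{g ∈ G} (𝒬_g ω_g)^G` underlying both state spaces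
`𝒜_{W,G}` and `ℬ_{W,G}`. -/
abbrev StateSpace {ι : Type} [Fintype ι] (W : MvPolynomial ι ℂ) (G : AddSubgroup (ι → QZ)) :
    Type :=
  DirectSum G fun g => sector W G (g : ι → QZ)

/-- `N_g`, the dimension of `Fix(g)`. -/
def fixDim {ι : Type} (g : ι → QZ) : ℕ := Nat.card (FixVar g)

open Classical in
/-- The degree of the form `x^m ω_g`: both the variables `xᵢ` and the `dxᵢ` have degree `qᵢ`. -/
def formDeg {ι : Type} [Fintype ι] (W : MvPolynomial ι ℂ) (g : ι → QZ) (m : FixVar g →₀ ℕ) : ℚ :=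
  ∑ i : FixVar g, ((m i : ℚ) + 1) * weights W i

/-- The A-model bi-degree of `⌊x^m ω_g, g⌉`. -/
def bidegA {ι : Type} [Fintype ι] (W : MvPolynomial ι ℂ) (g : ι → QZ) (m : FixVar g →₀ ℕ) :
    ℚ × ℚ :=
  (formDeg W g m + age g - age (expGrading W),
    fixDim g - formDeg W g m + age g - age (expGrading W))

/-- The B-model bi-degree of `⌊x^m ω_g, g⌉`. -/
def bidegB {ι : Type} [Fintype ι] (W : MvPolynomial ι ℂ) (g : ι → QZ) (m : FixVar g →₀ ℕ) :
    ℚ × ℚ :=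
  (formDeg W g m + age g - age (expGrading W),
    formDeg W g m + age (-g) - age (expGrading W))

/-- For a bi-degree function `d`, the part of the state space of bi-degree `r`: the elements
whose component in each sector `g` is a combination of classes of monomial forms `x^m ω_g` with
`d g m = r`. -/
def bigradedPiece {ι : Type} [Fintype ι] (W : MvPolynomial ι ℂ) (G : AddSubgroup (ι → QZ))
    (d : (g : ι → QZ) → (FixVar g →₀ ℕ) → ℚ × ℚ) (r : ℚ × ℚ) :
    Submodule ℂ (StateSpace W G) :=
  ⨅ g : G, (Submodule.span ℂ {x | ∃ m : FixVar (g : ι → QZ) →₀ ℕ,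
      d g m = r ∧ x = toMilnor (restrictFix W g) (monomial m 1)}).comap
    ((sector W G (g : ι → QZ)).subtype ∘ₗ
      DirectSum.component ℂ G (fun g => sector W G (g : ι → QZ)) g)

/-- `𝒜_{W,G}^{p,q}`, with `r = (p, q)`. -/
def pieceA {ι : Type} [Fintype ι] (W : MvPolynomial ι ℂ) (G : AddSubgroup (ι → QZ)) (r : ℚ × ℚ) :
    Submodule ℂ (StateSpace W G) :=
  bigradedPiece W G (bidegA W) r

/-- `ℬ_{W,G}^{p,q}`, with `r = (p, q)`. -/
def pieceB {ι : Type} [Fintype ι] (W : MvPolynomial ι ℂ) (G : AddSubgroup (ι → QZ)) (r : ℚ × ℚ) :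
    Submodule ℂ (StateSpace W G) :=
  bigradedPiece W G (bidegB W) r

/-! ### Mirror polynomial and mirror group -/

/-- The rows of `A` are the exponent vectors of the monomials of `W`, each listed once. -/
def IsExponentMatrix {ι : Type} [Fintype ι] (W : MvPolynomial ι ℂ) (A : Matrix ι ι ℕ) : Prop :=
  Function.Injective A ∧
    ∀ d : ι →₀ ℕ, d ∈ W.support ↔ ∃ i, A i = (d : ι → ℕ)

/-- The mirror polynomial `W^T = ∑ᵢ ∏ⱼ xⱼ ^ aⱼᵢ` of a polynomial with exponent matrix `A`. -/
def mirrorPoly {ι : Type} [Fintype ι] (A : Matrix ι ι ℕ) : MvPolynomial ι ℂ :=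
  ∑ i, ∏ j, X j ^ A j i

/-- The mirror group `G^T`: the `g ∈ G_{W^T}^max` with `g A hᵀ ∈ ℤ` for all `h ∈ G`.
The value `g A hᵀ` is computed with rational lifts `a` of `g` and `b` of `h`; modulo `ℤ` it does
not depend on them, since `g ∈ G_{W^T}^max` and `h ∈ G_W^max`. -/
def mirrorGroup {ι : Type} [Fintype ι] (A : Matrix ι ι ℕ) (G : AddSubgroup (ι → QZ)) :
    AddSubgroup (ι → QZ) where
  carrier := {g | g ∈ Gmax (mirrorPoly A) ∧
    ∃ a : ι → ℚ, (∀ i, (a i : QZ) = g i) ∧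
      ∀ h ∈ G, ∀ b : ι → ℚ, (∀ i, (b i : QZ) = h i) →
        ∃ k : ℤ, ∑ i, ∑ j, a i * (A i j : ℚ) * b j = k}
  zero_mem' := by
    refine ⟨(Gmax (mirrorPoly A)).zero_mem, 0, fun i => rfl, fun h _ b _ => ⟨0, by simp⟩⟩
  add_mem' := by
    rintro g g' ⟨hg, a, ha, hb⟩ ⟨hg', a', ha', hb'⟩
    refine ⟨(Gmax (mirrorPoly A)).add_mem hg hg', a + a', fun i => ?_, fun h hh b hbh => ?_⟩
    · simp [ha, ha']
    · obtain ⟨k, hk⟩ := hb h hh b hbh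
      obtain ⟨k', hk'⟩ := hb' h hh b hbh
      refine ⟨k + k', ?_⟩
      simp [add_mul, Finset.sum_add_distrib, hk, hk']
  neg_mem' := by
    rintro g ⟨hg, a, ha, hb⟩
    refine ⟨(Gmax (mirrorPoly A)).neg_mem hg, -a, fun i => ?_, fun h hh b hbh => ?_⟩
    · simp [ha]
    · obtain ⟨k, hk⟩ := hb h hh b hbh
      refine ⟨-k, ?_⟩
      simp [hk]

/-! ### Borcea–Voisin models -/

/-- `x₀² + f(x₁, …, xₙ)`. -/
def squarePlus {n : ℕ} (f : MvPolynomial (Fin n) ℂ) : MvPolynomial (Fin (n + 1)) ℂ :=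
  X 0 ^ 2 + rename Fin.succ f

/-- `W₁ + W₂`, in disjoint sets of variables. -/
def disjointSum {α β : Type} (W₁ : MvPolynomial α ℂ) (W₂ : MvPolynomial β ℂ) :
    MvPolynomial (α ⊕ β) ℂ :=
  rename Sum.inl W₁ + rename Sum.inr W₂

/-- The exponent matrix of `W₁ + W₂`. -/
def disjointSumMatrix {α β : Type} (A₁ : Matrix α α ℕ) (A₂ : Matrix β β ℕ) :
    Matrix (α ⊕ β) (α ⊕ β) ℕ :=
  Matrix.fromBlocks A₁ 0 0 A₂

/-- The product `H × K`, acting on the two sets of variables. -/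
def prodGroup {α β : Type} (H : AddSubgroup (α → QZ)) (K : AddSubgroup (β → QZ)) :
    AddSubgroup (α ⊕ β → QZ) where
  carrier := {g | (fun i => g (Sum.inl i)) ∈ H ∧ (fun j => g (Sum.inr j)) ∈ K}
  zero_mem' := ⟨H.zero_mem, K.zero_mem⟩
  add_mem' := fun ha hb => ⟨H.add_mem ha.1 hb.1, K.add_mem ha.2 hb.2⟩
  neg_mem' := fun ha => ⟨H.neg_mem ha.1, K.neg_mem ha.2⟩

/-- The involution `σ = (1/2, 0, …, 0; 1/2, 0, …, 0)`. -/
def sigma (n m : ℕ) : Fin (n + 1) ⊕ Fin (m + 1) → QZ :=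
  Sum.elim (Pi.single 0 (((1 / 2 : ℚ) : ℚ) : QZ)) (Pi.single 0 (((1 / 2 : ℚ) : ℚ) : QZ))

/-- The group generated by `G` and `σ`. -/
def withSigma {n m : ℕ} (G : AddSubgroup (Fin (n + 1) ⊕ Fin (m + 1) → QZ)) :
    AddSubgroup (Fin (n + 1) ⊕ Fin (m + 1) → QZ) :=
  G ⊔ AddSubgroup.zmultiples (sigma n m)

end BVLG

end

/-! An isolated singularity forces every variable to lead a monomial `x_j ^ a` or `x_j ^ a * x_l`.
The Calabi–Yau condition excludes products `x_j * x_l`: their two weights would add up to `1`, while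
`x₀` already has weight `1/2`. Counting monomials, `W` is a sum of Fermat, chain and loop
polynomials up to coefficients, which `ChainLoop` records as exponents at least `2` together with a
partial injection `next` (`HasIsolatedSingularity.exists_chainLoop`). Exponents at least `2` and
injectivity of `next` make the exponent matrix `A` invertible with weights in `(0, 1/2]`. This is
symmetric under transposition, so `W^T` is invertible as well.

A monomial form `x^m ω_g` is encoded by the rational vector `h` with `Aᵀ h = m + 1`, where `A` is
restricted to the variables fixed by `g`. The Milnor ring has as basis the monomials with `0 ≤ h ≤
1` such that `h i = 1` only if `next i` exists and carries `h = 0` (`IsBasic`). They span by an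
extremal argument (`Annihilates.eq_zero`) and are independent because explicit dual forms exist
(`annihilates_dualCoeff`). Extend `h` by zero, and lift `g` to a vector `γ` with entries in `[0,
1]`, taking the lift `1` exactly at the fixed variables where `h` vanishes. The resulting conditions
on `(γ, h)` are invariant under exchanging `γ` with `h` and `A` with its transpose (`MirrorPair`).
Invariance of the form under `G` says that `h` lies in the annihilator `G^T`, and by duality of
finite groups the elements of `G` are those annihilating `G^T` (`isDual_of_mem_right`). The exchange
of `γ` and `h` also carries A-degrees to B-degrees (`MirrorPair.pairDegB_swap`).

With `σ` added, a sector lies in `G` or in `σ + G`, whereas invariant forms still have `h` in `G^T`,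
subject to the further condition that `h x + h y` is integral at the two square variables. For
sectors in `σ + G` the plain exchange therefore fails. At a square variable, however, `(γ, h)` is
`(0, 1/2)` or `(1/2, 0)`, and switching these two values at both squares adds `σ` to both classes
without changing the bi-degree. So a pair with sector outside `G` is first switched at the squares
and then exchanged. This `mirrorMap` is inverted by the analogous map for `G^T` because `σ` belongs
to neither group: not to `G`, since its determinant on the first factor is `-1`, and not to `G^T`,
since it pairs to `1/2` with the grading operator of `W₁`. -/

noncomputable section

namespace BVLG

/-! ### Chain and loop shapes, invertibility of the exponent matrix, weights -/

/-- The shape of a sum of Fermat, chain and loop polynomials: the variable `i` is the leading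
variable of the monomial `x_i ^ exp i * x_j` when `next i = some j`, and of the monomial
`x_i ^ exp i` when `next i = none`. -/
structure ChainLoop (κ : Type) where
  exp : κ → ℕ
  next : κ ≃. κ
  two_le : ∀ i, 2 ≤ exp i
  next_ne : ∀ i, next i ≠ some i

namespace ChainLoop

variable {κ : Type}

/-- The shape of the transposed polynomial. -/
def transpose (D : ChainLoop κ) : ChainLoop κ where
  exp := D.exp
  next := D.next.symm
  two_le := D.two_le
  next_ne i h := D.next_ne i (D.next.eq_some_iff.1 h)

@[simp] theorem transpose_exp (D : ChainLoop κ) : D.transpose.exp = D.exp := rfl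

theorem transpose_next (D : ChainLoop κ) {i j : κ} :
    D.transpose.next j = some i ↔ D.next i = some j := D.next.eq_some_iff

theorem next_inj (D : ChainLoop κ) {i i' j : κ} (h : D.next i = some j) (h' : D.next i' = some j) :
    i = i' := D.next.inj h h'

/-- Multiplication by the exponent matrix. -/
def mul {R : Type*} [CommSemiring R] (D : ChainLoop κ) : (κ → R) →ₗ[R] (κ → R) where
  toFun v i := D.exp i * v i + (D.next i).elim 0 v
  map_add' v w := by
    ext i
    rcases h : D.next i with _ | j <;> simp [h] <;> ring
  map_smul' r v := by
    ext i
    rcases h : D.next i with _ | j <;> simp [h] <;> ring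

theorem mul_apply {R : Type*} [CommSemiring R] (D : ChainLoop κ) (v : κ → R) (i : κ) :
    D.mul v i = D.exp i * v i + (D.next i).elim 0 v := rfl

theorem mul_of_none {R : Type*} [CommSemiring R] (D : ChainLoop κ) (v : κ → R) {i : κ}
    (h : D.next i = none) : D.mul v i = D.exp i * v i := by simp [mul_apply, h]

theorem mul_of_some {R : Type*} [CommSemiring R] (D : ChainLoop κ) (v : κ → R) {i j : κ}
    (h : D.next i = some j) : D.mul v i = D.exp i * v i + v j := by simp [mul_apply, h]

variable [Fintype κ]

theorem sum_smul_elim {R M : Type*} [CommSemiring R] [AddCommMonoid M] [Module R M]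
    (D : ChainLoop κ) (v : κ → M) (w : κ → R) :
    ∑ i, w i • (D.next i).elim 0 v = ∑ j, (D.transpose.next j).elim 0 w • v j := by
  classical
  have h1 : ∀ i, w i • (D.next i).elim 0 v =
      ∑ j, if D.next i = some j then w i • v j else 0 := by
    intro i
    rcases h : D.next i with _ | j
    · simp
    · simp
  have h2 : ∀ j, (D.transpose.next j).elim 0 w • v j =
      ∑ i, if D.next i = some j then w i • v j else 0 := by
    intro j
    have h3 : ∀ i, D.next i = some j ↔ D.transpose.next j = some i := fun i => D.transpose_next.symm
    simp only [h3]
    rcases h : D.transpose.next j with _ | i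
    · simp
    · simp
  simp_rw [h1, h2]
  exact Finset.sum_comm

theorem sum_elim {R : Type*} [CommSemiring R] (D : ChainLoop κ) (v w : κ → R) :
    ∑ i, w i * (D.next i).elim 0 v = ∑ j, (D.transpose.next j).elim 0 w * v j :=
  D.sum_smul_elim v w

theorem sum_mul_transpose_smul {M : Type*} [AddCommGroup M] (D : ChainLoop κ) (h : κ → ℤ)
    (v : κ → M) :
    ∑ i, D.transpose.mul h i • v i = ∑ i, h i • (D.exp i • v i + (D.next i).elim 0 v) := by
  simp only [mul_apply, add_smul, smul_add, Finset.sum_add_distrib, transpose_exp, sum_smul_elim]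
  congr 1
  exact Finset.sum_congr rfl fun i _ => by rw [mul_comm, mul_smul, natCast_zsmul]

theorem sum_mul_transpose {R : Type*} [CommSemiring R] (D : ChainLoop κ) (h k : κ → R) :
    ∑ i, D.transpose.mul h i * k i = ∑ i, h i * D.mul k i := by
  simp only [mul_apply, add_mul, mul_add, Finset.sum_add_distrib, transpose_exp, sum_elim]
  congr 1
  exact Finset.sum_congr rfl fun i _ => by ring

/-- As `next` is injective, each `w j` is counted at most once on the left. -/
theorem sum_elim_le (D : ChainLoop κ) (w : κ → ℝ) (hw : ∀ i, 0 ≤ w i) :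
    ∑ i, (D.next i).elim 0 w ≤ ∑ i, w i := by
  have := D.sum_elim w (fun _ => (1 : ℝ))
  simp only [one_mul] at this
  rw [this]
  refine Finset.sum_le_sum fun j _ => ?_
  rcases D.transpose.next j with _ | i <;> simp [hw]

/-- Summing the inequalities gives `2 ∑ w ≤ ∑ w`. This takes the place of a determinant computation
for chains and loops. -/
theorem eq_zero_of_le_elim (D : ChainLoop κ) (w : κ → ℝ) (hw : ∀ i, 0 ≤ w i)
    (h : ∀ i, D.exp i * w i ≤ (D.next i).elim 0 w) : w = 0 := by
  have h1 : ∑ i, (2 : ℝ) * w i ≤ ∑ i, w i :=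
    (Finset.sum_le_sum fun i _ => (mul_le_mul_of_nonneg_right
      (by exact_mod_cast D.two_le i) (hw i)).trans (h i)).trans (D.sum_elim_le w hw)
  rw [← Finset.mul_sum] at h1
  have h2 : ∑ i, w i = 0 := le_antisymm (by linarith) (Finset.sum_nonneg fun i _ => hw i)
  ext i
  exact (Finset.sum_eq_zero_iff_of_nonneg fun i _ => hw i).1 h2 i (Finset.mem_univ i)

/-- A kernel relation equates `exp i * ‖v i‖` with the norm at the next variable, so the previous
estimate applies to the norms. Complex scalars are needed since coefficient vectors and values of
linear forms will be tested against the matrix. -/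
theorem mul_injective_complex (D : ChainLoop κ) : Function.Injective (D.mul (R := ℂ)) := by
  rw [injective_iff_map_eq_zero]
  intro v hv
  have h := D.eq_zero_of_le_elim (fun i => ‖v i‖) (fun i => norm_nonneg _) fun i => by
    have h0 := congrFun hv i
    rw [mul_apply, Pi.zero_apply] at h0
    have h1 : ‖(D.exp i : ℂ) * v i‖ = ‖(D.next i).elim 0 v‖ := by
      rw [eq_neg_of_add_eq_zero_left h0, norm_neg]
    rw [norm_mul, Complex.norm_natCast] at h1
    rw [h1]
    rcases D.next i with _ | j <;> simp
  ext i
  exact norm_eq_zero.1 (congrFun h i)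

theorem mul_injective (D : ChainLoop κ) : Function.Injective (D.mul (R := ℚ)) := by
  rw [injective_iff_map_eq_zero]
  intro v hv
  have h := D.mul_injective_complex (a₁ := fun i => (v i : ℂ)) (a₂ := 0) (by
    ext i
    have h0 := congrFun hv i
    rw [mul_apply, Pi.zero_apply] at h0
    rw [map_zero, mul_apply, Pi.zero_apply]
    rcases h : D.next i with _ | j <;> rw [h] at h0 <;> simp only [Option.elim] at h0 ⊢ <;>
      exact_mod_cast h0)
  ext i
  have := congrFun h i
  simpa using this

/-- Multiplication by the exponent matrix, as a linear equivalence. -/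
def mulEquiv (D : ChainLoop κ) : (κ → ℚ) ≃ₗ[ℚ] (κ → ℚ) :=
  LinearEquiv.ofInjectiveEndo D.mul D.mul_injective

theorem mulEquiv_apply (D : ChainLoop κ) (v : κ → ℚ) : D.mulEquiv v = D.mul v := rfl

theorem mul_mulEquiv_symm (D : ChainLoop κ) (v : κ → ℚ) : D.mul (D.mulEquiv.symm v) = v :=
  D.mulEquiv.apply_symm_apply v

/-- The weights: the solution of `A q = 1`. -/
def weight (D : ChainLoop κ) : κ → ℚ := D.mulEquiv.symm 1

theorem mul_weight (D : ChainLoop κ) : D.mul D.weight = 1 := D.mul_mulEquiv_symm 1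

/-- Bootstrapping from `a q_i = 1 - q_next`: looking where `|q|` is maximal gives `|q| ≤ 1`, hence
`q ≥ 0`, hence `q ≤ 1/2`, and then `q_next < 1` makes `q i` positive. -/
theorem weight_bounds (D : ChainLoop κ) (i : κ) : 0 < D.weight i ∧ D.weight i ≤ 1 / 2 := by
  set q := D.weight
  have hq : ∀ i, D.exp i * q i + (D.next i).elim 0 q = 1 := fun i => congrFun D.mul_weight i
  have ha : ∀ i, (2 : ℚ) ≤ D.exp i := fun i => by exact_mod_cast D.two_le i
  have habs : ∀ i, |q i| ≤ 1 := by
    obtain ⟨m, -, hm⟩ := Finset.exists_max_image Finset.univ (fun i => |q i|) ⟨i, Finset.mem_univ i⟩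
    intro i
    refine (hm i (Finset.mem_univ i)).trans ?_
    have h1 : |(D.next m).elim 0 q| ≤ |q m| := by
      rcases D.next m with _ | j
      · simp
      · exact hm j (Finset.mem_univ j)
    have h2 : (D.exp m : ℚ) * |q m| ≤ 1 + |q m| := by
      rw [← abs_of_nonneg (Nat.cast_nonneg (α := ℚ) (D.exp m)), ← abs_mul,
        eq_sub_of_add_eq (hq m)]
      exact (abs_sub _ _).trans (by simpa using h1)
    nlinarith [ha m, abs_nonneg (q m)]
  have hnn : ∀ i, 0 ≤ q i := by
    intro i
    have h1 : (D.next i).elim 0 q ≤ 1 := by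
      rcases D.next i with _ | j
      · simp
      · exact (abs_le.1 (habs j)).2
    have h2 := hq i
    by_contra hneg
    nlinarith [ha i]
  have hle : ∀ i, q i ≤ 1 / 2 := by
    intro i
    have h1 : 0 ≤ (D.next i).elim 0 q := by
      rcases D.next i with _ | j
      · simp
      · exact hnn j
    have h2 := hq i
    by_contra hgt
    nlinarith [ha i]
  refine ⟨(hnn i).lt_of_ne fun h0 => ?_, hle i⟩
  have h1 : (D.next i).elim 0 q ≤ 1 / 2 := by
    rcases D.next i with _ | j
    · simp
    · exact hle j
  have h2 := hq i
  rw [← h0] at h2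
  linarith

/-- Both sides are the sum of all entries of `A⁻¹`. Thus the shift by the age of the grading
operator is the same on the two sides of the mirror. -/
theorem sum_weight_transpose (D : ChainLoop κ) :
    ∑ i, D.transpose.weight i = ∑ i, D.weight i := by
  have h := D.sum_mul_transpose D.transpose.weight D.weight
  rw [mul_weight, mul_weight] at h
  simpa using h.symm

/-- This turns the weighted degree of a form into the plain sum of the entries of `h`, because `Aᵀ
h` lists the exponents plus one. -/
theorem sum_weight_mul_transpose (D : ChainLoop κ) (h : κ → ℚ) :
    ∑ i, D.transpose.mul h i * D.weight i = ∑ i, h i := by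
  rw [sum_mul_transpose, mul_weight]
  simp

end ChainLoop

/-! ### Characters of diagonal symmetries -/

theorem expQZ_eq_one {x : QZ} : expQZ x = 1 ↔ x = 0 := by
  refine ⟨fun h => ?_, fun h => h ▸ expQZ_zero⟩
  induction x using QuotientAddGroup.induction_on with
  | H a =>
    have h' : Complex.exp (2 * Real.pi * Complex.I * (a : ℂ)) = 1 := (expQZ_coe a).symm.trans h
    obtain ⟨n, hn⟩ := Complex.exp_eq_one_iff.1 h'
    have hpi : (2 * Real.pi * Complex.I : ℂ) ≠ 0 := Complex.two_pi_I_ne_zero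
    have h1 : (a : ℂ) = n := mul_left_cancel₀ hpi (hn.trans (mul_comm _ _))
    have h2 : a = n := by exact_mod_cast h1
    refine (AddCircle.coe_eq_zero_iff (1 : ℚ)).2 ⟨n, ?_⟩
    simp [h2]

theorem expQZ_nsmul (n : ℕ) (x : QZ) : expQZ (n • x) = expQZ x ^ n := by
  induction n with
  | zero => simp [expQZ_zero]
  | succ n ih => rw [succ_nsmul, expQZ_add, ih, pow_succ]

theorem expQZ_sum {α : Type} (s : Finset α) (x : α → QZ) :
    expQZ (∑ i ∈ s, x i) = ∏ i ∈ s, expQZ (x i) := by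
  classical
  induction s using Finset.induction_on with
  | empty => simp [expQZ_zero]
  | insert i s hi ih => rw [Finset.sum_insert hi, Finset.prod_insert hi, expQZ_add, ih]

theorem eval_monomial_single {κ : Type} (x : κ → ℂ) (i : κ) (k : ℕ) (r : ℂ) :
    eval x (monomial (Finsupp.single i k) r) = r * x i ^ k := by
  rw [eval_monomial, Finsupp.prod_single_index (by simp)]

section act

variable {κ : Type} [Fintype κ]

theorem act_monomial (g : κ → QZ) (d : κ →₀ ℕ) (r : ℂ) :
    act g (monomial d r) = monomial d (expQZ (∑ i, d i • g i) * r) := by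
  rw [act, aeval_monomial, Finsupp.prod_fintype _ _ (fun i => pow_zero _), expQZ_sum]
  simp_rw [mul_pow, Finset.prod_mul_distrib, expQZ_nsmul, ← C_pow, ← map_prod]
  rw [mul_comm (∏ i, _) r, ← C_mul_monomial (a := r), monomial_eq (s := d),
    Finsupp.prod_fintype _ _ (fun i => pow_zero _)]
  simp only [algebraMap_eq, map_prod, C_pow]

theorem coeff_act (g : κ → QZ) (d : κ →₀ ℕ) (p : MvPolynomial κ ℂ) :
    coeff d (act g p) = expQZ (∑ i, d i • g i) * coeff d p := by
  classical
  induction p using MvPolynomial.induction_on' with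
  | monomial e r =>
    rw [act_monomial, coeff_monomial, coeff_monomial]
    split_ifs with h
    · rw [h]
    · simp
  | add p q hp hq => rw [map_add, coeff_add, coeff_add, hp, hq, mul_add]

theorem mem_Gmax_iff {W : MvPolynomial κ ℂ} {g : κ → QZ} :
    g ∈ Gmax W ↔ ∀ d ∈ W.support, ∑ i, d i • g i = 0 := by
  change act g W = W ↔ _
  rw [MvPolynomial.ext_iff]
  refine forall_congr' fun d => ?_
  rw [coeff_act, mem_support_iff]
  by_cases h : coeff d W = 0
  · simp [h]
  · rw [mul_eq_right₀ h, expQZ_eq_one]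
    simp [h]

end act

/-! ### Polynomials of chain and loop shape: derivatives, singularity, weights, symmetries -/

namespace ChainLoop

variable {κ : Type} (D : ChainLoop κ)

/-- The factor of the monomial of leading variable `i` coprime to that variable. -/
def tail (i : κ) : κ →₀ ℕ := (D.next i).elim 0 fun j => Finsupp.single j 1

/-- The exponent vector of the monomial of leading variable `i`. -/
def row (i : κ) : κ →₀ ℕ := Finsupp.single i (D.exp i) + D.tail i

/-- The polynomial of the given shape and coefficients. -/
def poly [Fintype κ] (c : κ → ℂ) : MvPolynomial κ ℂ := ∑ i, monomial (D.row i) (c i)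

theorem tail_of_none {i : κ} (h : D.next i = none) : D.tail i = 0 := by simp [tail, h]

theorem tail_of_some {i j : κ} (h : D.next i = some j) : D.tail i = Finsupp.single j 1 := by
  simp [tail, h]

open Classical in
theorem tail_apply (i l : κ) : D.tail i l = if D.next i = some l then 1 else 0 := by
  rcases h : D.next i with _ | j
  · simp [tail_of_none, h]
  · simp [tail_of_some, h, Finsupp.single_apply]

theorem tail_self (i : κ) : D.tail i i = 0 := by simp [tail_apply, D.next_ne]

theorem row_self (i : κ) : D.row i i = D.exp i := by
  simp [row, tail_self]

theorem row_of_ne {i l : κ} (h : l ≠ i) : D.row i l = D.tail i l := by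
  simp [row, h.symm]

theorem row_le_one {i l : κ} (h : l ≠ i) : D.row i l ≤ 1 := by
  classical
  rw [row_of_ne D h, tail_apply]
  split_ifs <;> simp

/-- The leading variable is recognized as the only one with exponent at least `2`. -/
theorem row_injective : Function.Injective D.row := by
  intro i i' h
  by_contra hne
  have h1 := D.row_le_one (Ne.symm hne)
  rw [h, row_self] at h1
  have := D.two_le i'
  omega

theorem sum_row_mul [Fintype κ] {R : Type*} [CommSemiring R] (v : κ → R) (i : κ) :
    ∑ l, (D.row i l : R) * v l = D.mul v i := by
  classical
  simp only [row, Finsupp.add_apply, Nat.cast_add, add_mul, Finset.sum_add_distrib, mul_apply,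
    tail_apply, Finsupp.single_apply]
  congr 1
  · simp
  · rcases D.next i with _ | j <;> simp

theorem sum_row_nsmul [Fintype κ] {M : Type*} [AddCommMonoid M] (v : κ → M) (i : κ) :
    ∑ l, D.row i l • v l = D.exp i • v i + (D.next i).elim 0 v := by
  classical
  simp only [row, Finsupp.add_apply, add_smul, Finset.sum_add_distrib,
    tail_apply, Finsupp.single_apply]
  congr 1
  · simp
  · rcases D.next i with _ | j <;> simp

theorem transpose_mul_single [DecidableEq κ] {R : Type*} [CommSemiring R] (i l : κ) :
    D.transpose.mul (Pi.single i (1 : R)) l = (D.row i l : R) := by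
  simp only [mul_apply, transpose_exp, Pi.single_apply]
  by_cases h : l = i
  · subst h
    rw [row_self]
    rcases h' : D.transpose.next l with _ | j
    · simp
    · have : j ≠ l := fun hj => D.transpose.next_ne l (hj ▸ h')
      simp [this]
  · rw [row_of_ne D h, tail_apply]
    simp only [h, if_false, mul_zero, zero_add]
    have h3 : D.next i = some l ↔ D.transpose.next l = some i := D.transpose_next.symm
    simp only [h3]
    rcases h' : D.transpose.next l with _ | j
    · simp
    · simp [Pi.single_apply]

variable [Fintype κ] (c : κ → ℂ)

theorem coeff_row (i : κ) : coeff (D.row i) (D.poly c) = c i := by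
  classical
  simp [poly, coeff_sum, coeff_monomial, D.row_injective.eq_iff]

theorem mem_support_poly (hc : ∀ i, c i ≠ 0) (d : κ →₀ ℕ) :
    d ∈ (D.poly c).support ↔ ∃ i, D.row i = d := by
  classical
  constructor
  · intro h
    by_contra! hne
    rw [mem_support_iff] at h
    simp [poly, coeff_sum, coeff_monomial, hne] at h
  · rintro ⟨i, rfl⟩
    rw [mem_support_iff, coeff_row]
    exact hc i

theorem card_support_poly (hc : ∀ i, c i ≠ 0) :
    (D.poly c).support.card = Fintype.card κ := by
  classical
  have : (D.poly c).support = Finset.univ.image D.row := by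
    ext d
    simp [D.mem_support_poly c hc]
  rw [this, Finset.card_image_of_injective _ D.row_injective, Finset.card_univ]

/-- Besides its own monomial, a variable occurs only in the monomial of its predecessor, and there
linearly; that monomial therefore contributes a pure power. -/
theorem pderiv_poly (i : κ) :
    pderiv i (D.poly c) = monomial (Finsupp.single i (D.exp i - 1) + D.tail i) (c i * D.exp i) +
      (D.transpose.next i).elim 0 fun j => monomial (Finsupp.single j (D.exp j)) (c j) := by
  classical
  have h1 : ∀ j, pderiv i (monomial (D.row j) (c j)) =
      (if j = i then monomial (Finsupp.single i (D.exp i - 1) + D.tail i) (c i * D.exp i) else 0) +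
        if D.transpose.next i = some j then monomial (Finsupp.single j (D.exp j)) (c j) else 0 := by
    intro j
    rw [pderiv_monomial]
    by_cases h : j = i
    · subst h
      rw [if_pos rfl, if_neg (D.transpose.next_ne j), add_zero, row_self]
      have h2 : D.row j - Finsupp.single j 1 = Finsupp.single j (D.exp j - 1) + D.tail j := by
        ext l
        by_cases hl : j = l
        · subst hl
          simp [row_self, tail_self]
        · simp [row, hl]
      rw [h2]
    · rw [if_neg h, zero_add, row_of_ne D (Ne.symm h), tail_apply]
      by_cases h2 : D.next j = some i
      · rw [if_pos h2, if_pos (D.transpose_next.2 h2), row, tail_of_some D h2,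
          add_tsub_cancel_right]
        simp
      · rw [if_neg h2, if_neg fun h3 => h2 (D.transpose_next.1 h3)]
        simp
  rw [poly, map_sum, Finset.sum_congr rfl fun j _ => h1 j, Finset.sum_add_distrib]
  congr 1
  · simp
  · rcases D.transpose.next i with _ | j <;> simp

/-- The logarithmic derivatives are the transposed exponent matrix applied to the vector of terms of
the polynomial. Its injectivity lets single monomials be extracted. -/
theorem X_mul_pderiv_poly (i : κ) :
    X i * pderiv i (D.poly c) = monomial (D.row i) (c i * D.exp i) +
      (D.transpose.next i).elim 0 fun j => monomial (D.row j) (c j) := by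
  rw [pderiv_poly, mul_add, X, monomial_mul, one_mul]
  congr 1
  · congr 1
    have h2 : 1 + (D.exp i - 1) = D.exp i := by have := D.two_le i; omega
    rw [row, ← add_assoc, ← Finsupp.single_add, h2]
  · rcases h : D.transpose.next i with _ | j
    · simp
    · simp only [Option.elim, monomial_mul, one_mul]
      rw [row, tail_of_some D (D.transpose_next.1 h), add_comm]

/-- At a critical point the transposed matrix kills the vector of values of the terms, so every
monomial vanishes. If `x i ≠ 0`, the tail variable `x j` must then be zero, and `∂_j` reduces to `c
i * x i ^ exp i`, which is nonzero. -/
theorem eq_zero_of_eval_pderiv (hc : ∀ i, c i ≠ 0) (x : κ → ℂ)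
    (hx : ∀ i, eval x (pderiv i (D.poly c)) = 0) : x = 0 := by
  have hM : (fun i => c i * eval x (monomial (D.row i) 1)) = 0 := by
    apply D.transpose.mul_injective_complex
    rw [map_zero]
    ext i
    have h1 : eval x (X i * pderiv i (D.poly c)) = 0 := by rw [map_mul, hx, mul_zero]
    rw [X_mul_pderiv_poly, map_add, ← mul_one (c i * _), ← C_mul_monomial, map_mul, eval_C] at h1
    rw [mul_apply, Pi.zero_apply, transpose_exp]
    refine Eq.trans ?_ h1
    congr 1
    · ring
    · rcases D.transpose.next i with _ | j
      · simp
      · simp only [Option.elim]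
        rw [← mul_one (c j), ← C_mul_monomial, map_mul, eval_C, mul_one]
  ext i
  by_contra hxi
  have h1 : eval x (monomial (D.row i) 1) = 0 := by
    have := congrFun hM i
    simpa [hc i] using this
  have hk : ∀ k : ℕ, eval x (monomial (Finsupp.single i k) (1 : ℂ)) = x i ^ k := by
    intro k
    simp [eval_monomial]
  rw [row, ← one_mul (1 : ℂ), ← monomial_mul, map_mul, hk] at h1
  have h2 := (mul_eq_zero.1 h1).resolve_left (pow_ne_zero _ hxi)
  rcases h : D.next i with _ | j
  · simp [tail_of_none D h] at h2
  · rw [tail_of_some D h] at h2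
    have hxj : x j = 0 := by simpa [eval_monomial] using h2
    have h3 := hx j
    have h4 : eval x (monomial (Finsupp.single j (D.exp j - 1) + D.tail j) (c j * D.exp j)) =
        0 := by
      rw [← mul_one (c j * _), ← monomial_mul, map_mul, eval_monomial_single, hxj,
        zero_pow (by have := D.two_le j; omega),
        mul_zero, zero_mul]
    rw [pderiv_poly, map_add, h4, zero_add, D.transpose_next.2 h] at h3
    simp only [Option.elim] at h3
    rw [eval_monomial_single] at h3
    exact mul_ne_zero (hc i) (pow_ne_zero _ hxi) h3

theorem hasIsolatedSingularity_poly (hc : ∀ i, c i ≠ 0) : HasIsolatedSingularity (D.poly c) := by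
  classical
  refine ⟨fun i => ?_, Filter.eventually_of_mem self_mem_nhdsWithin fun x hx => ?_⟩
  · rw [pderiv_poly, map_add, ← mul_one (c i * _), ← monomial_mul, map_mul, eval_monomial_single,
      Pi.zero_apply,
      zero_pow (by have := D.two_le i; omega), mul_zero, zero_mul, zero_add]
    rcases D.transpose.next i with _ | j
    · simp
    · simp only [Option.elim]
      rw [eval_monomial_single,
      Pi.zero_apply,
        zero_pow (by have := D.two_le j; omega), mul_zero]
  · by_contra! h
    exact hx (D.eq_zero_of_eval_pderiv c hc x h)

/-- Homogeneity of degree one is the linear system `A q = 1`, whose unique solution is automatically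
positive. -/
theorem isWeightSystem_poly (hc : ∀ i, c i ≠ 0) (q : κ → ℚ) :
    IsWeightSystem (D.poly c) q ↔ q = D.weight := by
  have key : IsWeightedHomogeneous q (D.poly c) 1 ↔ q = D.weight := by
    rw [weight, LinearEquiv.eq_symm_apply, mulEquiv_apply]
    have hw : ∀ i, Finsupp.weight q (D.row i) = D.mul q i := fun i => by
      rw [Finsupp.weight_apply, Finsupp.sum_fintype _ _ (by simp), ← sum_row_mul]
      simp
    constructor
    · intro h
      ext i
      rw [← hw]
      exact h (by rw [coeff_row]; exact hc i)
    · intro h d hd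
      obtain ⟨i, rfl⟩ := (D.mem_support_poly c hc d).1 (mem_support_iff.2 hd)
      rw [hw, h, Pi.one_apply]
  rw [IsWeightSystem, key]
  refine ⟨fun h => h.2, fun h => ⟨fun i => ?_, h⟩⟩
  rw [h]
  exact (D.weight_bounds i).1

theorem weights_poly (hc : ∀ i, c i ≠ 0) : weights (D.poly c) = D.weight := by
  have h : ∃ q, IsWeightSystem (D.poly c) q := ⟨_, (D.isWeightSystem_poly c hc _).2 rfl⟩
  rw [weights, dif_pos h]
  exact (D.isWeightSystem_poly c hc _).1 h.choose_spec

theorem isInvertible_poly (hc : ∀ i, c i ≠ 0) : IsInvertible (D.poly c) :=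
  ⟨⟨D.hasIsolatedSingularity_poly c hc, D.weight, (D.isWeightSystem_poly c hc _).2 rfl,
    fun _ h => (D.isWeightSystem_poly c hc _).1 h⟩, D.card_support_poly c hc⟩

theorem mem_Gmax_poly (hc : ∀ i, c i ≠ 0) {g : κ → QZ} :
    g ∈ Gmax (D.poly c) ↔ ∀ i, D.exp i • g i + (D.next i).elim 0 g = 0 := by
  rw [mem_Gmax_iff]
  constructor
  · intro h i
    rw [← sum_row_nsmul]
    exact h _ ((D.mem_support_poly c hc _).2 ⟨i, rfl⟩)
  · intro h d hd
    obtain ⟨i, rfl⟩ := (D.mem_support_poly c hc d).1 hd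
    rw [sum_row_nsmul]
    exact h i

end ChainLoop

/-! ### Monomials spanning the Milnor ring -/

namespace ChainLoop

variable {κ : Type} [Fintype κ] (D : ChainLoop κ)

/-- The vectors `h` for which the monomials `x ^ (Aᵀ h - 1)` form a basis of the Milnor ring. -/
structure IsBasic (h : κ → ℚ) : Prop where
  nonneg : ∀ i, 0 ≤ h i
  le_one : ∀ i, h i ≤ 1
  integral : ∀ i, ∃ n : ℕ, D.transpose.mul h i = n + 1
  eq_one : ∀ i, h i = 1 → ∃ j, D.next i = some j ∧ h j = 0

/-- The exponent vector `Aᵀ h - 1`. -/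
def mon (h : κ → ℚ) : κ →₀ ℕ :=
  Finsupp.equivFunOnFinite.symm fun i => ⌊D.transpose.mul h i⌋₊ - 1

variable {D} in
theorem mon_add_one {h : κ → ℚ} (hint : ∀ i, ∃ n : ℕ, D.transpose.mul h i = n + 1) (i : κ) :
    (D.mon h i : ℚ) + 1 = D.transpose.mul h i := by
  obtain ⟨n, hn⟩ := hint i
  have h1 : ⌊(n + 1 : ℚ)⌋₊ = n + 1 := by exact_mod_cast Nat.floor_natCast (R := ℚ) (n + 1)
  simp [mon, hn, h1]

/-- The vector `h` with `Aᵀ h = m + 1`. -/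
def vec (m : κ →₀ ℕ) : κ → ℚ := D.transpose.mulEquiv.symm fun i => m i + 1

theorem mul_vec (m : κ →₀ ℕ) (i : κ) : D.transpose.mul (D.vec m) i = m i + 1 :=
  congrFun (D.transpose.mul_mulEquiv_symm _) i

variable {D} in
theorem eq_vec {h : κ → ℚ} {m : κ →₀ ℕ} (hm : ∀ i, D.transpose.mul h i = m i + 1) :
    h = D.vec m :=
  D.transpose.mul_injective (funext fun i => (hm i).trans (D.mul_vec m i).symm)

/-- `Aᵀ` sends the unit vector at `i` to the exponent vector led by `i`. Hence the two terms of a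
multiple of a partial derivative have vectors differing by a unit moved along an edge. -/
theorem vec_move [DecidableEq κ] {m m' : κ →₀ ℕ} {i j : κ} (h : m + D.row j = m' + D.row i) :
    D.vec m' = D.vec m + Pi.single j 1 - Pi.single i 1 := by
  refine (eq_vec fun l => ?_).symm
  rw [map_sub, map_add, Pi.sub_apply, Pi.add_apply, transpose_mul_single, transpose_mul_single,
    mul_vec]
  have h1 : (m l : ℚ) + D.row j l = m' l + D.row i l := by exact_mod_cast DFunLike.congr_fun h l
  linarith

theorem sum_sq_move [DecidableEq κ] (h : κ → ℚ) {i j : κ} (hij : i ≠ j) :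
    ∑ l, (h + Pi.single j 1 - Pi.single i 1 : κ → ℚ) l ^ 2 =
      ∑ l, h l ^ 2 + 2 * (h j - h i) + 2 := by
  have h1 : ∀ l, (h + Pi.single j 1 - Pi.single i 1 : κ → ℚ) l ^ 2 = h l ^ 2 +
      (if l = j then 2 * h l + 1 else 0) + (if l = i then 1 - 2 * h l else 0) := by
    intro l
    simp only [Pi.sub_apply, Pi.add_apply, Pi.single_apply]
    by_cases hj : l = j
    · by_cases hi : l = i
      · exact absurd (hi.symm.trans hj) hij
      · simp [hj, hij.symm]
        ring
    · by_cases hi : l = i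
      · simp [hi, hij]
        ring
      · simp [hi, hj]
  simp_rw [h1, Finset.sum_add_distrib]
  simp
  ring

variable (c : κ → ℂ)

/-- The values on monomials of a linear form vanishing on the Jacobian ideal. -/
def Annihilates (ℓ : (κ →₀ ℕ) → ℂ) : Prop :=
  ∀ i n, c i * D.exp i * ℓ (n + Finsupp.single i (D.exp i - 1) + D.tail i) +
    (D.transpose.next i).elim 0 (fun j => c j * ℓ (n + Finsupp.single j (D.exp j))) = 0

theorem annihilates_of_jacobianIdeal (ℓ : MvPolynomial κ ℂ →ₗ[ℂ] ℂ)
    (h : ∀ p ∈ jacobianIdeal (D.poly c), ℓ p = 0) :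
    D.Annihilates c fun m => ℓ (monomial m 1) := by
  intro i n
  have h1 := h _ (Ideal.mul_mem_left _ (monomial n 1) (Ideal.subset_span ⟨i, rfl⟩))
  simp only [pderiv_poly, mul_add, map_add, monomial_mul, one_mul, ← add_assoc] at h1
  rw [← mul_one (c i * _), ← smul_eq_mul (c i * _), ← smul_monomial, map_smul] at h1
  refine Eq.trans ?_ h1
  congr 1
  rcases D.transpose.next i with _ | j
  · simp
  · simp only [Option.elim, monomial_mul, one_mul]
    rw [← mul_one (c j), ← smul_eq_mul (c j) 1, ← smul_monomial, map_smul]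
    simp

/-- The polynomials all of whose multiples are killed by `ℓ` form an ideal, so it suffices to test
monomial multiples of the generators. -/
theorem jacobianIdeal_of_annihilates (ℓ : MvPolynomial κ ℂ →ₗ[ℂ] ℂ)
    (h : D.Annihilates c fun m => ℓ (monomial m 1)) :
    ∀ p ∈ jacobianIdeal (D.poly c), ℓ p = 0 := by
  let I : Ideal (MvPolynomial κ ℂ) :=
    { carrier := {p | ∀ r, ℓ (r * p) = 0}
      add_mem' := fun ha hb r => by rw [mul_add, map_add, ha, hb, add_zero]
      zero_mem' := fun r => by simp
      smul_mem' := fun s p hp r => by rw [smul_eq_mul, ← mul_assoc]; exact hp _ }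
  have hle : jacobianIdeal (D.poly c) ≤ I := by
    refine Ideal.span_le.2 ?_
    rintro _ ⟨i, rfl⟩ r
    induction r using MvPolynomial.induction_on' with
    | add p q hp hq => rw [add_mul, map_add, hp, hq, add_zero]
    | monomial n s =>
      have h1 := h i n
      rw [← mul_one s, ← smul_eq_mul s 1, ← smul_monomial, smul_mul_assoc, map_smul]
      refine smul_eq_zero_of_right _ (Eq.trans ?_ h1)
      simp only [pderiv_poly, mul_add, map_add, monomial_mul, one_mul, ← add_assoc]
      rw [← mul_one (c i * _), ← smul_eq_mul (c i * _), ← smul_monomial, map_smul]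
      congr 1
      · simp
      rcases hj : D.transpose.next i with _ | j
      · simp
      · simp only [Option.elim, monomial_mul, one_mul]
        rw [← mul_one (c j), ← smul_eq_mul (c j) 1, ← smul_monomial, map_smul]
        simp
  intro p hp
  have := hle hp 1
  rwa [one_mul] at this

variable {D c}

/-- The relations coming from `x_i ∂_i` say that `Aᵀ` kills the vector `c i * ℓ (n + row i)`.
Consequently multiples of a single monomial of the polynomial contribute nothing. -/
theorem Annihilates.add_row {ℓ : (κ →₀ ℕ) → ℂ} (hℓ : D.Annihilates c ℓ) (hc : ∀ i, c i ≠ 0)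
    (n : κ →₀ ℕ) (i : κ) : ℓ (n + D.row i) = 0 := by
  have hv : (fun i => c i * ℓ (n + D.row i)) = 0 := by
    apply D.transpose.mul_injective_complex
    rw [map_zero]
    ext i
    rw [mul_apply, Pi.zero_apply]
    refine Eq.trans ?_ (hℓ i (n + Finsupp.single i 1))
    congr 1
    · have h2 : 1 + (D.exp i - 1) = D.exp i := by have := D.two_le i; omega
      rw [add_assoc n, ← Finsupp.single_add, h2, add_assoc, transpose_exp, row]
      ring
    · rcases h : D.transpose.next i with _ | j
      · simp
      · simp only [Option.elim]
        rw [row, tail_of_some D (D.transpose_next.1 h), add_assoc,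
          add_comm (Finsupp.single i 1)]
  have := congrFun hv i
  simpa [hc i] using this

/-- The sum is the weighted degree of the form, and the weights are positive. -/
theorem finite_sum_vec (D : ChainLoop κ) (C : ℚ) : {m | ∑ i, D.vec m i = C}.Finite := by
  classical
  refine (Set.finite_Icc (0 : κ →₀ ℕ)
    (Finsupp.equivFunOnFinite.symm fun i => ⌈C / D.weight i⌉₊)).subset fun m hm => ?_
  refine ⟨zero_le, fun i => ?_⟩
  have hq := fun i => (D.weight_bounds i).1
  have h1 : ∑ l, ((m l : ℚ) + 1) * D.weight l = C := by
    rw [← show _ = C from hm, ← D.sum_weight_mul_transpose (D.vec m)]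
    exact Finset.sum_congr rfl fun l _ => by rw [mul_vec]
  have h2 : ((m i : ℚ) + 1) * D.weight i ≤ C := by
    rw [← h1]
    exact Finset.single_le_sum (f := fun l => ((m l : ℚ) + 1) * D.weight l)
      (fun l _ => by have := hq l; positivity) (Finset.mem_univ i)
  have h3 : (m i : ℚ) ≤ C / D.weight i := by
    rw [le_div_iff₀ (hq i)]
    nlinarith [hq i]
  have h4 : (m i : ℚ) ≤ (⌈C / D.weight i⌉₊ : ℚ) := h3.trans (Nat.le_ceil _)
  simpa using (Nat.cast_le (α := ℚ)).1 h4

/-- In the degree of `m₀`, take a monomial not annihilated with `∑ h²` minimal and, among those, `F`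
maximal. Finiteness of the degree makes both choices possible. -/
theorem exists_extremal (D : ChainLoop κ) (ℓ : (κ →₀ ℕ) → ℂ) (F : (κ →₀ ℕ) → ℝ)
    {m₀ : κ →₀ ℕ} (h₀ : ℓ m₀ ≠ 0) :
    ∃ m, ℓ m ≠ 0 ∧ ∀ m', ℓ m' ≠ 0 → ∑ i, D.vec m' i = ∑ i, D.vec m i →
      ∑ i, D.vec m i ^ 2 ≤ ∑ i, D.vec m' i ^ 2 ∧
        (∑ i, D.vec m' i ^ 2 = ∑ i, D.vec m i ^ 2 → F m' ≤ F m) := by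
  let S : Set (κ →₀ ℕ) := {m | ℓ m ≠ 0 ∧ ∑ i, D.vec m i = ∑ i, D.vec m₀ i}
  have hS : S.Finite := (D.finite_sum_vec _).subset fun m hm => hm.2
  obtain ⟨m₁, hm₁, hmin⟩ := Set.exists_min_image S (fun m => ∑ i, D.vec m i ^ 2) hS ⟨m₀, h₀, rfl⟩
  let S' : Set (κ →₀ ℕ) := {m | m ∈ S ∧ ∑ i, D.vec m i ^ 2 = ∑ i, D.vec m₁ i ^ 2}
  obtain ⟨m, hm, hmax⟩ := Set.exists_max_image S' F (hS.subset fun m hm => hm.1) ⟨m₁, hm₁, rfl⟩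
  refine ⟨m, hm.1.1, fun m' h' hs => ?_⟩
  have hm' : m' ∈ S := ⟨h', hs.trans hm.1.2⟩
  exact ⟨hm.2.trans_le (hmin m' hm'), fun he => hmax m' ⟨hm', he.trans hm.2⟩⟩

/-- At an extremal surviving monomial the vector `h` is shown to be basic. A relation from a partial
derivative replaces `m` by a monomial whose `h` has a unit moved along an edge; minimality of `∑ h²`
bounds the difference of the two entries and confines `h` to `[0, 1]`. When the move only switches a
`1` and a `0`, the sum of squares does not decide. The tie is broken by `‖ℓ m‖` weighted by `∏ ‖c i‖
^ h i`, a factor that absorbs the coefficients and leaves the growth by `exp i ≥ 2`. -/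
theorem Annihilates.eq_zero {ℓ : (κ →₀ ℕ) → ℂ} (hℓ : D.Annihilates c ℓ) (hc : ∀ i, c i ≠ 0)
    (hb : ∀ h, D.IsBasic h → ℓ (D.mon h) = 0) (m₀ : κ →₀ ℕ) : ℓ m₀ = 0 := by
  classical
  by_contra h₀
  obtain ⟨m, hm, hext⟩ := D.exists_extremal ℓ
    (fun m => ‖ℓ m‖ * Real.exp (∑ i, (D.vec m i : ℝ) * Real.log ‖c i‖)) h₀
  set h := D.vec m with hdef
  have hu : ∀ i, D.exp i * h i + (D.transpose.next i).elim 0 h = m i + 1 := D.mul_vec m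
  have ha : ∀ i, (2 : ℚ) ≤ D.exp i := fun i => by exact_mod_cast D.two_le i
  -- moving along an edge
  have hmove : ∀ m' i j, i ≠ j → m + D.row j = m' + D.row i → ℓ m' ≠ 0 → h i - h j ≤ 1 := by
    intro m' i j hij he hne
    have hv := D.vec_move he
    have h1 := (hext m' hne (by rw [hv]; simp [Finset.sum_add_distrib, hdef])).1
    rw [hv, sum_sq_move _ hij, ← hdef] at h1
    linarith
  -- If `x_i ^ exp i` divides `x^m`, then the tail variable `x_j` exists and does not divide it, by
  -- `Annihilates.add_row`. The pure power `x_i ^ exp i` in `∂_j` then yields a second surviving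
  -- monomial.
  have hA : ∀ i, D.exp i ≤ m i → ∃ j, D.next i = some j ∧ m j = 0 ∧ h i - h j ≤ 1 := by
    intro i hi
    have hsplit : m = (m - Finsupp.single i (D.exp i)) + Finsupp.single i (D.exp i) :=
      (tsub_add_cancel_of_le (Finsupp.single_le_iff.2 hi)).symm
    rcases hn : D.next i with _ | j
    · refine absurd ?_ hm
      have := hℓ.add_row hc (m - Finsupp.single i (D.exp i)) i
      rwa [row, tail_of_none D hn, add_zero, ← hsplit] at this
    · have hij : i ≠ j := fun e => D.next_ne i (e ▸ hn)
      refine ⟨j, rfl, ?_, ?_⟩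
      · by_contra hmj
        refine hm ?_
        have hle : D.row i ≤ m := by
          intro l
          rw [row, tail_of_some D hn, Finsupp.add_apply]
          by_cases h1 : l = i
          · subst h1
            simpa [Finsupp.single_apply, hij.symm] using hi
          · by_cases h2 : l = j
            · subst h2
              simp [hij]
              omega
            · simp [Ne.symm h1, Ne.symm h2]
        rw [← tsub_add_cancel_of_le hle]
        exact hℓ.add_row hc _ i
      · set n := m - Finsupp.single i (D.exp i) with hn'
        have hrel := hℓ j n
        rw [D.transpose_next.2 hn] at hrel
        simp only [Option.elim] at hrel
        rw [← hsplit] at hrel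
        refine hmove (n + Finsupp.single j (D.exp j - 1) + D.tail j) i j hij ?_ fun h0 => ?_
        · have h2 : D.exp j = D.exp j - 1 + 1 := by have := D.two_le j; omega
          rw [row, row, tail_of_some D hn, hsplit, h2, Finsupp.single_add, Nat.add_sub_cancel]
          abel
        · rw [h0, mul_zero, zero_add] at hrel
          exact mul_ne_zero (hc i) hm hrel
  have hA' : ∀ i, D.exp i ≤ m i →
      ∃ j, D.next i = some j ∧ D.exp j * h j + h i = 1 ∧ h i - h j ≤ 1 := by
    intro i hi
    obtain ⟨j, h1, h2, h3⟩ := hA i hi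
    have h4 := hu j
    rw [D.transpose_next.2 h1, h2] at h4
    exact ⟨j, h1, by simpa using h4, h3⟩
  have hle : ∀ i, h i ≤ 1 := by
    intro i₀
    obtain ⟨i, -, hmax⟩ := Finset.exists_max_image Finset.univ h ⟨i₀, Finset.mem_univ _⟩
    refine (hmax i₀ (Finset.mem_univ _)).trans ?_
    by_contra! hi
    rcases le_or_gt (D.exp i) (m i) with hle | hlt
    · obtain ⟨j, -, h2, h3⟩ := hA' i hle
      nlinarith [ha j]
    -- With `h i > 1` maximal, the predecessor `p` has `h p ≤ -2 (h i - 1)`, and the predecessor of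
    -- `p` must then have an entry at least `1 + 4 (h i - 1)`, exceeding the maximum.
    · have h1 : (m i : ℚ) + 1 ≤ D.exp i := by exact_mod_cast hlt
      have h2 := hu i
      rcases hp : D.transpose.next i with _ | p
      · simp only [hp, Option.elim] at h2
        nlinarith [ha i]
      · simp only [hp, Option.elim] at h2
        have h3 := hu p
        have h4 : h p ≤ -(2 * (h i - 1)) := by nlinarith [ha i]
        have h5 : 1 + 2 * (2 * (h i - 1)) ≤ (D.transpose.next p).elim 0 h := by
          have : (0 : ℚ) ≤ m p := Nat.cast_nonneg _
          nlinarith [ha p]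
        rcases hs : D.transpose.next p with _ | s
        · simp only [hs, Option.elim] at h5
          linarith
        · simp only [hs, Option.elim] at h5
          linarith [hmax s (Finset.mem_univ _)]
  have hnn : ∀ i, 0 ≤ h i := by
    intro i
    by_contra! hi
    have h1 := hu i
    have h2 : (D.transpose.next i).elim 0 h ≤ 1 := by
      rcases D.transpose.next i with _ | p
      · simp
      · exact hle p
    have : (0 : ℚ) ≤ m i := Nat.cast_nonneg _
    nlinarith [ha i]
  have hone : ∀ i, h i = 1 → ∃ j, D.next i = some j ∧ h j = 0 := by
    intro i hi
    rcases le_or_gt (D.exp i) (m i) with hle' | hlt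
    · obtain ⟨j, h1, h2, -⟩ := hA' i hle'
      refine ⟨j, h1, ?_⟩
      rw [hi] at h2
      have := ha j
      have h3 : (D.exp j : ℚ) * h j = 0 := by linarith
      exact (mul_eq_zero.1 h3).resolve_left (by linarith)
    · by_contra! hcon
      have h1 : (m i : ℚ) + 1 ≤ D.exp i := by exact_mod_cast hlt
      have h2 := hu i
      rw [hi, mul_one] at h2
      have h3 : 0 ≤ (D.transpose.next i).elim 0 h := by
        rcases D.transpose.next i with _ | p
        · simp
        · exact hnn p
      have hmi : m i = D.exp i - 1 := by
        have : (m i : ℚ) + 1 = D.exp i := by linarith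
        have : m i + 1 = D.exp i := by exact_mod_cast this
        omega
      -- The assumed failure makes `h` positive at the tail variable `l`. Since its predecessor `i`
      -- has `h i = 1`, this forces `m l > 0`, so the leading term of `∂_i` divides `x^m`.
      have hle' : Finsupp.single i (D.exp i - 1) + D.tail i ≤ m := by
        intro l
        rw [Finsupp.add_apply]
        by_cases hl : l = i
        · subst hl
          simp [tail_self, hmi]
        · rw [Finsupp.single_apply, if_neg (Ne.symm hl), zero_add, tail_apply]
          split_ifs with hnx
          · have h5 := hu l
            rw [D.transpose_next.2 hnx] at h5
            simp only [Option.elim] at h5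
            have h6 : 0 < h l := (hnn l).lt_of_ne (Ne.symm (hcon l hnx))
            have h7 : (0 : ℚ) < m l := by nlinarith [ha l]
            exact_mod_cast h7
          · exact Nat.zero_le _
      set n := m - (Finsupp.single i (D.exp i - 1) + D.tail i) with hn'
      have hsplit : n + Finsupp.single i (D.exp i - 1) + D.tail i = m := by
        rw [add_assoc]
        exact tsub_add_cancel_of_le hle'
      have hrel := hℓ i n
      rw [hsplit] at hrel
      have hai : (D.exp i : ℂ) ≠ 0 := by
        have := D.two_le i
        exact_mod_cast (by omega : D.exp i ≠ 0)
      rcases hp : D.transpose.next i with _ | p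
      · rw [hp] at hrel
        simp only [Option.elim, add_zero] at hrel
        exact mul_ne_zero (mul_ne_zero (hc i) hai) hm hrel
      · rw [hp] at hrel h2 h3
        simp only [Option.elim] at hrel h2 h3
        have hpi : D.next p = some i := D.transpose_next.1 hp
        have hp0 : h p = 0 := by linarith
        have hip : i ≠ p := fun e => D.next_ne p (by rw [hpi, e])
        have hne : ℓ (n + Finsupp.single p (D.exp p)) ≠ 0 := by
          intro h0
          rw [h0, mul_zero, add_zero] at hrel
          exact mul_ne_zero (mul_ne_zero (hc i) hai) hm hrel
        have hv := D.vec_move (m := m) (m' := n + Finsupp.single p (D.exp p)) (i := i) (j := p) (by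
          have h2 : D.exp i = D.exp i - 1 + 1 := by have := D.two_le i; omega
          rw [row, row, tail_of_some D hpi, ← hsplit, h2, Finsupp.single_add, Nat.add_sub_cancel]
          abel)
        -- Moving the unit from `h i = 1` to `h p = 0` keeps the sum of squares, so the secondary
        -- maximality applies.
        have hx := (hext _ hne (by rw [hv]; simp [Finset.sum_add_distrib, hdef])).2 (by
          rw [hv, sum_sq_move _ hip, ← hdef, hp0, hi]
          ring)
        rw [hv, ← hdef] at hx
        have hlog : ∑ l, (((h + Pi.single p 1 - Pi.single i 1 : κ → ℚ) l : ℚ) : ℝ) *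
            Real.log ‖c l‖ = ∑ l, (h l : ℝ) * Real.log ‖c l‖ + Real.log ‖c p‖ -
              Real.log ‖c i‖ := by
          have h1 : ∀ l, (((h + Pi.single p 1 - Pi.single i 1 : κ → ℚ) l : ℚ) : ℝ) *
              Real.log ‖c l‖ = h l * Real.log ‖c l‖ + (if l = p then Real.log ‖c l‖ else 0) -
                (if l = i then Real.log ‖c l‖ else 0) := by
            intro l
            simp only [Pi.sub_apply, Pi.add_apply, Pi.single_apply]
            split_ifs <;> push_cast <;> ring
          simp_rw [h1, Finset.sum_sub_distrib, Finset.sum_add_distrib]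
          simp
        rw [hlog, add_sub_assoc, Real.exp_add, Real.exp_sub,
          Real.exp_log (norm_pos_iff.2 (hc p)), Real.exp_log (norm_pos_iff.2 (hc i))] at hx
        have hnorm : ‖c i‖ * D.exp i * ‖ℓ m‖ = ‖c p‖ * ‖ℓ (n + Finsupp.single p (D.exp p))‖ := by
          have := congrArg norm (eq_neg_of_add_eq_zero_left hrel)
          simpa using this
        set Ex := Real.exp (∑ l, (h l : ℝ) * Real.log ‖c l‖) with hEx
        have hExp : 0 < Ex := Real.exp_pos _
        have hci := norm_pos_iff.2 (hc i)
        -- The relation of `∂_i` makes the weighted value exactly `exp i` times larger,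
        -- contradicting maximality.
        have h9 : ‖ℓ (n + Finsupp.single p (D.exp p))‖ * (Ex * (‖c p‖ / ‖c i‖)) =
            D.exp i * (‖ℓ m‖ * Ex) := by
          field_simp
          linear_combination (-1 : ℝ) * hnorm
        rw [h9] at hx
        have h10 : 0 < ‖ℓ m‖ * Ex := mul_pos (norm_pos_iff.2 hm) hExp
        have h11 : (2 : ℝ) ≤ D.exp i := by exact_mod_cast D.two_le i
        nlinarith
  have hbasic : D.IsBasic h := ⟨hnn, hle, fun i => ⟨m i, hu i⟩, hone⟩
  have hmon : D.mon h = m := by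
    ext i
    have h1 := mon_add_one hbasic.integral i
    have h2 : (D.mon h i : ℚ) + 1 = m i + 1 := h1.trans (hu i)
    exact_mod_cast add_right_cancel h2
  exact hm (hmon ▸ hb h hbasic)

end ChainLoop

/-! ### Dual forms and linear independence -/

namespace ChainLoop

variable {κ : Type} [Fintype κ] {D : ChainLoop κ}

/-- A negative entry at `i` must be compensated by an entry at least as positive at the predecessor
of `i`. Predecessors are distinct and the total is zero, so all these inequalities are equalities:
`k` is a sum of disjoint unit moves along edges. -/
theorem shift_structure (D : ChainLoop κ) {u k : κ → ℤ} (hu : ∀ i, u i ≤ D.exp i)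
    (hk : ∑ i, k i = 0)
    (hpos : ∀ i, 1 ≤ u i + D.transpose.mul k i) :
    (∀ i, k i < 0 → k i = -1 ∧ u i = D.exp i ∧ ∃ j, D.next j = some i ∧ k j = 1) ∧
      ∀ j, 0 < k j → k j = 1 ∧ ∃ i, D.next j = some i ∧ k i = -1 := by
  have ha : ∀ i, (2 : ℤ) ≤ D.exp i := fun i => by exact_mod_cast D.two_le i
  have hneg : ∀ i, k i < 0 → ∃ j, D.next j = some i ∧
      (-k i - 1) * D.exp i + 1 + (D.exp i - u i) ≤ k j := by
    intro i hi
    have h1 := hpos i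
    rw [mul_apply, transpose_exp] at h1
    rcases hj : D.transpose.next i with _ | j
    · rw [hj] at h1
      simp only [Option.elim] at h1
      nlinarith [ha i, hu i]
    · rw [hj] at h1
      simp only [Option.elim] at h1
      exact ⟨j, D.transpose_next.1 hj, by linarith⟩
  set F : κ → ℤ := fun j => max (k j) 0 - (D.next j).elim 0 fun i => max (-k i) 0 with hF
  have hge : ∀ i j, D.next j = some i → k i < 0 → -k i ≤ k j := by
    intro i j hji hi
    obtain ⟨j', hj', h2⟩ := hneg i hi
    rw [D.next_inj hji hj']
    nlinarith [ha i, hu i]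
  have hF0 : ∀ j, 0 ≤ F j := by
    intro j
    rcases hj : D.next j with _ | i
    · simp [hF, hj]
    · simp only [hF, hj, Option.elim]
      rcases lt_or_ge (k i) 0 with hi | hi
      · have := hge i j hj hi
        rw [max_eq_left (by omega : 0 ≤ -k i)]
        have := le_max_left (k j) 0
        omega
      · rw [max_eq_right (by omega : -k i ≤ 0)]
        have := le_max_right (k j) 0
        omega
  have hFsum : ∑ j, F j = 0 := by
    have h1 := D.sum_elim (fun i => max (-k i) 0) (fun _ => 1)
    simp only [one_mul] at h1
    have h2 : ∀ i, (D.transpose.next i).elim 0 (fun _ => (1 : ℤ)) * max (-k i) 0 =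
        max (-k i) 0 := by
      intro i
      rcases lt_or_ge (k i) 0 with hi | hi
      · obtain ⟨j, hj, -⟩ := hneg i hi
        simp [D.transpose_next.2 hj]
      · rw [max_eq_right (by omega : -k i ≤ 0), mul_zero]
    rw [hF, Finset.sum_sub_distrib, h1, Finset.sum_congr rfl fun i _ => h2 i,
      ← Finset.sum_sub_distrib]
    refine Eq.trans ?_ hk
    refine Finset.sum_congr rfl fun i _ => ?_
    rcases lt_or_ge (k i) 0 with hi | hi
    · rw [max_eq_right hi.le, max_eq_left (by omega)]
      ring
    · rw [max_eq_left hi, max_eq_right (by omega)]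
      ring
  have hFz : ∀ j, F j = 0 := fun j =>
    (Finset.sum_eq_zero_iff_of_nonneg fun i _ => hF0 i).1 hFsum j (Finset.mem_univ j)
  have hlow : ∀ i, k i < 0 → k i = -1 ∧ u i = D.exp i ∧ ∃ j, D.next j = some i ∧ k j = 1 := by
    intro i hi
    obtain ⟨j, hj, h1⟩ := hneg i hi
    have h2 := hFz j
    have h3 := hge i j hj hi
    simp only [hF, hj, Option.elim] at h2
    rw [max_eq_left (by omega), max_eq_left (by omega)] at h2
    have h4 : k i = -1 := by nlinarith [ha i, hu i]
    have h5 := hu i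
    rw [h4] at h1 h2
    exact ⟨h4, by omega, j, hj, by omega⟩
  refine ⟨hlow, fun j hj => ?_⟩
  have h2 := hFz j
  rcases hi : D.next j with _ | i
  · simp only [hF, hi, Option.elim] at h2
    rw [max_eq_left hj.le] at h2
    omega
  · simp only [hF, hi, Option.elim] at h2
    rw [max_eq_left hj.le] at h2
    have h3 : k i < 0 := by
      by_contra h4
      rw [max_eq_right (by omega)] at h2
      omega
    obtain ⟨h4, -, -⟩ := hlow i h3
    rw [h4] at h2
    simp only [neg_neg] at h2
    norm_num at h2
    exact ⟨by omega, i, rfl, h4⟩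

/-- For `h i < 1` this is `a h_i + h_p < a + 1`. For `h i = 1` the predecessor cannot also have
entry `1`, since that would require `h i = 0`. -/
theorem IsBasic.mon_add_one_le {h : κ → ℚ} (hb : D.IsBasic h) (i : κ) :
    D.mon h i + 1 ≤ D.exp i := by
  have h1 := mon_add_one hb.integral i
  rw [mul_apply, transpose_exp] at h1
  have ha : (0 : ℚ) < D.exp i := by have := D.two_le i; exact_mod_cast (by omega : 0 < D.exp i)
  rcases (hb.le_one i).lt_or_eq with hlt | heq
  · have h2 : (D.transpose.next i).elim 0 h ≤ 1 := by
      rcases D.transpose.next i with _ | p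
      · simp
      · exact hb.le_one p
    have h3 : (D.mon h i : ℚ) < D.exp i := by nlinarith
    exact_mod_cast h3
  · rw [heq, mul_one] at h1
    rcases hp : D.transpose.next i with _ | p
    · rw [hp] at h1
      simp only [Option.elim, add_zero] at h1
      exact_mod_cast h1.le
    · rw [hp] at h1
      simp only [Option.elim] at h1
      have h2 : h p < 1 := by
        refine (hb.le_one p).lt_of_ne fun h3 => ?_
        obtain ⟨j, hj, hj0⟩ := hb.eq_one p h3
        rw [D.transpose_next.1 hp, Option.some_inj] at hj
        rw [← hj, heq] at hj0
        exact one_ne_zero hj0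
      have h3 : (D.mon h i : ℚ) < D.exp i := by linarith
      exact_mod_cast h3

/-- `m` lies in the class of `h`: the vector of `m` differs from `h` by an integral vector of sum
zero. -/
def IsShift (D : ChainLoop κ) (h : κ → ℚ) (m : κ →₀ ℕ) (k : κ → ℤ) : Prop :=
  ∑ i, k i = 0 ∧ ∀ i, D.vec m i = h i + k i

theorem IsShift.add_one_eq {h : κ → ℚ} (hb : D.IsBasic h) {m : κ →₀ ℕ} {k : κ → ℤ}
    (hs : D.IsShift h m k) (i : κ) :
    (m i : ℤ) + 1 = ((D.mon h i : ℤ) + 1) + D.transpose.mul k i := by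
  have h1 := D.mul_vec m i
  have h2 : D.vec m = h + fun i => (k i : ℚ) := funext hs.2
  rw [h2, map_add, Pi.add_apply, ← mon_add_one hb.integral] at h1
  have h3 : D.transpose.mul (fun i => (k i : ℚ)) i = (D.transpose.mul k i : ℤ) := by
    rw [mul_apply, mul_apply]
    rcases D.transpose.next i with _ | p <;> simp
  rw [h3] at h1
  exact_mod_cast h1.symm

theorem IsShift.structure {h : κ → ℚ} (hb : D.IsBasic h) {m : κ →₀ ℕ} {k : κ → ℤ}
    (hs : D.IsShift h m k) :
    (∀ i, k i < 0 → k i = -1 ∧ D.mon h i + 1 = D.exp i ∧ ∃ j, D.next j = some i ∧ k j = 1) ∧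
      ∀ j, 0 < k j → k j = 1 ∧ ∃ i, D.next j = some i ∧ k i = -1 := by
  have := D.shift_structure (u := fun i => (D.mon h i : ℤ) + 1) (k := k)
    (fun i => by exact_mod_cast hb.mon_add_one_le i) hs.1 fun i => by
      rw [← hs.add_one_eq hb]
      omega
  exact ⟨fun i hi => ⟨(this.1 i hi).1, by exact_mod_cast (this.1 i hi).2.1, (this.1 i hi).2.2⟩,
    this.2⟩

/-- If `∂ᵢ` has its leading term divide `x ^ m`, then `k i ≤ 0`. -/
theorem IsShift.nonpos_of_le {h : κ → ℚ} (hb : D.IsBasic h) {m : κ →₀ ℕ} {k : κ → ℤ}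
    (hs : D.IsShift h m k) {i : κ} (hle : D.tail i ≤ m) : k i ≤ 0 := by
  by_contra! hi
  obtain ⟨h1, l, hl, h2⟩ := (hs.structure hb).2 i hi
  obtain ⟨-, h3, -⟩ := (hs.structure hb).1 l (by omega)
  have h4 := hs.add_one_eq hb l
  rw [mul_of_some _ _ (D.transpose_next.2 hl), h1, h2, transpose_exp] at h4
  have h5 : 1 ≤ m l := by
    have := hle l
    rwa [tail_of_some D hl, Finsupp.single_eq_same] at this
  omega

/-- The successor `j` of `i` has `h j = 0` and basic exponent zero, yet `x_j` divides `x^m`; so a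
unit has moved into `j`, necessarily from its successor `l`. The exponent at `l` is extremal while
`h j = 0`, which gives `h l = 1`. -/
theorem IsShift.exists_neg {h : κ → ℚ} (hb : D.IsBasic h) {m : κ →₀ ℕ} {k : κ → ℤ}
    (hs : D.IsShift h m k) {i : κ} (hle : D.tail i ≤ m) (hi : h i = 1) :
    ∃ l, k l < 0 ∧ h l = 1 := by
  have h1 := hs.nonpos_of_le hb hle
  obtain ⟨j, hj, hj0⟩ := hb.eq_one i hi
  have h2 : 1 ≤ m j := by
    have := hle j
    rwa [tail_of_some D hj, Finsupp.single_eq_same] at this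
  have h3 := hs.add_one_eq hb j
  rw [mul_of_some _ _ (D.transpose_next.2 hj), transpose_exp] at h3
  have h4 := mon_add_one hb.integral j
  rw [mul_of_some _ _ (D.transpose_next.2 hj), hj0, hi, mul_zero, zero_add] at h4
  have h5 : D.mon h j + 1 = 1 := by exact_mod_cast h4
  have h6 : 0 < k j := by
    by_contra! h7
    have : (0 : ℤ) ≤ D.exp j := Int.natCast_nonneg _
    nlinarith
  obtain ⟨-, l, hl, hkl⟩ := (hs.structure hb).2 j h6
  obtain ⟨-, h7, -⟩ := (hs.structure hb).1 l (by omega)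
  have h8 := mon_add_one hb.integral l
  rw [mul_of_some _ _ (D.transpose_next.2 hl), hj0, add_zero, transpose_exp] at h8
  have h9 : (D.mon h l : ℚ) + 1 = D.exp l := by exact_mod_cast h7
  have h10 : (D.exp l : ℚ) ≠ 0 := by have := D.two_le l; exact_mod_cast (by omega : D.exp l ≠ 0)
  rw [h9] at h8
  exact ⟨l, by omega, (mul_right_eq_self₀.1 h8.symm).resolve_right h10⟩

open Classical in
/-- The coordinate, in the monomial basis of the Milnor ring, of `x ^ m` along the basis vector
of `h`. -/
def dualCoeff (D : ChainLoop κ) (c : κ → ℂ) (h : κ → ℚ) (m : κ →₀ ℕ) : ℂ :=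
  -- Each index where the vector drops below `h` costs one use of the relation of `∂_i`, hence a
  -- factor `-(exp i * c i / c p)`. Drops at entries equal to `1` are given value zero, since
  -- another basis vector may be reached in this way.
  if (∃ k, D.IsShift h m k) ∧ ∀ i, D.vec m i < h i → h i ≠ 1 then
    ∏ i, if D.vec m i < h i then
      (D.transpose.next i).elim 1 fun p => -(D.exp i * c i / c p) else 1
  else 0

theorem exists_isShift_of_dualCoeff_ne_zero {c : κ → ℂ} {h : κ → ℚ} {m : κ →₀ ℕ}
    (hne : D.dualCoeff c h m ≠ 0) : ∃ k, D.IsShift h m k := by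
  by_contra hk
  exact hne (if_neg fun h1 => hk h1.1)

theorem dualCoeff_eq_zero {c : κ → ℂ} {h : κ → ℚ} {m : κ →₀ ℕ} {i : κ} (hi : h i = 1)
    (hlt : D.vec m i < h i) : D.dualCoeff c h m = 0 :=
  if_neg fun h1 => h1.2 i hlt hi

theorem vec_mon {h : κ → ℚ} (hb : D.IsBasic h) : D.vec (D.mon h) = h :=
  (eq_vec fun i => (mon_add_one hb.integral i).symm).symm

theorem dualCoeff_mon_self (c : κ → ℂ) {h : κ → ℚ} (hb : D.IsBasic h) :
    D.dualCoeff c h (D.mon h) = 1 := by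
  rw [dualCoeff, if_pos]
  · simp [vec_mon hb]
  · rw [vec_mon hb]
    exact ⟨⟨0, by simp, by simp [vec_mon hb]⟩, fun i hi => absurd hi (lt_irrefl _)⟩

/-- Distinct basic vectors in one class differ by a nonzero integral vector of sum zero, so some
entry falls from `1` to `0`, where the form vanishes by definition. -/
theorem dualCoeff_mon_of_ne (c : κ → ℂ) {h h' : κ → ℚ} (hb : D.IsBasic h) (hb' : D.IsBasic h')
    (hne : h ≠ h') : D.dualCoeff c h (D.mon h') = 0 := by
  by_contra h0
  obtain ⟨k, hk, hv⟩ := exists_isShift_of_dualCoeff_ne_zero h0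
  rw [vec_mon hb'] at hv
  obtain ⟨i, hi⟩ : ∃ i, k i < 0 := by
    by_contra! hk0
    refine hne (funext fun i => ?_)
    rw [hv, (Finset.sum_eq_zero_iff_of_nonneg fun i _ => hk0 i).1 hk i (Finset.mem_univ i)]
    simp
  have h1 : (k i : ℚ) ≤ -1 := by exact_mod_cast (by omega : k i ≤ -1)
  have h2 := hv i
  have h3 := hb.le_one i
  have h4 := hb'.nonneg i
  refine h0 (dualCoeff_eq_zero (i := i) (by linarith) ?_)
  rw [vec_mon hb']
  linarith

/-- The two terms of `x^n ∂_i` differ by the move along the edge from `p` to `i`. By the structure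
of shifts the first has `k i = k p = 0`, so the second acquires exactly one new factor, the one
which cancels the relation. -/
theorem annihilates_dualCoeff {c : κ → ℂ} (hc : ∀ i, c i ≠ 0) {h : κ → ℚ} (hb : D.IsBasic h) :
    D.Annihilates c (D.dualCoeff c h) := by
  classical
  intro i n
  set S := n + Finsupp.single i (D.exp i - 1) + D.tail i with hS
  have htail : D.tail i ≤ S := le_add_self
  have hSi : D.exp i ≤ S i + 1 := by
    have := D.two_le i
    simp [hS]
    omega
  -- When `h i = 1` both terms vanish; for the first this needs the drop found by
  -- `IsShift.exists_neg` at a possibly different index.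
  have hX : ∀ k, D.IsShift h S k → h i = 1 → D.dualCoeff c h S = 0 := by
    intro k hk hi
    obtain ⟨l, h1, h2⟩ := hk.exists_neg hb htail hi
    refine dualCoeff_eq_zero h2 ?_
    rw [hk.2 l]
    have : (k l : ℚ) < 0 := by exact_mod_cast h1
    linarith
  rcases hp : D.transpose.next i with _ | p
  · simp only [Option.elim, add_zero]
    by_contra hne
    have hne' := right_ne_zero_of_mul hne
    obtain ⟨k, hk⟩ := exists_isShift_of_dualCoeff_ne_zero hne'
    have h1 := hk.nonpos_of_le hb htail
    have h2 := hk.add_one_eq hb i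
    rw [mul_of_none _ _ hp, transpose_exp] at h2
    have h3 := mon_add_one hb.integral i
    rw [mul_of_none _ _ hp, transpose_exp] at h3
    have h4 := hb.mon_add_one_le i
    have h5 : D.mon h i + 1 = D.exp i := by
      have h6 : (0 : ℤ) ≤ D.exp i := Int.natCast_nonneg _
      have h7 : (D.exp i : ℤ) * k i ≤ 0 := mul_nonpos_of_nonneg_of_nonpos h6 h1
      omega
    have h6 : (D.mon h i : ℚ) + 1 = D.exp i := by exact_mod_cast h5
    have h7 : (D.exp i : ℚ) ≠ 0 := by have := D.two_le i; exact_mod_cast (by omega : D.exp i ≠ 0)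
    rw [h6] at h3
    exact hne' (hX k hk ((mul_right_eq_self₀.1 h3.symm).resolve_right h7))
  · simp only [Option.elim]
    have hpi : D.next p = some i := D.transpose_next.1 hp
    have hip : i ≠ p := fun e => D.next_ne p (by rw [hpi, e])
    set S' := n + Finsupp.single p (D.exp p) with hS'
    have hv : D.vec S' = D.vec S + Pi.single p 1 - Pi.single i 1 := by
      refine D.vec_move ?_
      have h2 : D.exp i = D.exp i - 1 + 1 := by have := D.two_le i; omega
      rw [row, row, tail_of_some D hpi, hS, hS', h2, Finsupp.single_add, Nat.add_sub_cancel]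
      abel
    by_cases hex : ∃ k, D.IsShift h S k
    · obtain ⟨k, hk⟩ := hex
      have hk' : D.IsShift h S' (k + Pi.single p 1 - Pi.single i 1) := by
        refine ⟨by simp [Finset.sum_add_distrib, hk.1], fun l => ?_⟩
        rw [hv]
        simp only [Pi.sub_apply, Pi.add_apply, hk.2, Pi.single_apply]
        push_cast
        ring
      set k' := k + Pi.single p 1 - Pi.single i 1 with hkdef
      have hk'i : k' i = k i - 1 := by simp [hkdef, hip]
      have hk'p : k' p = k p + 1 := by simp [hkdef, hip.symm]
      have hk'l : ∀ l, l ≠ i → l ≠ p → k' l = k l := fun l h1 h2 => by simp [hkdef, h1, h2]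
      have h1 := hk.nonpos_of_le hb htail
      obtain ⟨h2, -, p', hp', h3⟩ := (hk'.structure hb).1 i (by omega)
      obtain rfl := D.next_inj hpi hp'
      have hki : k i = 0 := by omega
      have hkp : k p = 0 := by omega
      have hlt : ∀ l, D.vec S l < h l ↔ k l < 0 := fun l => by
        rw [hk.2, add_lt_iff_neg_left]
        exact_mod_cast Iff.rfl
      have hlt' : ∀ l, D.vec S' l < h l ↔ k l < 0 ∨ l = i := fun l => by
        rw [hk'.2, add_lt_iff_neg_left, Int.cast_lt_zero]
        by_cases hl : l = i
        · subst hl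
          simp [hk'i, hki]
        · by_cases hl' : l = p
          · subst hl'
            simp [hk'p, hkp, hl]
          · simp [hk'l l hl hl', hl]
      by_cases hi : h i = 1
      · rw [hX k hk hi, dualCoeff_eq_zero hi ((hlt' i).2 (Or.inr rfl)), mul_zero, mul_zero,
          add_zero]
      · by_cases hcond : ∀ l, k l < 0 → h l ≠ 1
        · rw [dualCoeff, dualCoeff, if_pos ⟨⟨k, hk⟩, fun l hl => hcond l ((hlt l).1 hl)⟩,
            if_pos ⟨⟨k', hk'⟩, fun l hl => ((hlt' l).1 hl).elim (hcond l) fun e => e ▸ hi⟩]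
          have hprod : (∏ l, if D.vec S' l < h l then
              (D.transpose.next l).elim 1 fun q => -(D.exp l * c l / c q) else 1) =
              -(D.exp i * c i / c p) * ∏ l, if D.vec S l < h l then
              (D.transpose.next l).elim 1 fun q => -(D.exp l * c l / c q) else 1 := by
            rw [← Finset.mul_prod_erase _ _ (Finset.mem_univ i),
              ← Finset.mul_prod_erase _ (fun l => if D.vec S l < h l then _ else _)
                (Finset.mem_univ i), if_pos ((hlt' i).2 (Or.inr rfl)),
              if_neg (by rw [hlt, hki]; exact lt_irrefl _), hp, one_mul]
            congr 1
            refine Finset.prod_congr rfl fun l hl => ?_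
            have := Finset.ne_of_mem_erase hl
            simp only [hlt, hlt', this, or_false]
          rw [hprod]
          field_simp [hc p]
          ring
        · push Not at hcond
          obtain ⟨l, h4, h5⟩ := hcond
          rw [dualCoeff_eq_zero h5 ((hlt l).2 h4), dualCoeff_eq_zero h5 ((hlt' l).2 (Or.inl h4)),
            mul_zero, mul_zero, add_zero]
    · have hex' : ¬∃ k, D.IsShift h S' k := by
        rintro ⟨k, hk⟩
        refine hex ⟨k - Pi.single p 1 + Pi.single i 1,
          by simp [Finset.sum_add_distrib, hk.1], fun l => ?_⟩
        have := hk.2 l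
        rw [hv] at this
        simp only [Pi.sub_apply, Pi.add_apply, Pi.single_apply] at this ⊢
        push_cast
        linarith
      rw [dualCoeff, dualCoeff, if_neg fun h1 => hex h1.1, if_neg fun h1 => hex' h1.1, mul_zero,
        mul_zero, add_zero]

end ChainLoop

/-! ### The monomial basis of the Milnor ring -/

theorem toMilnor_eq_zero {κ : Type} {V : MvPolynomial κ ℂ} {p : MvPolynomial κ ℂ} :
    toMilnor V p = 0 ↔ p ∈ jacobianIdeal V :=
  Ideal.Quotient.eq_zero_iff_mem

theorem toMilnor_surjective {κ : Type} (V : MvPolynomial κ ℂ) :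
    Function.Surjective (toMilnor V) :=
  Ideal.Quotient.mk_surjective

/-- The linear form on the Milnor ring induced by a linear form vanishing on the Jacobian ideal. -/
def milnorLift {κ : Type} (V : MvPolynomial κ ℂ) (ℓ : MvPolynomial κ ℂ →ₗ[ℂ] ℂ)
    (h : ∀ p ∈ jacobianIdeal V, ℓ p = 0) : MilnorRing V →ₗ[ℂ] ℂ :=
  ((jacobianIdeal V).restrictScalars ℂ).liftQ ℓ (fun p hp => h p hp) ∘ₗ
    (Submodule.Quotient.restrictScalarsEquiv ℂ (jacobianIdeal V)).symm.toLinearMap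

theorem milnorLift_toMilnor {κ : Type} (V : MvPolynomial κ ℂ) (ℓ : MvPolynomial κ ℂ →ₗ[ℂ] ℂ)
    (h : ∀ p ∈ jacobianIdeal V, ℓ p = 0) (p : MvPolynomial κ ℂ) :
    milnorLift V ℓ h (toMilnor V p) = ℓ p := rfl

theorem linearMap_ext_monomial {κ : Type} {M : Type*} [AddCommGroup M] [Module ℂ M]
    {f f' : MvPolynomial κ ℂ →ₗ[ℂ] M}
    (h : ∀ m, f (monomial m 1) = f' (monomial m 1)) : f = f' :=
  (MvPolynomial.basisMonomials κ ℂ).ext fun m => by simpa using h m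

namespace ChainLoop

section Milnor

variable {κ : Type} [Fintype κ] (D : ChainLoop κ) {c : κ → ℂ} {V : MvPolynomial κ ℂ}

/-- The linear form on polynomials extending `dualCoeff`. -/
def dualForm (c : κ → ℂ) (h : κ → ℚ) : MvPolynomial κ ℂ →ₗ[ℂ] ℂ :=
  (MvPolynomial.basisMonomials κ ℂ).constr ℂ (D.dualCoeff c h)

theorem dualForm_monomial (c : κ → ℂ) (h : κ → ℚ) (m : κ →₀ ℕ) :
    D.dualForm c h (monomial m 1) = D.dualCoeff c h m :=
  (MvPolynomial.basisMonomials κ ℂ).constr_basis ℂ (D.dualCoeff c h) m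

theorem dualForm_jacobianIdeal (hc : ∀ i, c i ≠ 0) (hV : V = D.poly c) {h : κ → ℚ}
    (hb : D.IsBasic h) : ∀ p ∈ jacobianIdeal V, D.dualForm c h p = 0 := by
  subst hV
  refine D.jacobianIdeal_of_annihilates c _ ?_
  simp_rw [dualForm_monomial]
  exact annihilates_dualCoeff hc hb

theorem linearIndependent_mon (hc : ∀ i, c i ≠ 0) (hV : V = D.poly c) : LinearIndependent ℂ
    fun h : {h : κ → ℚ // D.IsBasic h} => toMilnor V (monomial (D.mon h) 1) := by
  refine LinearIndependent.of_pairwise_dual_eq_zero_one _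
    (fun h => milnorLift V (D.dualForm c h) (D.dualForm_jacobianIdeal hc hV h.2)) ?_ ?_
  · intro h h' hne
    rw [milnorLift_toMilnor, dualForm_monomial]
    exact dualCoeff_mon_of_ne c h.2 h'.2 fun e => hne (Subtype.ext e)
  · intro h
    rw [milnorLift_toMilnor, dualForm_monomial]
    exact dualCoeff_mon_self c h.2

/-- A linear form killing the span would annihilate the Jacobian ideal and the basic monomials,
hence every monomial. -/
theorem top_le_span_mon (hc : ∀ i, c i ≠ 0) (hV : V = D.poly c) : ⊤ ≤ Submodule.span ℂ
    (Set.range fun h : {h : κ → ℚ // D.IsBasic h} => toMilnor V (monomial (D.mon h) 1)) := by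
  by_contra hlt
  obtain ⟨f, hf, hle⟩ := Submodule.exists_le_ker_of_lt_top _ (lt_top_iff_ne_top.2
    fun h => hlt h.ge)
  have hann : D.Annihilates c fun m => (f ∘ₗ toMilnor V) (monomial m 1) := by
    refine D.annihilates_of_jacobianIdeal c _ fun p hp => ?_
    rw [← hV] at hp
    rw [LinearMap.comp_apply, toMilnor_eq_zero.2 hp, map_zero]
  have hz : f ∘ₗ toMilnor V = 0 := linearMap_ext_monomial fun m =>
    hann.eq_zero hc (fun h hb => hle (Submodule.subset_span ⟨⟨h, hb⟩, rfl⟩)) m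
  refine hf (LinearMap.ext fun x => ?_)
  obtain ⟨p, rfl⟩ := toMilnor_surjective V x
  exact LinearMap.congr_fun hz p

/-- The monomial basis of the Milnor ring. -/
def milnorBasis (hc : ∀ i, c i ≠ 0) (hV : V = D.poly c) :
    Module.Basis {h : κ → ℚ // D.IsBasic h} ℂ (MilnorRing V) :=
  Module.Basis.mk (D.linearIndependent_mon hc hV) (D.top_le_span_mon hc hV)

theorem milnorBasis_apply (hc : ∀ i, c i ≠ 0) (hV : V = D.poly c)
    (h : {h : κ → ℚ // D.IsBasic h}) :
    D.milnorBasis hc hV h = toMilnor V (monomial (D.mon h) 1) :=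
  Module.Basis.mk_apply _ _ _

theorem milnorBasis_repr (hc : ∀ i, c i ≠ 0) (hV : V = D.poly c)
    (h : {h : κ → ℚ // D.IsBasic h}) (p : MvPolynomial κ ℂ) :
    (D.milnorBasis hc hV).repr (toMilnor V p) h = D.dualForm c h p := by
  have key : (D.milnorBasis hc hV).coord h =
      milnorLift V (D.dualForm c h) (D.dualForm_jacobianIdeal hc hV h.2) := by
    refine (D.milnorBasis hc hV).ext fun h' => ?_
    rw [Module.Basis.coord_apply, Module.Basis.repr_self, milnorBasis_apply, milnorLift_toMilnor,
      dualForm_monomial]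
    by_cases he : h' = h
    · rw [he, Finsupp.single_eq_same, dualCoeff_mon_self c h.2]
    · rw [Finsupp.single_eq_of_ne (Ne.symm he),
        dualCoeff_mon_of_ne c h.2 h'.2 fun e => he (Subtype.ext e.symm)]
  rw [← milnorLift_toMilnor V (D.dualForm c h) (D.dualForm_jacobianIdeal hc hV h.2) p, ← key]
  rfl

/-- The span of the classes of the monomials satisfying a condition which depends only on their
class. -/
theorem mem_span_monomial_iff (hc : ∀ i, c i ≠ 0) (hV : V = D.poly c) {P : (κ →₀ ℕ) → Prop}
    (hP : ∀ h m k, D.IsBasic h → D.IsShift h m k → P m → P (D.mon h)) (x : MilnorRing V) :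
    x ∈ Submodule.span ℂ {x | ∃ m, P m ∧ x = toMilnor V (monomial m 1)} ↔
      ∀ h : {h : κ → ℚ // D.IsBasic h}, ¬P (D.mon h) → (D.milnorBasis hc hV).repr x h = 0 := by
  constructor
  · intro hx h hne
    have hle : Submodule.span ℂ {x | ∃ m, P m ∧ x = toMilnor V (monomial m 1)} ≤
        LinearMap.ker ((D.milnorBasis hc hV).coord h) := by
      refine Submodule.span_le.2 ?_
      rintro _ ⟨m, hm, rfl⟩
      rw [SetLike.mem_coe, LinearMap.mem_ker, Module.Basis.coord_apply, milnorBasis_repr,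
        dualForm_monomial]
      by_contra h0
      obtain ⟨k, hk⟩ := exists_isShift_of_dualCoeff_ne_zero h0
      exact hne (hP h m k h.2 hk hm)
    exact hle hx
  · intro hx
    rw [← (D.milnorBasis hc hV).linearCombination_repr x, Finsupp.linearCombination_apply]
    refine Submodule.sum_mem _ fun h hh => Submodule.smul_mem _ _ (Submodule.subset_span ?_)
    rw [milnorBasis_apply]
    refine ⟨_, ?_, rfl⟩
    by_contra hne
    exact Finsupp.mem_support_iff.1 hh (hx h hne)

end Milnor

/-! ### Restriction to fixed loci -/

section restrict

variable {ι : Type}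

open Classical in
/-- Restriction of a shape to a set of variables. -/
def restrict (D : ChainLoop ι) (s : ι → Prop) : ChainLoop {i // s i} where
  exp i := D.exp i
  next :=
    { toFun := fun i => (D.next i).bind fun j => if h : s j then some ⟨j, h⟩ else none
      invFun := fun i => (D.next.symm i).bind fun j => if h : s j then some ⟨j, h⟩ else none
      inv := by
        rintro ⟨i, hi⟩ ⟨j, hj⟩
        simp only [Option.bind_eq_some_iff]
        constructor
        · rintro ⟨a, h1, h2⟩
          refine ⟨j, ?_, by simp [hj]⟩
          split_ifs at h2
          simp only [Option.some_inj, Subtype.mk.injEq] at h2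
          subst h2
          exact D.next.eq_some_iff.1 h1
        · rintro ⟨a, h1, h2⟩
          refine ⟨i, ?_, by simp [hi]⟩
          split_ifs at h2
          simp only [Option.some_inj, Subtype.mk.injEq] at h2
          subst h2
          exact D.next.eq_some_iff.2 h1 }
  two_le i := D.two_le i
  next_ne := by
    rintro ⟨i, hi⟩ h
    simp only [PEquiv.coe_mk, Option.bind_eq_some_iff] at h
    obtain ⟨a, h1, h2⟩ := h
    split_ifs at h2
    simp only [Option.some_inj, Subtype.mk.injEq] at h2
    exact D.next_ne i (h2 ▸ h1)

@[simp] theorem restrict_exp (D : ChainLoop ι) (s : ι → Prop) (i : {i // s i}) :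
    (D.restrict s).exp i = D.exp i := rfl

theorem restrict_transpose (D : ChainLoop ι) (s : ι → Prop) :
    (D.restrict s).transpose = D.transpose.restrict s := rfl

theorem restrict_next (D : ChainLoop ι) (s : ι → Prop) {i j : {i // s i}} :
    (D.restrict s).next i = some j ↔ D.next i = some (j : ι) := by
  classical
  change ((D.next i).bind fun j => if h : s j then some ⟨j, h⟩ else none) = some j ↔ _
  simp only [Option.bind_eq_some_iff]
  constructor
  · rintro ⟨a, h1, h2⟩
    split_ifs at h2
    simp only [Option.some_inj] at h2
    rw [h1, ← h2]
  · intro h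
    exact ⟨j, h, by simp [j.2]⟩

theorem restrict_next_eq_none (D : ChainLoop ι) (s : ι → Prop) {i : {i // s i}} :
    (D.restrict s).next i = none ↔ ∀ j, D.next i = some j → ¬s j := by
  rw [Option.eq_none_iff_forall_ne_some]
  constructor
  · intro h j hj hs
    exact h ⟨j, hs⟩ ((D.restrict_next s).2 hj)
  · intro h j hj
    exact h j ((D.restrict_next s).1 hj) j.2

theorem restrict_elim {R : Type*} [Zero R] (D : ChainLoop ι) (s : ι → Prop) (v : ι → R)
    (hv : ∀ i, ¬s i → v i = 0) (i : {i // s i}) :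
    ((D.restrict s).next i).elim 0 (fun j => v j) = (D.next i).elim 0 v := by
  rcases h : (D.restrict s).next i with _ | j
  · rw [restrict_next_eq_none] at h
    rcases h' : D.next i with _ | j
    · rfl
    · exact (hv j (h j h')).symm
  · rw [(D.restrict_next s).1 h]
    rfl

theorem restrict_mul {R : Type*} [CommSemiring R] (D : ChainLoop ι) (s : ι → Prop) (v : ι → R)
    (hv : ∀ i, ¬s i → v i = 0) (i : {i // s i}) :
    (D.restrict s).mul (fun j => v j) i = D.mul v i := by
  rw [mul_apply, mul_apply, restrict_elim D s v hv, restrict_exp]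

variable [Fintype ι]

-- A monomial led by a moved variable contains it to a positive power and disappears. A monomial led
-- by a fixed variable survives whole, since its tail variable is fixed too.
open Classical in
theorem restrictFix_poly (D : ChainLoop ι) (c : ι → ℂ) (g : ι → QZ)
    (hg : ∀ i j, D.next i = some j → g i = 0 → g j = 0) :
    restrictFix (D.poly c) g = (D.restrict fun i => g i = 0).poly fun i => c i := by
  have h1 : ∀ i, aeval (fun i => if h : g i = 0 then (X ⟨i, h⟩ : MvPolynomial (FixVar g) ℂ) else 0)
      (monomial (D.row i) (c i)) =
      if h : g i = 0 then monomial ((D.restrict fun i => g i = 0).row ⟨i, h⟩) (c i) else 0 := by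
    intro i
    have hdeg := D.two_le i
    rw [row, ← mul_one (c i), ← monomial_mul, map_mul, aeval_monomial,
      Finsupp.prod_single_index (by simp)]
    by_cases hi : g i = 0
    · rw [dif_pos hi, dif_pos hi, row, ← monomial_mul]
      congr 1
      · rw [monomial_eq, Finsupp.prod_single_index (by simp)]
        rfl
      · rcases h : D.next i with _ | j
        · have h2 : (D.restrict fun i => g i = 0).next ⟨i, hi⟩ = none := by
            rw [restrict_next_eq_none]
            simp [h]
          rw [tail_of_none _ h, tail_of_none _ h2]
          simp
        · have hj := hg i j h hi
          have h2 : (D.restrict fun i => g i = 0).next ⟨i, hi⟩ = some ⟨j, hj⟩ := by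
            rw [restrict_next]
            exact h
          rw [tail_of_some _ h, tail_of_some _ h2, aeval_monomial,
            Finsupp.prod_single_index (by simp), dif_pos hj]
          simp [X]
    · rw [dif_neg hi, dif_neg hi, zero_pow (by omega), mul_zero, zero_mul]
  rw [restrictFix, poly, map_sum, Finset.sum_congr rfl fun i _ => h1 i, poly]
  rw [← Finset.sum_subset (Finset.subset_univ (Finset.univ.filter fun i => g i = 0))
    fun i _ hi => dif_neg (by simpa using hi), Finset.sum_filter,
    ← Finset.sum_filter]
  rw [Finset.sum_subtype (Finset.univ.filter fun i => g i = 0) (p := fun i => g i = 0) (by simp)]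
  exact Finset.sum_congr rfl fun i _ => dif_pos i.2

end restrict

end ChainLoop

/-! ### The monomial basis of the state space and its bigrading -/

/-- The basis of a submodule cut out by the vanishing of some of the coordinates. -/
def subBasis {ι' M : Type*} [AddCommGroup M] [Module ℂ M] (B : Module.Basis ι' ℂ M)
    (S : Submodule ℂ M) (P : ι' → Prop) (hS : ∀ x, x ∈ S ↔ ∀ i, ¬P i → B.repr x i = 0) :
    Module.Basis {i // P i} ℂ S :=
  .ofRepr ((LinearEquiv.ofSubmodules B.repr S (Finsupp.supported ℂ ℂ {i | P i}) (by
    ext y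
    rw [Submodule.mem_map_equiv, hS, Finsupp.mem_supported']
    simp)).trans (Finsupp.supportedEquivFinsupp {i | P i}))

open Classical in
theorem formAct_monomial {ι : Type} [Fintype ι] (g k : ι → QZ) (m : FixVar g →₀ ℕ) :
    formAct g k (monomial m 1) = expQZ (∑ i : FixVar g, (m i + 1) • k i) • monomial m (1 : ℂ) := by
  rw [formAct, LinearMap.smul_apply, AlgHom.toLinearMap_apply, act_monomial, ← smul_eq_mul,
    ← smul_monomial, smul_smul]
  congr 1
  simp_rw [add_smul, one_smul, Finset.sum_add_distrib, expQZ_add, expQZ_sum]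
  rw [mul_comm]

namespace ChainLoop

/-- The exponents differ by `Aᵀ k` with `k` integral, and pairing this with a symmetry gives `k · A
v = 0`. So the character of a form depends only on its class. -/
theorem IsShift.sum_smul {κ : Type} [Fintype κ] {D : ChainLoop κ} {h : κ → ℚ} (hb : D.IsBasic h)
    {m : κ →₀ ℕ} {k : κ → ℤ} (hs : D.IsShift h m k) {v : κ → QZ}
    (hv : ∀ i, D.exp i • v i + (D.next i).elim 0 v = 0) :
    ∑ i, (m i + 1) • v i = ∑ i, (D.mon h i + 1) • v i := by
  have h1 : ∀ i, (m i + 1) • v i = (D.mon h i + 1) • v i + D.transpose.mul k i • v i := by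
    intro i
    rw [← natCast_zsmul, ← natCast_zsmul, ← add_smul]
    push_cast
    rw [hs.add_one_eq hb]
  rw [Finset.sum_congr rfl fun i _ => h1 i, Finset.sum_add_distrib, sum_mul_transpose_smul]
  simp [hv]

variable {ι : Type} [Fintype ι] (D : ChainLoop ι) {c : ι → ℂ}

/-- The restriction of a shape to the variables fixed by `g`. -/
abbrev fix (g : ι → QZ) : ChainLoop (FixVar g) := D.restrict fun i => g i = 0

variable {D} in
theorem eq_zero_of_mem_Gmax (hc : ∀ i, c i ≠ 0) {g : ι → QZ} (hg : g ∈ Gmax (D.poly c)) {i j : ι}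
    (hj : D.next i = some j) (hi : g i = 0) : g j = 0 := by
  have := (D.mem_Gmax_poly c hc).1 hg i
  simpa [hj, hi] using this

variable {D} in
theorem fix_mul_eq_zero (hc : ∀ i, c i ≠ 0) {g k : ι → QZ} (hg : g ∈ Gmax (D.poly c))
    (hk : k ∈ Gmax (D.poly c)) (i : FixVar g) :
    (D.fix g).exp i • k i + ((D.fix g).next i).elim 0 (fun j => k j) = 0 := by
  refine Eq.trans ?_ ((D.mem_Gmax_poly c hc).1 hk i)
  congr 1
  rcases h : D.next i with _ | j
  · have h2 : (D.fix g).next i = none := by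
      rw [restrict_next_eq_none]
      simp [h]
    rw [h2]
    rfl
  · have h2 : (D.fix g).next i = some ⟨j, eq_zero_of_mem_Gmax hc hg h i.2⟩ := by
      rw [restrict_next]
      exact h
    rw [h2]
    rfl

open Classical in
/-- Invariance of the form `x ^ m ω_g` under `G`. -/
def InvariantForm (G : AddSubgroup (ι → QZ)) (g : ι → QZ) (m : FixVar g →₀ ℕ) : Prop :=
  ∀ k ∈ G, ∑ i : FixVar g, (m i + 1) • k i = 0

variable {W : MvPolynomial ι ℂ} {G : AddSubgroup (ι → QZ)}

theorem restrictFix_eq (hc : ∀ i, c i ≠ 0) (hW : W = D.poly c) {g : ι → QZ} (hg : g ∈ Gmax W) :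
    restrictFix W g = (D.fix g).poly fun i => c i := by
  subst hW
  exact D.restrictFix_poly c g fun i j hj hi => eq_zero_of_mem_Gmax hc hg hj hi

/-- Each dual form is an eigenvector of the transposed action, since it is supported on one class of
monomials sharing a character. Coordinates of an invariant class therefore vanish along noninvariant
basis monomials. -/
theorem mem_sector_iff (hc : ∀ i, c i ≠ 0) (hW : W = D.poly c) (hG : G ≤ Gmax W) {g : ι → QZ}
    (hg : g ∈ G) (x : MilnorRing (restrictFix W g)) :
    x ∈ sector W G g ↔ ∀ h : {h // (D.fix g).IsBasic h}, ¬InvariantForm G g ((D.fix g).mon h) →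
      ((D.fix g).milnorBasis (fun i => hc i) (D.restrictFix_eq hc hW (hG hg))).repr x h = 0 := by
  classical
  constructor
  · rintro ⟨p, hp, rfl⟩ h hh
    simp only [InvariantForm, not_forall] at hh
    obtain ⟨k, hk, hne⟩ := hh
    have hp' : toMilnor (restrictFix W g) (formAct g k p) = toMilnor (restrictFix W g) p := by
      have h1 := (Submodule.mem_iInf _).1 hp k
      exact (Submodule.mem_iInf _).1 h1 hk
    have hcomp : (D.fix g).dualForm (fun i => c i) h ∘ₗ formAct g k =
        expQZ (∑ i : FixVar g, ((D.fix g).mon h i + 1) • k i) •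
          (D.fix g).dualForm (fun i => c i) h := by
      refine linearMap_ext_monomial fun m => ?_
      rw [LinearMap.comp_apply, formAct_monomial, map_smul, LinearMap.smul_apply,
        dualForm_monomial]
      by_cases h0 : (D.fix g).dualCoeff (fun i => c i) h m = 0
      · rw [h0, smul_zero, smul_zero]
      · obtain ⟨s, hs⟩ := exists_isShift_of_dualCoeff_ne_zero h0
        rw [hs.sum_smul h.2 (v := fun i => k i)
          (fix_mul_eq_zero hc (hW ▸ hG hg) (hW ▸ hG hk))]
    have h1 := LinearMap.congr_fun hcomp p
    rw [LinearMap.comp_apply, LinearMap.smul_apply,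
      ← (D.fix g).milnorBasis_repr (c := fun i => c i) (fun i => hc i)
        (D.restrictFix_eq hc hW (hG hg)), hp',
      milnorBasis_repr, smul_eq_mul] at h1
    rw [milnorBasis_repr]
    by_contra h2
    exact hne (expQZ_eq_one.1 ((mul_eq_right₀ h2).1 h1.symm))
  · intro hx
    rw [← ((D.fix g).milnorBasis (fun i => hc i)
      (D.restrictFix_eq hc hW (hG hg))).linearCombination_repr x,
      Finsupp.linearCombination_apply]
    refine Submodule.sum_mem _ fun h hh => Submodule.smul_mem _ _ ?_
    rw [milnorBasis_apply]
    refine ⟨_, ?_, rfl⟩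
    simp only [SetLike.mem_coe, Submodule.mem_iInf]
    intro k hk
    have hinv : InvariantForm G g ((D.fix g).mon h) := by
      by_contra hne
      exact Finsupp.mem_support_iff.1 hh (hx h hne)
    rw [LinearMap.mem_eqLocus, LinearMap.comp_apply, formAct_monomial, hinv k hk, expQZ_zero,
      one_smul]

/-- The index set of the monomial basis of the state space. -/
abbrev StateIndex (D : ChainLoop ι) (G : AddSubgroup (ι → QZ)) : Type :=
  Σ g : G, {h : {h : FixVar (g : ι → QZ) → ℚ // (D.fix (g : ι → QZ)).IsBasic h} //
    InvariantForm G (g : ι → QZ) ((D.fix (g : ι → QZ)).mon h)}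

/-- The monomial basis of the state space. -/
def stateBasis (hc : ∀ i, c i ≠ 0) (hW : W = D.poly c) (hG : G ≤ Gmax W) :
    Module.Basis (D.StateIndex G) ℂ (StateSpace W G) :=
  DFinsupp.basis fun g => subBasis _ _ _ (D.mem_sector_iff hc hW hG g.2)

/-- A bi-degree constant on classes of monomials makes each piece a coordinate subspace, although
the piece is spanned by all monomials of that bi-degree and not only the basic ones. -/
theorem mem_bigradedPiece_iff (hc : ∀ i, c i ≠ 0) (hW : W = D.poly c) (hG : G ≤ Gmax W)
    {d : (g : ι → QZ) → (FixVar g →₀ ℕ) → ℚ × ℚ}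
    (hd : ∀ g ∈ G, ∀ h m k, (D.fix g).IsBasic h → (D.fix g).IsShift h m k →
      d g m = d g ((D.fix g).mon h)) (r : ℚ × ℚ) (x : StateSpace W G) :
    x ∈ bigradedPiece W G d r ↔ ∀ t : D.StateIndex G,
      d t.1 ((D.fix (t.1 : ι → QZ)).mon t.2) ≠ r → (D.stateBasis hc hW hG).repr x t = 0 := by
  have hrepr : ∀ t : D.StateIndex G, (D.stateBasis hc hW hG).repr x t =
      ((D.fix (t.1 : ι → QZ)).milnorBasis (fun i => hc i)
        (D.restrictFix_eq hc hW (hG t.1.2))).repr (x t.1) t.2 := fun t => rfl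
  rw [bigradedPiece, Submodule.mem_iInf]
  have hmem : ∀ g : G, x ∈ Submodule.comap ((sector W G (g : ι → QZ)).subtype ∘ₗ
      DirectSum.component ℂ G (fun g => sector W G (g : ι → QZ)) g)
      (Submodule.span ℂ {x | ∃ m : FixVar (g : ι → QZ) →₀ ℕ,
        d g m = r ∧ x = toMilnor (restrictFix W g) (monomial m 1)}) ↔
      ∀ h : {h // (D.fix (g : ι → QZ)).IsBasic h}, ¬d g ((D.fix (g : ι → QZ)).mon h) = r →
        ((D.fix (g : ι → QZ)).milnorBasis (fun i => hc i)
          (D.restrictFix_eq hc hW (hG g.2))).repr (x g) h = 0 := fun g =>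
    (D.fix (g : ι → QZ)).mem_span_monomial_iff (fun i => hc i) (D.restrictFix_eq hc hW (hG g.2))
      (P := fun m => d g m = r) (fun h m k hb hs hm => (hd g g.2 h m k hb hs).symm.trans hm) _
  constructor
  · intro hx t ht
    rw [hrepr]
    exact (hmem t.1).1 (hx t.1) t.2 ht
  · intro hx g
    rw [hmem]
    intro h hh
    by_cases hinv : InvariantForm G (g : ι → QZ) ((D.fix (g : ι → QZ)).mon h)
    · exact hx ⟨g, h, hinv⟩ hh
    · exact (D.mem_sector_iff hc hW hG g.2 _).1 (x g).2 h hinv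

/-- State spaces whose basis index sets correspond are isomorphic. -/
theorem exists_equiv_of_index_equiv {ι' : Type} [Fintype ι'] (hc : ∀ i, c i ≠ 0)
    (hW : W = D.poly c) (hG : G ≤ Gmax W) {d : (g : ι → QZ) → (FixVar g →₀ ℕ) → ℚ × ℚ}
    (hd : ∀ g ∈ G, ∀ h m k, (D.fix g).IsBasic h → (D.fix g).IsShift h m k →
      d g m = d g ((D.fix g).mon h))
    (D' : ChainLoop ι') {c' : ι' → ℂ} {W' : MvPolynomial ι' ℂ} {G' : AddSubgroup (ι' → QZ)}
    (hc' : ∀ i, c' i ≠ 0) (hW' : W' = D'.poly c') (hG' : G' ≤ Gmax W')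
    {d' : (g : ι' → QZ) → (FixVar g →₀ ℕ) → ℚ × ℚ}
    (hd' : ∀ g ∈ G', ∀ h m k, (D'.fix g).IsBasic h → (D'.fix g).IsShift h m k →
      d' g m = d' g ((D'.fix g).mon h))
    (e : D.StateIndex G ≃ D'.StateIndex G')
    (he : ∀ t, d' (e t).1 ((D'.fix ((e t).1 : ι' → QZ)).mon (e t).2) =
      d t.1 ((D.fix (t.1 : ι → QZ)).mon t.2)) :
    ∃ f : StateSpace W G ≃ₗ[ℂ] StateSpace W' G', ∀ r,
      (bigradedPiece W G d r).map f.toLinearMap = bigradedPiece W' G' d' r := by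
  refine ⟨(D.stateBasis hc hW hG).equiv (D'.stateBasis hc' hW' hG') e, fun r => ?_⟩
  ext y
  rw [Submodule.mem_map_equiv, mem_bigradedPiece_iff D hc hW hG hd,
    mem_bigradedPiece_iff D' hc' hW' hG' hd']
  have hrepr : ∀ t, (D.stateBasis hc hW hG).repr
      (((D.stateBasis hc hW hG).equiv (D'.stateBasis hc' hW' hG') e).symm y) t =
      (D'.stateBasis hc' hW' hG').repr y (e t) := by
    intro t
    rw [show ((D.stateBasis hc hW hG).equiv (D'.stateBasis hc' hW' hG') e).symm y =
      (D.stateBasis hc hW hG).repr.symm (((D'.stateBasis hc' hW' hG').reindex e.symm).repr y)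
      from rfl, LinearEquiv.apply_symm_apply, Module.Basis.repr_reindex_apply, Equiv.symm_symm]
  simp_rw [hrepr, ← he]
  exact e.forall_congr_right (q := fun t => d' t.1 ((D'.fix (t.1 : ι' → QZ)).mon t.2) ≠ r →
    (D'.stateBasis hc' hW' hG').repr y t = 0)

end ChainLoop

/-! ### Pairs indexing the basis of the state space -/

/-- The class in `(ℚ/ℤ)^n` of a rational vector. -/
def cls {ι : Type} (v : ι → ℚ) : ι → QZ := fun i => (v i : QZ)

theorem coe_eq_zero_iff {a : ℚ} : (a : QZ) = 0 ↔ ∃ z : ℤ, a = z := by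
  rw [AddCircle.coe_eq_zero_iff]
  simp [eq_comm]

theorem coe_rep (x : QZ) : ((rep x : ℚ) : QZ) = x := by
  induction x using QuotientAddGroup.induction_on with
  | H a =>
    rw [rep_coe, ← sub_eq_zero, ← AddCircle.coe_sub, coe_eq_zero_iff]
    exact ⟨-⌊a⌋, by rw [Int.fract]; push_cast; ring⟩

theorem rep_nonneg (x : QZ) : 0 ≤ rep x := by
  obtain ⟨a, rfl⟩ := QuotientAddGroup.mk_surjective x
  exact (rep_coe a).symm ▸ Int.fract_nonneg a

theorem rep_lt_one (x : QZ) : rep x < 1 := by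
  obtain ⟨a, rfl⟩ := QuotientAddGroup.mk_surjective x
  exact (rep_coe a).symm ▸ Int.fract_lt_one a

theorem exists_cls_eq {ι : Type} (g : ι → QZ) : ∃ v, cls v = g :=
  ⟨fun i => rep (g i), funext fun i => coe_rep (g i)⟩

theorem coe_sum {α : Type} (s : Finset α) (f : α → ℚ) :
    ((∑ i ∈ s, f i : ℚ) : QZ) = ∑ i ∈ s, (f i : QZ) :=
  map_sum (QuotientAddGroup.mk' (AddSubgroup.zmultiples (1 : ℚ))) f s

theorem coe_nsmul_mul (n : ℕ) (a : ℚ) : ((n * a : ℚ) : QZ) = n • (a : QZ) := by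
  rw [← nsmul_eq_mul, AddCircle.coe_nsmul]

open Classical in
theorem sum_fixVar {ι M : Type} [Fintype ι] [AddCommMonoid M] (g : ι → QZ) (f : ι → M)
    (hf : ∀ i, g i ≠ 0 → f i = 0) : ∑ i, f i = ∑ i : FixVar g, f i := by
  rw [← Finset.sum_subset (Finset.subset_univ (Finset.univ.filter fun i => g i = 0))
    fun i _ hi => hf i (by simpa using hi)]
  exact Finset.sum_subtype _ (by simp) f

namespace ChainLoop

variable {ι : Type} (D : ChainLoop ι)

/-- Pairs of rational vectors which index a basis of the state space, symmetric under
transposition: `γ` determines the sector and `h` the monomial form. -/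
structure MirrorPair (γ h : ι → ℚ) : Prop where
  left_nonneg : ∀ i, 0 ≤ γ i
  left_le_one : ∀ i, γ i ≤ 1
  right_nonneg : ∀ i, 0 ≤ h i
  right_le_one : ∀ i, h i ≤ 1
  support : ∀ i, h i = 0 ↔ γ i ≠ 0
  left_int : ∀ i, ∃ z : ℤ, D.mul γ i = z
  right_int : ∀ i, ∃ z : ℤ, D.transpose.mul h i = z
  right_eq_one : ∀ i, h i = 1 → ∃ j, D.next i = some j ∧ γ j = 1
  left_eq_one : ∀ j, γ j = 1 → ∃ i, D.next i = some j ∧ h i = 1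

variable {D}

theorem MirrorPair.transpose {γ h : ι → ℚ} (hp : D.MirrorPair γ h) :
    D.transpose.MirrorPair h γ where
  left_nonneg := hp.right_nonneg
  left_le_one := hp.right_le_one
  right_nonneg := hp.left_nonneg
  right_le_one := hp.left_le_one
  support i := by rw [Ne, hp.support, not_not]
  left_int := hp.right_int
  right_int := hp.left_int
  right_eq_one i hi := by
    obtain ⟨j, h1, h2⟩ := hp.left_eq_one i hi
    exact ⟨j, D.transpose_next.2 h1, h2⟩
  left_eq_one i hi := by
    obtain ⟨j, h1, h2⟩ := hp.right_eq_one i hi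
    exact ⟨j, D.transpose_next.2 h1, h2⟩

theorem MirrorPair.left_eq_zero {γ h : ι → ℚ} (hp : D.MirrorPair γ h) {i : ι} (hi : h i ≠ 0) :
    γ i = 0 := by
  by_contra h0
  exact hi ((hp.support i).2 h0)

theorem MirrorPair.right_eq_zero {γ h : ι → ℚ} (hp : D.MirrorPair γ h) {i : ι}
    (hi : cls γ i ≠ 0) : h i = 0 := by
  by_contra h0
  exact hi (by rw [cls, hp.left_eq_zero h0]; rfl)

theorem MirrorPair.cls_eq_zero {γ h : ι → ℚ} (hp : D.MirrorPair γ h) {i : ι} :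
    cls γ i = 0 ↔ γ i = 0 ∨ γ i = 1 := by
  rw [cls, coe_eq_zero_iff]
  constructor
  · rintro ⟨z, hz⟩
    have h1 := hp.left_nonneg i
    have h2 := hp.left_le_one i
    rw [hz] at h1 h2
    have h3 : 0 ≤ z := by exact_mod_cast h1
    have h4 : z ≤ 1 := by exact_mod_cast h2
    rcases (by omega : z = 0 ∨ z = 1) with rfl | rfl
    · left; simpa using hz
    · right; simpa using hz
  · rintro (h | h)
    · exact ⟨0, by simp [h]⟩
    · exact ⟨1, by simp [h]⟩

/-- At a fixed variable either `γ i = 0`, so that `h i > 0`, or `γ i = 1`, and then the predecessor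
contributes its entry `1`. -/
theorem MirrorPair.exists_nat {γ h : ι → ℚ} (hp : D.MirrorPair γ h) {i : ι} (hi : cls γ i = 0) :
    ∃ n : ℕ, D.transpose.mul h i = n + 1 := by
  obtain ⟨z, hz⟩ := hp.right_int i
  have hpos : 0 < D.transpose.mul h i := by
    rw [mul_apply, transpose_exp]
    have ha : (0 : ℚ) < D.exp i := by have := D.two_le i; exact_mod_cast (by omega : 0 < D.exp i)
    have hel : 0 ≤ (D.transpose.next i).elim 0 h := by
      rcases D.transpose.next i with _ | p
      · simp
      · exact hp.right_nonneg p
    rcases hp.cls_eq_zero.1 hi with h0 | h1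
    · have h2 : 0 < h i := (hp.right_nonneg i).lt_of_ne
        fun h3 => (hp.support i).1 h3.symm h0
      positivity
    · obtain ⟨p, hpi, hh⟩ := hp.left_eq_one i h1
      rw [D.transpose_next.2 hpi]
      simp only [Option.elim]
      have := mul_nonneg ha.le (hp.right_nonneg i)
      linarith
  rw [hz] at hpos ⊢
  have h1 : 0 < z := by exact_mod_cast hpos
  refine ⟨(z - 1).toNat, ?_⟩
  have h2 : ((z - 1).toNat : ℤ) = z - 1 := Int.toNat_of_nonneg (by omega)
  have h3 : (((z - 1).toNat : ℤ) : ℚ) = ((z - 1 : ℤ) : ℚ) := by rw [h2]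
  push_cast at h3
  rw [h3]
  ring

theorem MirrorPair.fix_integral {γ h : ι → ℚ} (hp : D.MirrorPair γ h) (i : FixVar (cls γ)) :
    ∃ n : ℕ, (D.fix (cls γ)).transpose.mul (fun i => h i) i = n + 1 := by
  rw [restrict_transpose, restrict_mul D.transpose _ h fun i hi => hp.right_eq_zero hi]
  exact hp.exists_nat i.2

theorem MirrorPair.isBasic {γ h : ι → ℚ} (hp : D.MirrorPair γ h) :
    (D.fix (cls γ)).IsBasic fun i => h i where
  nonneg i := hp.right_nonneg i
  le_one i := hp.right_le_one i
  integral := hp.fix_integral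
  eq_one i hi := by
    obtain ⟨j, h1, h2⟩ := hp.right_eq_one i hi
    refine ⟨⟨j, hp.cls_eq_zero.2 (Or.inr h2)⟩, (D.restrict_next _).2 h1, ?_⟩
    exact (hp.support j).2 (by rw [h2]; exact one_ne_zero)

theorem coe_mul (v : ι → ℚ) (i : ι) :
    ((D.mul v i : ℚ) : QZ) = D.exp i • cls v i + (D.next i).elim 0 (cls v) := by
  rw [mul_apply, AddCircle.coe_add, coe_nsmul_mul]
  congr 1
  rcases D.next i with _ | j <;> rfl

variable [Fintype ι]

theorem cls_mem_Gmax {c : ι → ℂ} (hc : ∀ i, c i ≠ 0) {v : ι → ℚ} :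
    cls v ∈ Gmax (D.poly c) ↔ ∀ i, ∃ z : ℤ, D.mul v i = z := by
  rw [mem_Gmax_poly D c hc]
  exact forall_congr' fun i => by rw [← coe_mul, coe_eq_zero_iff]

variable (D) in
/-- The pairing `h A vᵀ` is integral for all lifts `v` of elements of `G`. -/
def Perp (G : AddSubgroup (ι → QZ)) (h : ι → ℚ) : Prop :=
  ∀ v : ι → ℚ, cls v ∈ G → ∃ z : ℤ, ∑ i, D.transpose.mul h i * v i = z

variable (D) in
/-- The pairs indexing a basis of the state space of the group `G`. -/
abbrev PairIndex (G : AddSubgroup (ι → QZ)) : Type :=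
  {p : (ι → ℚ) × (ι → ℚ) // D.MirrorPair p.1 p.2 ∧ cls p.1 ∈ G ∧ D.Perp G p.2}

/-- The character of the form at a lift `v` is `∑ (m i + 1) v i`, which equals `h A vᵀ` because `Aᵀ
h` vanishes at the moved variables. -/
theorem invariantForm_iff_perp {G : AddSubgroup (ι → QZ)} {g : ι → QZ} {h : ι → ℚ}
    (hout : ∀ i, g i ≠ 0 → h i = 0) (hmul : ∀ i, g i ≠ 0 → D.transpose.mul h i = 0)
    (hint : ∀ i, ∃ n : ℕ, (D.fix g).transpose.mul (fun i => h i) i = n + 1) :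
    InvariantForm G g ((D.fix g).mon fun i => h i) ↔ D.Perp G h := by
  classical
  have key : ∀ v : ι → ℚ, ((∑ i, D.transpose.mul h i * v i : ℚ) : QZ) =
      ∑ i : FixVar g, ((D.fix g).mon (fun i => h i) i + 1) • cls v i := by
    intro v
    rw [sum_fixVar g _ fun i hi => by rw [hmul i hi, zero_mul], coe_sum]
    refine Finset.sum_congr rfl fun i _ => ?_
    have h1 := mon_add_one hint i
    rw [restrict_transpose, restrict_mul D.transpose _ h hout] at h1
    rw [← h1, cls, ← coe_nsmul_mul]
    push_cast
    rfl
  constructor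
  · intro hinv v hv
    rw [← coe_eq_zero_iff, key]
    exact hinv _ hv
  · intro hperp k hk
    obtain ⟨v, rfl⟩ := exists_cls_eq k
    rw [← key, coe_eq_zero_iff]
    exact hperp v hk

/-- The predecessor of a moved variable is moved too, so `h` vanishes at both. -/
theorem MirrorPair.mul_eq_zero {c : ι → ℂ} (hc : ∀ i, c i ≠ 0) {γ h : ι → ℚ}
    (hp : D.MirrorPair γ h) {i : ι} (hi : cls γ i ≠ 0) : D.transpose.mul h i = 0 := by
  rw [mul_apply, hp.right_eq_zero hi, mul_zero, zero_add]
  rcases hj : D.transpose.next i with _ | p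
  · rfl
  · refine hp.right_eq_zero fun h0 => hi ?_
    exact eq_zero_of_mem_Gmax hc ((cls_mem_Gmax hc).2 hp.left_int) (D.transpose_next.1 hj) h0

/-- The basis element of the state space attached to a pair. -/
def stateOfPair {c : ι → ℂ} (hc : ∀ i, c i ≠ 0) (G : AddSubgroup (ι → QZ)) (p : D.PairIndex G) :
    D.StateIndex G :=
  ⟨⟨cls p.1.1, p.2.2.1⟩, ⟨fun i => p.1.2 i, p.2.1.isBasic⟩,
    (invariantForm_iff_perp (fun _ hi => p.2.1.right_eq_zero hi)
      (fun _ hi => p.2.1.mul_eq_zero hc hi) p.2.1.fix_integral).2 p.2.2.2⟩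

open Classical in
/-- The extension by zero of the vector of a basis element. -/
def extendState {G : AddSubgroup (ι → QZ)} (t : D.StateIndex G) (i : ι) : ℚ :=
  if hi : (t.1 : ι → QZ) i = 0 then (t.2 : FixVar (t.1 : ι → QZ) → ℚ) ⟨i, hi⟩ else 0

theorem state_ext {G : AddSubgroup (ι → QZ)} {t t' : D.StateIndex G}
    (h1 : (t.1 : ι → QZ) = t'.1) (h2 : extendState t = extendState t') : t = t' := by
  obtain ⟨g, h⟩ := t
  obtain ⟨g', h'⟩ := t'
  obtain rfl : g = g' := Subtype.ext h1
  congr 1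
  refine Subtype.ext (Subtype.ext (funext fun i => ?_))
  have := congrFun h2 i
  simpa [extendState, i.2] using this

theorem extendState_stateOfPair {c : ι → ℂ} (hc : ∀ i, c i ≠ 0) (G : AddSubgroup (ι → QZ))
    (p : D.PairIndex G) : extendState (stateOfPair hc G p) = p.1.2 := by
  ext i
  rw [extendState]
  split_ifs with hi
  · rfl
  · exact (p.2.1.right_eq_zero hi).symm

/-- Where `h ≠ 0`, `γ` is zero. Where `h = 0`, `γ` lies in `(0, 1]`, an interval on which a class in
`ℚ/ℤ` has a single lift. -/
theorem stateOfPair_injective {c : ι → ℂ} (hc : ∀ i, c i ≠ 0) (G : AddSubgroup (ι → QZ)) :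
    Function.Injective (stateOfPair (D := D) hc G) := by
  rintro p p' he
  have h1 : cls p.1.1 = cls p'.1.1 := congrArg (fun t : D.StateIndex G => (t.1 : ι → QZ)) he
  have h2 : p.1.2 = p'.1.2 := by
    rw [← extendState_stateOfPair hc G p, he, extendState_stateOfPair]
  refine Subtype.ext (Prod.ext (funext fun i => ?_) h2)
  by_cases h0 : p.1.2 i = 0
  · have h3 := (p.2.1.support i).1 h0
    rw [h2] at h0
    have h4 := (p'.2.1.support i).1 h0
    have h5 : (((p.1.1 i - p'.1.1 i : ℚ)) : QZ) = 0 := by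
      rw [AddCircle.coe_sub, sub_eq_zero]
      exact congrFun h1 i
    obtain ⟨z, hz⟩ := coe_eq_zero_iff.1 h5
    have h6 := (p.2.1.left_nonneg i).lt_of_ne (Ne.symm h3)
    have h7 := (p'.2.1.left_nonneg i).lt_of_ne (Ne.symm h4)
    have h8 := p.2.1.left_le_one i
    have h9 := p'.2.1.left_le_one i
    have h10 : (z : ℚ) < 1 := by linarith
    have h11 : (-1 : ℚ) < z := by linarith
    have h12 : z < 1 := by exact_mod_cast h10
    have h13 : -1 < z := by exact_mod_cast h11
    obtain rfl : z = 0 := by omega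
    simpa [sub_eq_zero] using hz
  · rw [p.2.1.left_eq_zero h0]
    rw [h2] at h0
    rw [p'.2.1.left_eq_zero h0]

theorem stateOfPair_surjective {c : ι → ℂ} (hc : ∀ i, c i ≠ 0) {G : AddSubgroup (ι → QZ)}
    (hG : G ≤ Gmax (D.poly c)) : Function.Surjective (stateOfPair (D := D) hc G) := by
  classical
  rintro ⟨⟨g, hg⟩, ⟨h, hb⟩, hinv⟩
  have hext : ∀ (i : ι) (hi : g i = 0),
      extendState (D := D) (G := G) ⟨⟨g, hg⟩, ⟨h, hb⟩, hinv⟩ i = h ⟨i, hi⟩ :=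
    fun i hi => dif_pos hi
  have hext0 : ∀ (i : ι) (_ : g i ≠ 0),
      extendState (D := D) (G := G) ⟨⟨g, hg⟩, ⟨h, hb⟩, hinv⟩ i = 0 := fun i hi => dif_neg hi
  set k := extendState (D := D) (G := G) ⟨⟨g, hg⟩, ⟨h, hb⟩, hinv⟩ with hk
  -- The lift of zero is `1` exactly where the form vector vanishes; this choice makes the
  -- conditions on the pair symmetric.
  set γ : ι → ℚ := fun i => if g i = 0 then (if k i = 0 then 1 else 0) else rep (g i) with hγ
  have hrepz : ∀ i, g i ≠ 0 → rep (g i) ≠ 0 := by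
    intro i hi h0
    have := coe_rep (g i)
    rw [h0] at this
    exact hi this.symm
  have hcls : cls γ = g := by
    ext i
    simp only [cls, hγ]
    split_ifs with h1 h2
    · rw [h1, coe_eq_zero_iff]
      exact ⟨1, by simp⟩
    · rw [h1]
      rfl
    · exact coe_rep (g i)
  have hclosed : ∀ i j, D.next i = some j → g i = 0 → g j = 0 := fun i j hj hi =>
    eq_zero_of_mem_Gmax hc (hG hg) hj hi
  have hkfun : (fun i : FixVar g => k i) = h := funext fun i => hext i i.2
  have hmulfix : ∀ i : FixVar g, (D.fix g).transpose.mul h i = D.transpose.mul k i := by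
    intro i
    rw [restrict_transpose, ← restrict_mul D.transpose _ k hext0]
    rw [hkfun]
  have hmul0 : ∀ i, g i ≠ 0 → D.transpose.mul k i = 0 := by
    intro i hi
    rw [mul_apply, hext0 i hi, mul_zero, zero_add]
    rcases hj : D.transpose.next i with _ | p
    · rfl
    · exact hext0 p fun h0 => hi (hclosed p i (D.transpose_next.1 hj) h0)
  have hp : D.MirrorPair γ k :=
    { left_nonneg := fun i => by
        simp only [hγ]
        split_ifs
        · exact zero_le_one
        · exact le_rfl
        · exact rep_nonneg _
      left_le_one := fun i => by
        simp only [hγ]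
        split_ifs
        · exact le_rfl
        · exact zero_le_one
        · exact (rep_lt_one _).le
      right_nonneg := fun i => by
        by_cases hi : g i = 0
        · rw [hext i hi]
          exact hb.nonneg _
        · rw [hext0 i hi]
      right_le_one := fun i => by
        by_cases hi : g i = 0
        · rw [hext i hi]
          exact hb.le_one _
        · rw [hext0 i hi]
          exact zero_le_one
      support := fun i => by
        simp only [hγ]
        split_ifs with h1 h2
        · simp [h2]
        · simp [h2]
        · simp [hext0 i h1, hrepz i h1]
      left_int := (cls_mem_Gmax hc).1 (by rw [hcls]; exact hG hg)
      right_int := fun i => by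
        by_cases hi : g i = 0
        · obtain ⟨n, hn⟩ := hb.integral ⟨i, hi⟩
          exact ⟨n + 1, by rw [← hmulfix ⟨i, hi⟩, hn]; push_cast; rfl⟩
        · exact ⟨0, by rw [hmul0 i hi]; simp⟩
      right_eq_one := fun i hi => by
        by_cases h0 : g i = 0
        · rw [hext i h0] at hi
          obtain ⟨j, hj, hj0⟩ := hb.eq_one _ hi
          refine ⟨j, (D.restrict_next _).1 hj, ?_⟩
          have h3 : k j = 0 := by rw [hext j j.2, ← hj0]
          simp only [hγ, h3, if_true]
          exact if_pos j.2
        · rw [hext0 i h0] at hi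
          exact absurd hi zero_ne_one
      left_eq_one := fun j hj => by
        simp only [hγ] at hj
        split_ifs at hj with h1 h2
        -- As `h j = 0`, the positive integer `(Aᵀ h) j` is the entry of the predecessor, which is
        -- at most `1` and so equals `1`.
        · obtain ⟨n, hn⟩ := hb.integral ⟨j, h1⟩
          rw [hmulfix, mul_apply, h2, mul_zero, zero_add] at hn
          have hn0 : (0 : ℚ) ≤ n := Nat.cast_nonneg n
          rcases hq : D.transpose.next j with _ | q
          · rw [hq] at hn
            simp only [Option.elim] at hn
            linarith
          · rw [hq] at hn
            simp only [Option.elim] at hn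
            refine ⟨q, D.transpose_next.1 hq, ?_⟩
            by_cases h0 : g q = 0
            · have h3 := hb.le_one ⟨q, h0⟩
              rw [← hext q h0] at h3
              linarith
            · rw [hext0 q h0] at hn
              linarith
        · exact absurd hj zero_ne_one
        · exact absurd hj (rep_lt_one _).ne }
  have hperp : D.Perp G k := by
    refine (invariantForm_iff_perp (g := g) hext0 hmul0 ?_).1 ?_
    · rw [hkfun]
      exact hb.integral
    · rw [hkfun]
      exact hinv
  refine ⟨⟨(γ, k), hp, by rw [hcls]; exact hg, hperp⟩, state_ext hcls ?_⟩
  rw [extendState_stateOfPair]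

/-- The basis elements of the state space correspond to pairs. -/
def pairEquiv {c : ι → ℂ} (hc : ∀ i, c i ≠ 0) {G : AddSubgroup (ι → QZ)}
    (hG : G ≤ Gmax (D.poly c)) : D.PairIndex G ≃ D.StateIndex G :=
  Equiv.ofBijective _ ⟨stateOfPair_injective hc G, stateOfPair_surjective hc hG⟩

end ChainLoop

/-! ### Bi-degrees of pairs -/

namespace ChainLoop

theorem MirrorPair.rep_cls {ι : Type} {D : ChainLoop ι} {γ h : ι → ℚ} (hp : D.MirrorPair γ h)
    (i : ι) [Decidable (γ i = 1)] :
    rep (cls γ i) = γ i - if γ i = 1 then 1 else 0 := by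
  rw [cls, rep_coe]
  split_ifs with h1
  · rw [h1]
    simp
  · rw [sub_zero, Int.fract_eq_self]
    exact ⟨hp.left_nonneg i, (hp.left_le_one i).lt_of_ne h1⟩

theorem MirrorPair.rep_neg_cls {ι : Type} {D : ChainLoop ι} {γ h : ι → ℚ} (hp : D.MirrorPair γ h)
    (i : ι) [Decidable (γ i = 0)] : rep ((-cls γ) i) = (if γ i = 0 then 0 else 1) - γ i := by
  rw [Pi.neg_apply, cls, ← AddCircle.coe_neg, rep_coe]
  split_ifs with h0
  · rw [h0]
    simp
  · have h1 := (hp.left_nonneg i).lt_of_ne (Ne.symm h0)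
    have h2 := hp.left_le_one i
    rw [Int.fract_eq_iff]
    exact ⟨by linarith, by linarith, -1, by push_cast; ring⟩

variable {ι : Type} [Fintype ι] {D : ChainLoop ι} {c : ι → ℂ} {W : MvPolynomial ι ℂ}

open Classical in
/-- The A-model bi-degree of a pair, up to the shift by the age of the grading operator. -/
def pairDegA (γ h : ι → ℚ) : ℚ × ℚ :=
  (∑ i, (h i + γ i - if γ i = 1 then 1 else 0), ∑ i, ((if h i = 0 then 0 else 1) - h i + γ i))

open Classical in
/-- The B-model bi-degree of a pair, up to the shift by the age of the grading operator. -/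
def pairDegB (γ h : ι → ℚ) : ℚ × ℚ :=
  (∑ i, (h i + γ i - if γ i = 1 then 1 else 0), ∑ i, (h i + (if γ i = 0 then 0 else 1) - γ i))

theorem fix_mul_weight (hc : ∀ i, c i ≠ 0) {g : ι → QZ} (hg : g ∈ Gmax (D.poly c)) :
    (D.fix g).mul (fun i => D.weight i) = 1 := by
  ext i
  have h1 := congrFun D.mul_weight i
  rw [mul_apply] at h1 ⊢
  refine Eq.trans ?_ h1
  congr 1
  rcases h : D.next i with _ | j
  · have h2 : (D.fix g).next i = none := by
      rw [restrict_next_eq_none]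
      simp [h]
    rw [h2]
    rfl
  · have h2 : (D.fix g).next i = some ⟨j, eq_zero_of_mem_Gmax hc hg h i.2⟩ := by
      rw [restrict_next]
      exact h
    rw [h2]
    rfl

-- The degree is `(m + 1) · q`, that is `h A q`, and the weights still solve `A q = 1` on the fixed
-- locus because it contains the tails of its monomials.
open Classical in
theorem formDeg_eq_sum_vec (hc : ∀ i, c i ≠ 0) (hW : W = D.poly c) {g : ι → QZ}
    (hg : g ∈ Gmax W) (m : FixVar g →₀ ℕ) : formDeg W g m = ∑ i, (D.fix g).vec m i := by
  subst hW
  have h := (D.fix g).sum_mul_transpose ((D.fix g).vec m) fun i => D.weight i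
  rw [fix_mul_weight hc hg] at h
  simp only [Pi.one_apply, mul_one, mul_vec] at h
  rw [← h, formDeg, weights_poly D c hc]

theorem formDeg_isShift (hc : ∀ i, c i ≠ 0) (hW : W = D.poly c) {g : ι → QZ}
    (hg : g ∈ Gmax W) {h : FixVar g → ℚ} {m : FixVar g →₀ ℕ} {k : FixVar g → ℤ}
    (hb : (D.fix g).IsBasic h) (hs : (D.fix g).IsShift h m k) :
    formDeg W g m = formDeg W g ((D.fix g).mon h) := by
  rw [formDeg_eq_sum_vec hc hW hg, formDeg_eq_sum_vec hc hW hg, vec_mon hb,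
    Finset.sum_congr rfl fun i _ => hs.2 i, Finset.sum_add_distrib]
  have : ∑ i, (k i : ℚ) = 0 := by exact_mod_cast hs.1
  rw [this, add_zero]

/-- The weights lie in `(0, 1/2]`, so they are their own representatives. -/
theorem age_expGrading (hc : ∀ i, c i ≠ 0) (hW : W = D.poly c) :
    age (expGrading W) = ∑ i, D.weight i := by
  subst hW
  refine Finset.sum_congr rfl fun i _ => ?_
  rw [expGrading, weights_poly D c hc, rep_coe, Int.fract_eq_self]
  have := D.weight_bounds i
  exact ⟨this.1.le, by linarith⟩

open Classical in
theorem MirrorPair.fixDim_eq {γ h : ι → ℚ} (hp : D.MirrorPair γ h) :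
    (fixDim (cls γ) : ℚ) = ∑ i, ((if h i = 0 then 0 else 1) + if γ i = 1 then 1 else 0) := by
  have h1 : ∀ i, (((if h i = 0 then 0 else 1) + if γ i = 1 then 1 else 0 : ℚ)) =
      if cls γ i = 0 then 1 else 0 := by
    intro i
    have h2 := hp.cls_eq_zero (i := i)
    have h3 := hp.support i
    by_cases h0 : γ i = 0
    · simp [h2, h3, h0]
    · by_cases h4 : γ i = 1
      · simp [h2, h3, h4]
      · simp [h2, h3, h4, h0]
  rw [Finset.sum_congr rfl fun i _ => h1 i, Finset.sum_boole, fixDim, Nat.card_eq_fintype_card,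
    Fintype.card_subtype]

theorem formDeg_stateOfPair (hc : ∀ i, c i ≠ 0) (hW : W = D.poly c) {γ h : ι → ℚ}
    (hp : D.MirrorPair γ h) :
    formDeg W (cls γ) ((D.fix (cls γ)).mon fun i => h i) = ∑ i, h i := by
  classical
  have hg : cls γ ∈ Gmax W := hW ▸ (cls_mem_Gmax hc).2 hp.left_int
  rw [formDeg_eq_sum_vec hc hW hg, vec_mon hp.isBasic,
    sum_fixVar (cls γ) h fun i hi => hp.right_eq_zero hi]

theorem bidegA_stateOfPair (hc : ∀ i, c i ≠ 0) (hW : W = D.poly c) {γ h : ι → ℚ}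
    (hp : D.MirrorPair γ h) :
    bidegA W (cls γ) ((D.fix (cls γ)).mon fun i => h i) =
      pairDegA γ h - (∑ i, D.weight i, ∑ i, D.weight i) := by
  classical
  rw [bidegA, formDeg_stateOfPair hc hW hp, age_expGrading hc hW, hp.fixDim_eq, age,
    Finset.sum_congr rfl fun i _ => hp.rep_cls i, pairDegA]
  simp only [Finset.sum_add_distrib, Finset.sum_sub_distrib, Prod.mk_sub_mk, Prod.mk.injEq]
  constructor <;> ring

theorem bidegB_stateOfPair (hc : ∀ i, c i ≠ 0) (hW : W = D.poly c) {γ h : ι → ℚ}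
    (hp : D.MirrorPair γ h) :
    bidegB W (cls γ) ((D.fix (cls γ)).mon fun i => h i) =
      pairDegB γ h - (∑ i, D.weight i, ∑ i, D.weight i) := by
  classical
  rw [bidegB, formDeg_stateOfPair hc hW hp, age_expGrading hc hW, age, age,
    Finset.sum_congr rfl fun i _ => hp.rep_cls i,
    Finset.sum_congr rfl fun i _ => hp.rep_neg_cls i, pairDegB]
  simp only [Finset.sum_add_distrib, Finset.sum_sub_distrib, Prod.mk_sub_mk, Prod.mk.injEq]
  constructor <;> ring

/-- The second components agree term by term. The first differ by the numbers of entries `1` in `h`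
and in `γ`, which are equal because such entries are matched along the edges of `next`. -/
theorem MirrorPair.pairDegB_swap {γ h : ι → ℚ} (hp : D.MirrorPair γ h) :
    pairDegB h γ = pairDegA γ h := by
  classical
  have key : ∑ i, (if h i = 1 then (1 : ℚ) else 0) = ∑ i, if γ i = 1 then (1 : ℚ) else 0 := by
    have h1 : ∀ i, (if h i = 1 then (1 : ℚ) else 0) =
        1 * (D.next i).elim 0 fun j => if γ j = 1 then (1 : ℚ) else 0 := by
      intro i
      rw [one_mul]
      by_cases hi : h i = 1
      · obtain ⟨j, hj, hγ⟩ := hp.right_eq_one i hi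
        simp [hi, hj, hγ]
      · rw [if_neg hi]
        rcases hj : D.next i with _ | j
        · rfl
        · have : γ j ≠ 1 := by
            intro hγ
            obtain ⟨i', hi', h1⟩ := hp.left_eq_one j hγ
            exact hi (D.next_inj hj hi' ▸ h1)
          simp [this]
    rw [Finset.sum_congr rfl fun i _ => h1 i, D.sum_elim]
    refine Finset.sum_congr rfl fun j _ => ?_
    by_cases hγ : γ j = 1
    · obtain ⟨i, hi, -⟩ := hp.left_eq_one j hγ
      simp [D.transpose_next.2 hi]
    · simp [hγ]
  rw [pairDegA, pairDegB]
  simp only [Finset.sum_add_distrib, Finset.sum_sub_distrib, key, Prod.mk.injEq]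
  constructor <;> ring

/-- A bijection of pairs compatible with the bi-degrees induces a bigraded isomorphism from the
A-model to the B-model. -/
theorem exists_equiv_of_pairEquiv {ι' : Type} [Fintype ι'] {D' : ChainLoop ι'} {c' : ι' → ℂ}
    {W' : MvPolynomial ι' ℂ} {G : AddSubgroup (ι → QZ)} {G' : AddSubgroup (ι' → QZ)}
    (hc : ∀ i, c i ≠ 0) (hW : W = D.poly c) (hG : G ≤ Gmax W)
    (hc' : ∀ i, c' i ≠ 0) (hW' : W' = D'.poly c') (hG' : G' ≤ Gmax W')
    (hwt : ∑ i, D.weight i = ∑ i, D'.weight i) (e : D.PairIndex G ≃ D'.PairIndex G')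
    (he : ∀ p, pairDegB (e p).1.1 (e p).1.2 = pairDegA p.1.1 p.1.2) :
    ∃ f : StateSpace W G ≃ₗ[ℂ] StateSpace W' G', ∀ r,
      (pieceA W G r).map f.toLinearMap = pieceB W' G' r := by
  refine D.exists_equiv_of_index_equiv hc hW hG (d := bidegA W) ?_ D' hc' hW' hG'
    (d' := bidegB W') ?_
    (((pairEquiv hc (hW ▸ hG)).symm.trans e).trans (pairEquiv hc' (hW' ▸ hG'))) ?_
  · intro g hg h m k hb hs
    rw [bidegA, bidegA, formDeg_isShift hc hW (hG hg) hb hs]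
  · intro g hg h m k hb hs
    rw [bidegB, bidegB, formDeg_isShift hc' hW' (hG' hg) hb hs]
  · intro t
    obtain ⟨p, rfl⟩ := (pairEquiv hc (hW ▸ hG)).surjective t
    rw [Equiv.trans_apply, Equiv.trans_apply, Equiv.symm_apply_apply]
    exact (bidegB_stateOfPair hc' hW' (e p).2.1).trans
      (((congrArg₂ _ (he p) (by rw [hwt]))).trans (bidegA_stateOfPair hc hW p.2.1).symm)

end ChainLoop

/-! ### Classification of the invertible polynomials -/

/-- A curve through the origin that leaves it at once cannot consist of critical points. Isolation
is used below only in this form, on coordinate axes and on monomial curves. -/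
theorem HasIsolatedSingularity.exists_ne_zero {ι : Type} {W : MvPolynomial ι ℂ}
    (hW : HasIsolatedSingularity W) {p : ℂ → ι → ℂ} (hp : Continuous p) (h0 : p 0 = 0)
    (hne : ∀ z, z ≠ 0 → p z ≠ 0) : ∃ z i, eval (p z) (pderiv i W) ≠ 0 := by
  have ht : Filter.Tendsto p (nhdsWithin 0 {0}ᶜ) (nhdsWithin 0 {0}ᶜ) := by
    refine tendsto_nhdsWithin_iff.2 ⟨?_, Filter.eventually_of_mem self_mem_nhdsWithin hne⟩
    have h1 : Filter.Tendsto p (nhds 0) (nhds (p 0)) := hp.tendsto 0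
    rw [h0] at h1
    exact h1.mono_left nhdsWithin_le_nhds
  obtain ⟨z, i, hz⟩ := (ht.eventually hW.2).exists
  exact ⟨z, i, hz⟩

theorem eval_pderiv {ι : Type} (W : MvPolynomial ι ℂ) (x : ι → ℂ) (i : ι) :
    eval x (pderiv i W) = ∑ d ∈ W.support,
      eval x (monomial (d - Finsupp.single i 1) (coeff d W * d i)) := by
  conv_lhs => rw [W.as_sum, map_sum, map_sum]
  simp_rw [pderiv_monomial]

theorem eval_monomial_eq_zero {ι : Type} {x : ι → ℂ} {d : ι →₀ ℕ} {i : ι} (hx : x i = 0)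
    (hd : d i ≠ 0) (r : ℂ) : eval x (monomial d r) = 0 := by
  rw [eval_monomial, Finsupp.prod, Finset.prod_eq_zero (Finsupp.mem_support_iff.2 hd)
    (by rw [hx, zero_pow hd]), mul_zero]

theorem HasIsolatedSingularity.single_notMem {ι : Type} {W : MvPolynomial ι ℂ}
    (hW : HasIsolatedSingularity W) (i : ι) : Finsupp.single i 1 ∉ W.support := by
  classical
  intro hmem
  have h1 := hW.1 i
  rw [eval_pderiv, Finset.sum_eq_single_of_mem _ hmem] at h1
  · rw [tsub_self] at h1
    simp at h1
    exact mem_support_iff.1 hmem h1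
  · intro d hd hne
    by_cases hdi : d i = 0
    · simp [hdi]
    · obtain ⟨l, hl⟩ : ∃ l, ((d - Finsupp.single i 1 : ι →₀ ℕ)) l ≠ 0 := by
        by_contra! h2
        refine hne ?_
        ext l
        have h3 := h2 l
        rw [Finsupp.tsub_apply] at h3
        by_cases hl : l = i
        · subst hl
          simp at h3 ⊢
          omega
        · rw [Finsupp.single_eq_of_ne hl] at h3 ⊢
          omega
      exact eval_monomial_eq_zero (i := l) rfl hl _

/-- Every variable is the leading variable of some monomial. -/
theorem HasIsolatedSingularity.exists_pointer {ι : Type} {W : MvPolynomial ι ℂ}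
    (hW : HasIsolatedSingularity W) (j : ι) : ∃ d ∈ W.support, ∃ o : Option ι, o ≠ some j ∧
      d j ≠ 0 ∧ d = Finsupp.single j (d j) + o.elim 0 (fun l => Finsupp.single l 1) := by
  classical
  -- Some derivative is nonzero on the `j`-th axis; a monomial responsible for it becomes a power of
  -- `x_j` after removing one factor `x_l`.
  obtain ⟨z, l, hz⟩ := hW.exists_ne_zero (p := fun z => Pi.single j z)
    (continuous_single (A := fun _ => ℂ) j) (Pi.single_zero j) (fun z hz => by simpa using hz)
  rw [eval_pderiv] at hz
  obtain ⟨d, hd, hne⟩ := Finset.exists_ne_zero_of_sum_ne_zero hz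
  have hdl : d l ≠ 0 := by
    intro h0
    simp [h0] at hne
  have hout : ∀ i, i ≠ j → (d - Finsupp.single l 1 : ι →₀ ℕ) i = 0 := by
    intro i hi
    by_contra h0
    exact hne (eval_monomial_eq_zero (i := i) (by simp [hi]) h0 _)
  refine ⟨d, hd, ?_⟩
  by_cases hlj : l = j
  · subst hlj
    refine ⟨none, by simp, hdl, ?_⟩
    ext i
    by_cases hi : i = l
    · simp [hi]
    · have := hout i hi
      rw [Finsupp.tsub_apply, Finsupp.single_eq_of_ne hi] at this
      simpa [hi] using this
  · have hdl1 : d l = 1 := by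
      have := hout l hlj
      rw [Finsupp.tsub_apply, Finsupp.single_eq_same] at this
      omega
    have heq : d = Finsupp.single j (d j) + Finsupp.single l 1 := by
      ext i
      by_cases hi : i = j
      · subst hi
        simp [Ne.symm hlj]
      · by_cases hil : i = l
        · subst hil
          simp [hi, hdl1]
        · have := hout i hi
          rw [Finsupp.tsub_apply, Finsupp.single_eq_of_ne hil] at this
          simpa [hi, hil] using this
    refine ⟨some l, by simpa using hlj, fun h0 => ?_, heq⟩
    rw [h0, Finsupp.single_zero, zero_add] at heq
    exact hW.single_notMem l (heq ▸ hd)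

/-- Two variables do not point to the same variable. -/
theorem HasIsolatedSingularity.pointer_injective {ι : Type} {W : MvPolynomial ι ℂ}
    (hW : HasIsolatedSingularity W) {b : ι → ℕ} (hb : ∀ i, 2 ≤ b i) {φ : ι → Option ι}
    (hφ : ∀ i, φ i ≠ some i)
    (hsupp : ∀ d ∈ W.support, ∃ i,
      Finsupp.single i (b i) + (φ i).elim 0 (fun l => Finsupp.single l 1) = d)
    {j₁ j₂ l : ι} (h₁ : φ j₁ = some l) (h₂ : φ j₂ = some l)
    (hc₂ : coeff (Finsupp.single j₂ (b j₂) + Finsupp.single l 1) W ≠ 0) : j₁ = j₂ := by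
  classical
  by_contra hne
  have hl₁ : l ≠ j₁ := fun e => hφ j₁ (e ▸ h₁)
  have hl₂ : l ≠ j₂ := fun e => hφ j₂ (e ▸ h₂)
  set d₁ := Finsupp.single j₁ (b j₁) + Finsupp.single l 1 with hd₁
  set d₂ := Finsupp.single j₂ (b j₂) + Finsupp.single l 1 with hd₂
  have hb₂ := hb j₂
  have hb₁ := hb j₁
  -- The root `t` makes the two contributions to `∂_l` cancel along `(z ^ b j₂, t * z ^ b j₁)`. All
  -- other contributions to derivatives vanish there: the remaining monomials contain the square of
  -- a variable that is zero on the curve, and `x_l` is zero too. The whole curve would be critical.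
  obtain ⟨t, ht⟩ := IsAlgClosed.exists_pow_nat_eq (-(coeff d₁ W / coeff d₂ W))
    (by omega : 0 < b j₂)
  let p : ℂ → ι → ℂ := fun z => Pi.single j₁ (z ^ b j₂) + Pi.single j₂ (t * z ^ b j₁)
  have hp₁ : ∀ z, p z j₁ = z ^ b j₂ := fun z => by simp [p, hne]
  have hp₂ : ∀ z, p z j₂ = t * z ^ b j₁ := fun z => by simp [p, Ne.symm hne]
  have hp : ∀ z i, i ≠ j₁ → i ≠ j₂ → p z i = 0 := fun z i h h' => by simp [p, h, h']
  obtain ⟨z, i, hz⟩ := hW.exists_ne_zero (p := p)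
    (((continuous_single (A := fun _ => ℂ) j₁).comp (by fun_prop)).add
      ((continuous_single (A := fun _ => ℂ) j₂).comp (by fun_prop)))
    (by
      change (Pi.single j₁ ((0 : ℂ) ^ b j₂) : ι → ℂ) + (Pi.single j₂ (t * 0 ^ b j₁) : ι → ℂ) = 0
      rw [zero_pow (by omega), zero_pow (by omega), mul_zero, Pi.single_zero, Pi.single_zero,
        add_zero])
    (fun z hz h0 => pow_ne_zero (b j₂) hz (by rw [← hp₁, h0]; rfl))
  refine hz ?_
  have hterm : ∀ d ∈ W.support, d ≠ d₁ → d ≠ d₂ →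
      eval (p z) (monomial (d - Finsupp.single i 1) (coeff d W * d i)) = 0 := by
    intro d hd hn₁ hn₂
    obtain ⟨j, rfl⟩ := hsupp d hd
    have hj₁ : j ≠ j₁ := fun e => hn₁ (by rw [e, h₁, hd₁]; rfl)
    have hj₂ : j ≠ j₂ := fun e => hn₂ (by rw [e, h₂, hd₂]; rfl)
    refine eval_monomial_eq_zero (hp z j hj₁ hj₂) ?_ _
    have := hb j
    rw [Finsupp.tsub_apply, Finsupp.add_apply, Finsupp.single_eq_same]
    have h3 : Finsupp.single i 1 j ≤ 1 := by
      rw [Finsupp.single_apply]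
      split_ifs <;> simp
    omega
  have hd12 : d₁ ≠ d₂ := by
    intro e
    have := DFunLike.congr_fun e j₁
    simp [hd₁, hd₂, hl₁.symm, hne] at this
    omega
  have hsum : eval (p z) (pderiv i W) =
      eval (p z) (monomial (d₁ - Finsupp.single i 1) (coeff d₁ W * d₁ i)) +
        eval (p z) (monomial (d₂ - Finsupp.single i 1) (coeff d₂ W * d₂ i)) := by
    rw [eval_pderiv, ← Finset.sum_pair
      (f := fun d => eval (p z) (monomial (d - Finsupp.single i 1) (coeff d W * d i))) hd12]
    refine Finset.sum_congr_of_eq_on_inter ?_ ?_ ?_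
    · intro d hd hn
      simp only [Finset.mem_insert, Finset.mem_singleton, not_or] at hn
      exact hterm d hd hn.1 hn.2
    · intro d _ hn
      rw [notMem_support_iff.1 hn]
      simp
    · intros
      rfl
  rw [hsum]
  by_cases hil : i = l
  · subst hil
    rw [hd₁, hd₂, add_tsub_cancel_right, add_tsub_cancel_right, eval_monomial_single,
      eval_monomial_single, hp₁, hp₂, ← hd₁, ← hd₂]
    have e₁ : d₁ i = 1 := by simp [hd₁, hl₁]
    have e₂ : d₂ i = 1 := by simp [hd₂, hl₂]
    rw [e₁, e₂, mul_pow, ht]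
    field_simp
    ring
  · have h0 : p z l = 0 := hp z l hl₁ hl₂
    rw [eval_monomial_eq_zero h0, eval_monomial_eq_zero h0, add_zero]
    · simp [hd₂, hl₂, Ne.symm hil]
    · simp [hd₁, hl₁, Ne.symm hil]

/-- A polynomial with an isolated singularity, as many monomials as variables and no monomial
`x_i x_j` pointed at is of chain and loop shape. -/
theorem HasIsolatedSingularity.exists_chainLoop {ι : Type} [Fintype ι] {W : MvPolynomial ι ℂ}
    (hW : HasIsolatedSingularity W) (hcard : W.support.card = Fintype.card ι)
    (htwo : ∀ d ∈ W.support, ∀ j (o : Option ι), o ≠ some j → d j ≠ 0 →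
      d = Finsupp.single j (d j) + o.elim 0 (fun l => Finsupp.single l 1) → 2 ≤ d j) :
    ∃ (D : ChainLoop ι) (c : ι → ℂ), (∀ i, c i ≠ 0) ∧ W = D.poly c := by
  classical
  choose d hd φ hφ hne heq using hW.exists_pointer
  have h2 : ∀ j, 2 ≤ d j j := fun j => htwo (d j) (hd j) j (φ j) (hφ j) (hne j) (heq j)
  have hinj : Function.Injective d := by
    intro j j' h
    by_contra hjj
    have h3 := h2 j'
    rw [← h, heq j] at h3
    rw [Finsupp.add_apply, Finsupp.single_eq_of_ne (Ne.symm hjj), zero_add] at h3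
    rcases hφj : φ j with _ | l
    · simp [hφj] at h3
    · rw [hφj] at h3
      simp only [Option.elim, Finsupp.single_apply] at h3
      split_ifs at h3 <;> omega
  -- The chosen monomials are as many as the variables, so there are no others.
  have hsupp : Finset.univ.image d = W.support := by
    refine Finset.eq_of_subset_of_card_le ?_ ?_
    · intro e he
      obtain ⟨j, -, rfl⟩ := Finset.mem_image.1 he
      exact hd j
    · rw [hcard, Finset.card_image_of_injective _ hinj, Finset.card_univ]
  have hφinj : ∀ j₁ j₂ l, φ j₁ = some l → φ j₂ = some l → j₁ = j₂ := by
    intro j₁ j₂ l h₁ h₂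
    refine hW.pointer_injective (b := fun j => d j j) h2 (φ := φ) hφ ?_ h₁ h₂ ?_
    · intro e he
      rw [← hsupp] at he
      obtain ⟨j, -, rfl⟩ := Finset.mem_image.1 he
      exact ⟨j, (heq j).symm⟩
    · have := heq j₂
      rw [h₂] at this
      simp only [Option.elim] at this
      rw [← this]
      exact mem_support_iff.1 (hd j₂)
  let N : ι ≃. ι :=
    { toFun := φ
      invFun := fun l => if h : ∃ j, φ j = some l then some h.choose else none
      inv := by
        intro j l
        constructor
        · intro h
          change (if h : ∃ j, φ j = some l then some h.choose else none) = some j at h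
          split_ifs at h with hex
          rw [Option.some_inj] at h
          rw [← h]
          exact hex.choose_spec
        · intro h
          have hex : ∃ j, φ j = some l := ⟨j, h⟩
          change (if h : ∃ j, φ j = some l then some h.choose else none) = some j
          rw [dif_pos hex, hφinj _ _ l hex.choose_spec h] }
  refine ⟨⟨fun j => d j j, N, h2, hφ⟩, fun j => coeff (d j) W,
    fun j => mem_support_iff.1 (hd j), ?_⟩
  have hrow : ∀ j, (⟨fun j => d j j, N, h2, hφ⟩ : ChainLoop ι).row j = d j :=
    fun j => (heq j).symm
  rw [ChainLoop.poly]
  simp_rw [hrow]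
  conv_lhs => rw [W.as_sum, ← hsupp, Finset.sum_image fun _ _ _ _ h => hinj h]

theorem IsAdmissible.isWeightSystem {ι : Type} {W : MvPolynomial ι ℂ} (hW : IsAdmissible W) :
    IsWeightSystem W (weights W) := by
  have h := hW.2.exists
  rw [weights, dif_pos h]
  exact h.choose_spec

theorem mem_support_squarePlus {n : ℕ} {f : MvPolynomial (Fin n) ℂ} {d : Fin (n + 1) →₀ ℕ}
    (hd : d ∈ (squarePlus f).support) : d = Finsupp.single 0 2 ∨ d 0 = 0 := by
  classical
  by_contra! h
  refine mem_support_iff.1 hd ?_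
  rw [squarePlus, coeff_add, coeff_X_pow, if_neg (Ne.symm h.1), zero_add]
  refine coeff_rename_eq_zero _ _ _ fun u hu => absurd ?_ h.2
  rw [← hu, Finsupp.mapDomain_of_notMem_range]
  rintro ⟨i, hi⟩
  exact Fin.succ_ne_zero i hi

/-- The shape of `x₀² + f` satisfying the Calabi–Yau condition. -/
theorem exists_chainLoop_squarePlus {n : ℕ} {f : MvPolynomial (Fin n) ℂ}
    (hW : IsInvertible (squarePlus f)) (hCY : CalabiYau (squarePlus f))
    (h0 : Finsupp.single 0 2 ∈ (squarePlus f).support) :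
    ∃ (D : ChainLoop (Fin (n + 1))) (c : Fin (n + 1) → ℂ), (∀ i, c i ≠ 0) ∧
      squarePlus f = D.poly c := by
  classical
  set W := squarePlus f with hWdef
  set q := weights W with hq
  have hqs : IsWeightSystem W q := hW.1.isWeightSystem
  have hdeg : ∀ d ∈ W.support, Finsupp.weight q d = 1 := fun d hd =>
    hqs.2 (mem_support_iff.1 hd)
  have hpos := hqs.1
  have hq0 : q 0 = 1 / 2 := by
    have := hdeg _ h0
    rw [Finsupp.weight_single] at this
    simp at this
    linarith
  have hlt : ∀ j, q j < 1 := by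
    intro j
    obtain ⟨d, hd, o, ho, hne, heq⟩ := hW.1.1.exists_pointer j
    have h1 := hdeg d hd
    rw [heq, map_add, Finsupp.weight_single] at h1
    rcases o with _ | l
    · simp only [Option.elim, map_zero, add_zero, nsmul_eq_mul] at h1 heq
      have h2 : d j ≠ 1 := by
        intro e
        rw [e] at heq
        exact hW.1.1.single_notMem j (heq ▸ hd)
      have h3 : (2 : ℚ) ≤ d j := by exact_mod_cast (by omega : 2 ≤ d j)
      nlinarith [hpos j]
    · simp only [Option.elim, Finsupp.weight_single, one_smul, nsmul_eq_mul] at h1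
      have h3 : (1 : ℚ) ≤ d j := by exact_mod_cast (by omega : 1 ≤ d j)
      nlinarith [hpos j, hpos l]
  have hsum : ∑ j, q j = 1 := by
    rw [← show age (expGrading W) = 1 from hCY]
    refine Finset.sum_congr rfl fun j _ => ?_
    rw [expGrading, rep_coe, Int.fract_eq_self.2 ⟨(hpos j).le, hlt j⟩]
  refine hW.1.1.exists_chainLoop hW.2 fun d hd j o ho hne heq => ?_
  by_contra! hlt2
  have hd1 : d j = 1 := by omega
  rcases o with _ | l
  · rw [hd1] at heq
    simp only [Option.elim, add_zero] at heq
    exact hW.1.1.single_notMem j (heq ▸ hd)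
  · have hlj : l ≠ j := by simpa using ho
    have hdl : d l = 1 := by
      rw [heq]
      simp [hlj]
    have h1 := hdeg d hd
    rw [heq, hd1, map_add, Finsupp.weight_single, one_smul] at h1
    simp only [Option.elim, Finsupp.weight_single, one_smul] at h1
    have h0' : d 0 = 0 := by
      refine (mem_support_squarePlus hd).resolve_left fun e => ?_
      have hj := DFunLike.congr_fun e j
      have hl := DFunLike.congr_fun e l
      rw [Finsupp.single_apply] at hj hl
      split_ifs at hj hl <;> omega
    have hj0 : (0 : Fin (n + 1)) ≠ j := fun e => by rw [e] at h0'; omega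
    have hl0 : (0 : Fin (n + 1)) ≠ l := fun e => by rw [e] at h0'; omega
    -- A monomial `x_j * x_l` gives `q j + q l = 1`; together with `q 0 = 1/2` this exceeds the
    -- total weight `1`.
    have h3 : ∑ i ∈ ({0, j, l} : Finset (Fin (n + 1))), q i ≤ ∑ i, q i :=
      Finset.sum_le_sum_of_subset_of_nonneg (Finset.subset_univ _) fun i _ _ => (hpos i).le
    rw [Finset.sum_insert (by simp [hj0, hl0]), Finset.sum_pair (Ne.symm hlj), hq0, hsum] at h3
    linarith

/-- The exponent matrix of a polynomial of chain and loop shape agrees with that shape up to a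
permutation of its rows. -/
theorem IsExponentMatrix.exists_perm {ι : Type} [Fintype ι] {D : ChainLoop ι} {c : ι → ℂ}
    (hc : ∀ i, c i ≠ 0) {A : Matrix ι ι ℕ} (hA : IsExponentMatrix (D.poly c) A) :
    ∃ π : ι ≃ ι, ∀ i, A i = D.row (π i) := by
  have h1 : ∀ i, ∃ j, A i = D.row j := by
    intro i
    obtain ⟨j, hj⟩ := (D.mem_support_poly c hc (Finsupp.equivFunOnFinite.symm (A i))).1
      ((hA.2 _).2 ⟨i, rfl⟩)
    exact ⟨j, by rw [hj]; rfl⟩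
  choose π hπ using h1
  have hinj : Function.Injective π := fun i i' h => hA.1 (by rw [hπ, hπ, h])
  exact ⟨Equiv.ofBijective π (Finite.injective_iff_bijective.1 hinj), hπ⟩

/-- The permutation is needed because the shape labels monomials by their leading variables, while
the rows of the matrix come in any order. As `f` does not involve `x₀`, this variable has neither
successor nor predecessor. -/
theorem exists_shape_squarePlus {n : ℕ} {f : MvPolynomial (Fin n) ℂ}
    (hW : IsInvertible (squarePlus f)) (hCY : CalabiYau (squarePlus f))
    {A : Matrix (Fin (n + 1)) (Fin (n + 1)) ℕ} (hA : IsExponentMatrix (squarePlus f) A)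
    (hA0 : A 0 = Pi.single 0 2) :
    ∃ (D : ChainLoop (Fin (n + 1))) (c : Fin (n + 1) → ℂ) (π : Fin (n + 1) ≃ Fin (n + 1)),
      (∀ i, c i ≠ 0) ∧ squarePlus f = D.poly c ∧ (∀ i, A i = D.row (π i)) ∧ π 0 = 0 ∧
      D.exp 0 = 2 ∧ D.next 0 = none ∧ D.transpose.next 0 = none := by
  classical
  have h0 : Finsupp.single 0 2 ∈ (squarePlus f).support :=
    (hA.2 _).2 ⟨0, by rw [hA0, Finsupp.single_eq_pi_single]⟩
  obtain ⟨D, c, hc, hD⟩ := exists_chainLoop_squarePlus hW hCY h0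
  have hA' := hA
  rw [hD] at hA'
  obtain ⟨π, hπ⟩ := hA'.exists_perm hc
  have hrow : D.row (π 0) = Finsupp.single 0 2 := by
    apply DFunLike.coe_injective
    rw [← hπ, hA0, Finsupp.single_eq_pi_single]
  have hπ0 : π 0 = 0 := by
    by_contra hne
    have h1 := D.row_self (π 0)
    rw [hrow, Finsupp.single_eq_of_ne hne] at h1
    have := D.two_le (π 0)
    omega
  rw [hπ0] at hrow
  refine ⟨D, c, π, hc, hD, hπ, hπ0, ?_, ?_, ?_⟩
  · rw [← D.row_self 0, hrow, Finsupp.single_eq_same]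
  · rcases h : D.next 0 with _ | j
    · rfl
    · have hj : j ≠ 0 := fun e => D.next_ne 0 (e ▸ h)
      have h1 := D.row_of_ne hj
      rw [hrow, D.tail_of_some h, Finsupp.single_eq_same, Finsupp.single_eq_of_ne hj] at h1
      exact absurd h1 zero_ne_one
  · rcases h : D.transpose.next 0 with _ | j
    · rfl
    · have h' := D.transpose_next.1 h
      have hj : 0 ≠ j := fun e => D.next_ne j (by rw [h', e])
      have h1 := D.row_of_ne hj
      rw [D.tail_of_some h', Finsupp.single_eq_same] at h1
      have h2 : D.row j ∈ (squarePlus f).support := by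
        rw [hD, D.mem_support_poly c hc]
        exact ⟨j, rfl⟩
      rcases mem_support_squarePlus h2 with h3 | h3
      · rw [h3, Finsupp.single_eq_same] at h1
        omega
      · omega

namespace ChainLoop

/-! ### Dual groups -/

section dual

variable {ι : Type} [Fintype ι]

/-- `G` and `K` are annihilators of each other under the pairing given by the exponent matrix. -/
structure IsDual (D : ChainLoop ι) (G K : AddSubgroup (ι → QZ)) : Prop where
  mem_left : ∀ v : ι → ℚ, cls v ∈ G ↔ (∀ i, ∃ z : ℤ, D.mul v i = z) ∧ D.transpose.Perp K v
  mem_right : ∀ h : ι → ℚ, cls h ∈ K ↔ (∀ i, ∃ z : ℤ, D.transpose.mul h i = z) ∧ D.Perp G h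

theorem IsDual.transpose {D : ChainLoop ι} {G K : AddSubgroup (ι → QZ)} (hGK : D.IsDual G K) :
    D.transpose.IsDual K G where
  mem_left := hGK.mem_right
  mem_right := hGK.mem_left

/-- The columns of `A⁻¹` generate the maximal symmetry group, with the integers `A v` as
coefficients. -/
theorem cls_eq_sum (D : ChainLoop ι) [DecidableEq ι] {v : ι → ℚ} {z : ι → ℤ}
    (hz : ∀ i, D.mul v i = z i) :
    cls v = ∑ i, z i • cls (D.mulEquiv.symm (Pi.single i 1)) := by
  have h1 : v = ∑ i, (z i : ℚ) • D.mulEquiv.symm (Pi.single i 1) := by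
    apply D.mulEquiv.injective
    rw [map_sum]
    ext l
    simp [mulEquiv_apply, hz, Finset.sum_apply, Pi.single_apply]
  ext l
  conv_lhs => rw [cls, h1]
  rw [Finset.sum_apply, coe_sum, Finset.sum_apply]
  refine Finset.sum_congr rfl fun i _ => ?_
  rw [Pi.smul_apply, Pi.smul_apply, smul_eq_mul, cls, ← zsmul_eq_mul, AddCircle.coe_zsmul]

/-- On the maximal symmetry group a character is determined by its values on the columns of `A⁻¹`;
lifts of these values are the entries of `t`. -/
theorem exists_lift_character (D : ChainLoop ι) (χ : (ι → QZ) →+ QZ) :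
    ∃ t : ι → ℚ, ∀ v : ι → ℚ, (∀ i, ∃ z : ℤ, D.mul v i = z) →
      ((∑ i, D.transpose.mul t i * v i : ℚ) : QZ) = χ (cls v) := by
  classical
  refine ⟨fun i => rep (χ (cls (D.mulEquiv.symm (Pi.single i 1)))), fun v hv => ?_⟩
  choose z hz using hv
  rw [D.cls_eq_sum hz, map_sum, sum_mul_transpose, coe_sum]
  refine Finset.sum_congr rfl fun i _ => ?_
  rw [map_zsmul, hz, mul_comm, ← zsmul_eq_mul, AddCircle.coe_zsmul, coe_rep]

/-- Every subgroup of the group of diagonal symmetries is its own double annihilator. -/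
theorem isDual_of_mem_right {D : ChainLoop ι} {G K : AddSubgroup (ι → QZ)}
    (hG : ∀ v : ι → ℚ, cls v ∈ G → ∀ i, ∃ z : ℤ, D.mul v i = z)
    (hK : ∀ h : ι → ℚ, cls h ∈ K ↔ (∀ i, ∃ z : ℤ, D.transpose.mul h i = z) ∧ D.Perp G h) :
    D.IsDual G K where
  mem_left v := by
    classical
    refine ⟨fun hv => ⟨hG v hv, fun u hu => ?_⟩, fun ⟨hv, hperp⟩ => ?_⟩
    · obtain ⟨z, hz⟩ := ((hK u).1 hu).2 v hv
      refine ⟨z, ?_⟩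
      rw [← hz, sum_mul_transpose]
      exact Finset.sum_congr rfl fun i _ => mul_comm _ _
    · by_contra hmem
      -- A class outside `G` is detected by a character trivial on `G`. Written as a pairing with
      -- some `t`, this character shows that `t` lies in `K`, against the assumption on `v`.
      obtain ⟨χ, hχ⟩ := CharacterModule.exists_character_apply_ne_zero_of_ne_zero
        (A := (ι → QZ) ⧸ G) (a := QuotientAddGroup.mk (cls v))
        (fun h0 => hmem ((QuotientAddGroup.eq_zero_iff _).1 h0))
      let ψ : (ι → QZ) →+ QZ := AddMonoidHom.comp χ (QuotientAddGroup.mk' G)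
      obtain ⟨t, ht⟩ := D.exists_lift_character ψ
      refine hχ ?_
      change ψ (cls v) = 0
      rw [← ht v hv, coe_eq_zero_iff]
      have htK : cls t ∈ K := by
        refine (hK t).2 ⟨fun i => ?_, fun u hu => ?_⟩
        -- Unit vectors have class zero, so the character is trivial on them, which gives the
        -- integrality of `Aᵀ t`.
        · have hint : ∀ j, ∃ z : ℤ, D.mul (Pi.single i (1 : ℚ)) j = z := by
            intro j
            have h1 : ∀ k, ∃ z : ℤ, (Pi.single i (1 : ℚ) : ι → ℚ) k = z := fun k => by
              by_cases hk : k = i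
              · exact ⟨1, by simp [hk]⟩
              · exact ⟨0, by simp [hk]⟩
            obtain ⟨z, hz⟩ := h1 j
            rcases h : D.next j with _ | k
            · exact ⟨D.exp j * z, by rw [mul_of_none D _ h, hz]; push_cast; rfl⟩
            · obtain ⟨z', hz'⟩ := h1 k
              exact ⟨D.exp j * z + z', by rw [mul_of_some D _ h, hz, hz']; push_cast; rfl⟩
          have h2 := ht _ hint
          have h3 : cls (Pi.single i (1 : ℚ)) = 0 := by
            ext k
            rw [cls, Pi.zero_apply, coe_eq_zero_iff]
            by_cases hk : k = i
            · exact ⟨1, by simp [hk]⟩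
            · exact ⟨0, by simp [hk]⟩
          rw [h3, map_zero, coe_eq_zero_iff] at h2
          simpa [Pi.single_apply] using h2
        · rw [← coe_eq_zero_iff, ht u (hG u hu)]
          change χ (QuotientAddGroup.mk (cls u)) = 0
          rw [(QuotientAddGroup.eq_zero_iff _).2 hu, map_zero]
      obtain ⟨z, hz⟩ := hperp t htK
      refine ⟨z, ?_⟩
      rw [← hz, sum_mul_transpose]
      exact Finset.sum_congr rfl fun i _ => mul_comm _ _
  mem_right := hK

end dual

/-! ### Exchanging the two square variables -/

/-- The variable `x` occurs in the polynomial in the square `x²` only. -/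
structure IsSquare {ι : Type} (D : ChainLoop ι) (x : ι) : Prop where
  exp_eq : D.exp x = 2
  next_eq : D.next x = none
  transpose_next_eq : D.transpose.next x = none

namespace IsSquare

variable {ι : Type} {D : ChainLoop ι} {x : ι}

theorem transpose (hx : D.IsSquare x) : D.transpose.IsSquare x :=
  ⟨hx.exp_eq, hx.transpose_next_eq, hx.next_eq⟩

theorem mul_apply (hx : D.IsSquare x) (v : ι → ℚ) : D.mul v x = 2 * v x := by
  rw [D.mul_of_none _ hx.next_eq, hx.exp_eq]
  norm_num

theorem next_ne (hx : D.IsSquare x) {i j : ι} (h : D.next i = some j) : j ≠ x := by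
  rintro rfl
  have h1 := D.transpose_next.2 h
  rw [hx.transpose_next_eq] at h1
  exact absurd h1 (by simp)

theorem ne_next (hx : D.IsSquare x) {i j : ι} (h : D.next i = some j) : i ≠ x := by
  rintro rfl
  rw [hx.next_eq] at h
  exact absurd h (by simp)

theorem left_ne_one (hx : D.IsSquare x) {γ h : ι → ℚ} (hp : D.MirrorPair γ h) : γ x ≠ 1 := by
  intro h1
  obtain ⟨i, hi, -⟩ := hp.left_eq_one x h1
  exact hx.next_ne hi rfl

theorem eq_half (hx : D.IsSquare x) {γ h : ι → ℚ} (hp : D.MirrorPair γ h) (h0 : γ x ≠ 0) :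
    γ x = 1 / 2 := by
  obtain ⟨z, hz⟩ := hp.left_int x
  rw [hx.mul_apply] at hz
  have h1 := (hp.left_nonneg x).lt_of_ne (Ne.symm h0)
  have h2 := (hp.left_le_one x).lt_of_ne (hx.left_ne_one hp)
  have h3 : (0 : ℚ) < z := by linarith
  have h4 : (z : ℚ) < 2 := by linarith
  have h5 : 0 < z := by exact_mod_cast h3
  have h6 : z < 2 := by exact_mod_cast h4
  obtain rfl : z = 1 := by omega
  push_cast at hz
  linarith

/-- Without a predecessor `γ x` cannot be `1`, and `2 γ x` is integral, so it is `0` or `1/2`; by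
transposition the same holds for `h x`, and exactly one of the two vanishes. -/
theorem values (hx : D.IsSquare x) {γ h : ι → ℚ} (hp : D.MirrorPair γ h) :
    γ x = 0 ∧ h x = 1 / 2 ∨ γ x = 1 / 2 ∧ h x = 0 := by
  by_cases h0 : γ x = 0
  · exact Or.inl ⟨h0, hx.transpose.eq_half hp.transpose fun h1 => (hp.support x).1 h1 h0⟩
  · exact Or.inr ⟨hx.eq_half hp h0, (hp.support x).2 h0⟩

end IsSquare

open Classical in
/-- The vector which agrees with `k` at `x` and `y`, and with `v` elsewhere. -/
def replaceAt {ι : Type} (x y : ι) (v k : ι → ℚ) (i : ι) : ℚ := if i = x ∨ i = y then k i else v i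

section replaceAt

variable {ι : Type} {x y : ι}

theorem replaceAt_of_mem (v k : ι → ℚ) {i : ι} (h : i = x ∨ i = y) : replaceAt x y v k i = k i :=
  if_pos h

theorem replaceAt_of_notMem (v k : ι → ℚ) {i : ι} (h : ¬(i = x ∨ i = y)) :
    replaceAt x y v k i = v i := if_neg h

theorem replaceAt_replaceAt (v k : ι → ℚ) :
    replaceAt x y (replaceAt x y v k) (replaceAt x y k v) = v := by
  ext i
  by_cases h : i = x ∨ i = y
  · rw [replaceAt_of_mem _ _ h, replaceAt_of_mem _ _ h]
  · rw [replaceAt_of_notMem _ _ h, replaceAt_of_notMem _ _ h]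

variable {D : ChainLoop ι}

theorem IsSquare.of_mem (hx : D.IsSquare x) (hy : D.IsSquare y) {i : ι} (h : i = x ∨ i = y) :
    D.IsSquare i := by
  rcases h with rfl | rfl
  exacts [hx, hy]

theorem mul_replaceAt_of_mem (hx : D.IsSquare x) (hy : D.IsSquare y) (v k : ι → ℚ) {i : ι}
    (h : i = x ∨ i = y) : D.mul (replaceAt x y v k) i = D.transpose.mul k i := by
  have hi := hx.of_mem hy h
  rw [hi.mul_apply, hi.transpose.mul_apply, replaceAt_of_mem _ _ h]

theorem mul_replaceAt_of_notMem (hx : D.IsSquare x) (hy : D.IsSquare y) (v k : ι → ℚ) {i : ι}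
    (h : ¬(i = x ∨ i = y)) : D.mul (replaceAt x y v k) i = D.mul v i := by
  rw [D.mul_apply, D.mul_apply, replaceAt_of_notMem _ _ h]
  congr 1
  rcases hj : D.next i with _ | j
  · rfl
  · exact replaceAt_of_notMem _ _ fun h' => (hx.of_mem hy h').next_ne hj rfl

theorem MirrorPair.replaceAt_int (hx : D.IsSquare x) (hy : D.IsSquare y) {γ h : ι → ℚ}
    (hp : D.MirrorPair γ h) (i : ι) : ∃ z : ℤ, D.mul (replaceAt x y γ h) i = z := by
  by_cases hi : i = x ∨ i = y
  · rw [mul_replaceAt_of_mem hx hy _ _ hi]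
    exact hp.right_int i
  · rw [mul_replaceAt_of_notMem hx hy _ _ hi]
    exact hp.left_int i

theorem MirrorPair.replaceAt_eq_one (hx : D.IsSquare x) (hy : D.IsSquare y) {γ h : ι → ℚ}
    (hp : D.MirrorPair γ h) (i : ι) (hi : replaceAt x y γ h i = 1) :
    ∃ j, D.next j = some i ∧ replaceAt x y h γ j = 1 := by
  by_cases hi' : i = x ∨ i = y
  · rw [replaceAt_of_mem _ _ hi'] at hi
    exact absurd hi ((hx.of_mem hy hi').transpose.left_ne_one hp.transpose)
  · rw [replaceAt_of_notMem _ _ hi'] at hi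
    obtain ⟨j, hj, h1⟩ := hp.left_eq_one i hi
    refine ⟨j, hj, ?_⟩
    rw [replaceAt_of_notMem _ _ fun h' => (hx.of_mem hy h').ne_next hj rfl, h1]

/-- Exchanging the entries of a pair at the square variables gives a pair. -/
theorem MirrorPair.replaceAt (hx : D.IsSquare x) (hy : D.IsSquare y) {γ h : ι → ℚ}
    (hp : D.MirrorPair γ h) : D.MirrorPair (replaceAt x y γ h) (replaceAt x y h γ) where
  left_nonneg i := by
    unfold ChainLoop.replaceAt
    split_ifs
    exacts [hp.right_nonneg i, hp.left_nonneg i]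
  left_le_one i := by
    unfold ChainLoop.replaceAt
    split_ifs
    exacts [hp.right_le_one i, hp.left_le_one i]
  right_nonneg i := by
    unfold ChainLoop.replaceAt
    split_ifs
    exacts [hp.left_nonneg i, hp.right_nonneg i]
  right_le_one i := by
    unfold ChainLoop.replaceAt
    split_ifs
    exacts [hp.left_le_one i, hp.right_le_one i]
  support i := by
    unfold ChainLoop.replaceAt
    split_ifs
    · rw [Ne, hp.support, not_not]
    · exact hp.support i
  left_int := hp.replaceAt_int hx hy
  right_int := hp.transpose.replaceAt_int hx.transpose hy.transpose
  right_eq_one i hi := by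
    obtain ⟨j, hj, h1⟩ := hp.transpose.replaceAt_eq_one hx.transpose hy.transpose i hi
    exact ⟨j, D.transpose_next.1 hj, h1⟩
  left_eq_one := hp.replaceAt_eq_one hx hy

/-- At a square variable both possible values of the pair contribute `(1/2, 1/2)` to the bi-degree.
-/
theorem pairDegA_replaceAt [Fintype ι] (hx : D.IsSquare x) (hy : D.IsSquare y) {γ h : ι → ℚ}
    (hp : D.MirrorPair γ h) :
    pairDegA (replaceAt x y γ h) (replaceAt x y h γ) = pairDegA γ h := by
  classical
  rw [pairDegA, pairDegA, Prod.mk.injEq]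
  constructor <;> refine Finset.sum_congr rfl fun i _ => ?_ <;> by_cases hi : i = x ∨ i = y
  · rw [replaceAt_of_mem _ _ hi, replaceAt_of_mem _ _ hi]
    rcases (hx.of_mem hy hi).values hp with h1 | h1 <;> rw [h1.1, h1.2] <;> norm_num
  · rw [replaceAt_of_notMem _ _ hi, replaceAt_of_notMem _ _ hi]
  · rw [replaceAt_of_mem _ _ hi, replaceAt_of_mem _ _ hi]
    rcases (hx.of_mem hy hi).values hp with h1 | h1 <;> rw [h1.1, h1.2] <;> norm_num
  · rw [replaceAt_of_notMem _ _ hi, replaceAt_of_notMem _ _ hi]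

open Classical in
/-- The vector with entries `1/2` at `x` and `y`, and `0` elsewhere. -/
def halfAt (x y : ι) (i : ι) : ℚ := if i = x ∨ i = y then 1 / 2 else 0

theorem halfAt_of_mem {i : ι} (h : i = x ∨ i = y) : halfAt x y i = 1 / 2 := if_pos h

theorem halfAt_of_notMem {i : ι} (h : ¬(i = x ∨ i = y)) : halfAt x y i = 0 := if_neg h

/-- Switching `0` and `1/2` is the addition of `1/2` modulo integers. -/
theorem cls_replaceAt (hx : D.IsSquare x) (hy : D.IsSquare y) {γ h : ι → ℚ}
    (hp : D.MirrorPair γ h) : cls (replaceAt x y γ h) = cls (γ + halfAt x y) := by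
  ext i
  rw [cls, cls, ← sub_eq_zero, ← AddCircle.coe_sub, coe_eq_zero_iff, Pi.add_apply]
  by_cases hi : i = x ∨ i = y
  · rw [replaceAt_of_mem _ _ hi, halfAt_of_mem hi]
    rcases (hx.of_mem hy hi).values hp with h1 | h1 <;> rw [h1.1, h1.2]
    · exact ⟨0, by norm_num⟩
    · exact ⟨-1, by norm_num⟩
  · rw [replaceAt_of_notMem _ _ hi, halfAt_of_notMem hi]
    exact ⟨0, by norm_num⟩

theorem mul_halfAt_int (hx : D.IsSquare x) (hy : D.IsSquare y) (i : ι) :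
    ∃ z : ℤ, D.mul (halfAt x y) i = z := by
  by_cases hi : i = x ∨ i = y
  · exact ⟨1, by rw [(hx.of_mem hy hi).mul_apply, halfAt_of_mem hi]; norm_num⟩
  · refine ⟨0, ?_⟩
    rw [D.mul_apply, halfAt_of_notMem hi]
    rcases hj : D.next i with _ | j
    · simp
    · simp [halfAt_of_notMem fun h' => (hx.of_mem hy h').next_ne hj rfl]

theorem sum_mul_halfAt [Fintype ι] (hx : D.IsSquare x) (hy : D.IsSquare y) (hxy : x ≠ y)
    (v : ι → ℚ) : ∑ i, D.mul v i * halfAt x y i = v x + v y := by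
  classical
  rw [← Finset.sum_subset (Finset.subset_univ {x, y}) fun i _ hi => by
    rw [halfAt_of_notMem (by simpa using hi), mul_zero], Finset.sum_pair hxy,
    halfAt_of_mem (Or.inl rfl), halfAt_of_mem (Or.inr rfl), hx.mul_apply, hy.mul_apply]
  ring

end replaceAt

/-! ### The mirror map on pairs -/

theorem cls_add {ι : Type} {v w : ι → ℚ} : cls (v + w) = cls v + cls w :=
  funext fun _ => AddCircle.coe_add _ _ _

section mirrorMap

variable {ι : Type} [Fintype ι]

/-- `G'` and `K'` are the extensions of the dual groups `G` and `K` by the involution which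
changes the signs of the square variables `x` and `y`. -/
structure IsExtended (D : ChainLoop ι) (x y : ι) (G K G' K' : AddSubgroup (ι → QZ)) : Prop where
  ne : x ≠ y
  square_left : D.IsSquare x
  square_right : D.IsSquare y
  dual : D.IsDual G K
  notMem_left : cls (halfAt x y) ∉ G
  notMem_right : cls (halfAt x y) ∉ K
  mem_left : ∀ v : ι → ℚ, cls v ∈ G' ↔ cls v ∈ G ∨ cls (v + halfAt x y) ∈ G
  mem_right : ∀ v : ι → ℚ, cls v ∈ K' ↔ cls v ∈ K ∨ cls (v + halfAt x y) ∈ K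

namespace IsExtended

variable {D : ChainLoop ι} {x y : ι} {G K G' K' : AddSubgroup (ι → QZ)}

theorem transpose (hD : D.IsExtended x y G K G' K') : D.transpose.IsExtended x y K G K' G' where
  ne := hD.ne
  square_left := hD.square_left.transpose
  square_right := hD.square_right.transpose
  dual := hD.dual.transpose
  notMem_left := hD.notMem_right
  notMem_right := hD.notMem_left
  mem_left := hD.mem_right
  mem_right := hD.mem_left

theorem cls_halfAt_mem (hD : D.IsExtended x y G K G' K') : cls (halfAt x y) ∈ G' := by
  refine (hD.mem_left _).2 (Or.inr ?_)
  have h1 : cls (halfAt x y + halfAt x y) = 0 := by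
    ext i
    rw [cls, Pi.zero_apply, coe_eq_zero_iff, Pi.add_apply]
    by_cases hi : i = x ∨ i = y
    · exact ⟨1, by rw [halfAt_of_mem hi]; norm_num⟩
    · exact ⟨0, by rw [halfAt_of_notMem hi]; norm_num⟩
  rw [h1]
  exact G.zero_mem

theorem int_of_mem (hD : D.IsExtended x y G K G' K') {v : ι → ℚ} (hv : cls v ∈ G') (i : ι) :
    ∃ z : ℤ, D.mul v i = z := by
  rcases (hD.mem_left v).1 hv with hv | hv
  · exact ((hD.dual.mem_left v).1 hv).1 i
  · obtain ⟨z, hz⟩ := ((hD.dual.mem_left _).1 hv).1 i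
    obtain ⟨w, hw⟩ := mul_halfAt_int hD.square_left hD.square_right i
    refine ⟨z - w, ?_⟩
    rw [map_add, Pi.add_apply, hw] at hz
    push_cast
    linarith

/-- The involution pairs with `h` to `h x + h y`, because the exponent `2` cancels the entries
`1/2`. -/
theorem perp_iff (hD : D.IsExtended x y G K G' K') (h : ι → ℚ) :
    D.Perp G' h ↔ D.Perp G h ∧ ∃ z : ℤ, h x + h y = z := by
  have hs := sum_mul_halfAt hD.square_left.transpose hD.square_right.transpose hD.ne h
  constructor
  · intro hp
    refine ⟨fun v hv => hp v ((hD.mem_left v).2 (Or.inl hv)), ?_⟩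
    rw [← hs]
    exact hp _ hD.cls_halfAt_mem
  · rintro ⟨hp, z, hz⟩ v hv
    rcases (hD.mem_left v).1 hv with hv | hv
    · exact hp v hv
    · obtain ⟨w, hw⟩ := hp _ hv
      refine ⟨w - z, ?_⟩
      simp only [Pi.add_apply, mul_add, Finset.sum_add_distrib] at hw
      rw [hs, hz] at hw
      push_cast
      linarith

open Classical in
/-- The mirror map: interchange sectors and forms, after moving the pair into a sector of `G`. -/
def mirrorMap (x y : ι) (G : AddSubgroup (ι → QZ)) (p : (ι → ℚ) × (ι → ℚ)) :
    (ι → ℚ) × (ι → ℚ) :=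
  if cls p.1 ∈ G then (p.2, p.1) else (replaceAt x y p.2 p.1, replaceAt x y p.1 p.2)

theorem mirrorMap_mem (hD : D.IsExtended x y G K G' K') {p : (ι → ℚ) × (ι → ℚ)}
    (hp : D.MirrorPair p.1 p.2 ∧ cls p.1 ∈ G' ∧ D.Perp G' p.2) :
    D.transpose.MirrorPair (mirrorMap x y G p).1 (mirrorMap x y G p).2 ∧
      cls (mirrorMap x y G p).1 ∈ K' ∧ D.transpose.Perp K' (mirrorMap x y G p).2 := by
  obtain ⟨γ, h⟩ := p
  obtain ⟨hm, hγ, hh⟩ := hp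
  dsimp only at hm hγ hh
  have hx := hD.square_left
  have hy := hD.square_right
  obtain ⟨hperp, z, hz⟩ := (hD.perp_iff h).1 hh
  have hK : cls h ∈ K := (hD.dual.mem_right h).2 ⟨hm.right_int, hperp⟩
  -- Integrality of `h x + h y` forces the pair to take the same value at both squares, so `γ x + γ
  -- y` is integral as well.
  have hsum : ∃ z : ℤ, γ x + γ y = z := by
    have key : ∀ z : ℤ, (1 / 2 : ℚ) ≠ z := by
      intro z hz
      have h2 : (1 : ℚ) = ((2 * z : ℤ) : ℚ) := by push_cast; linarith
      have h3 : (1 : ℤ) = 2 * z := by exact_mod_cast h2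
      omega
    rcases hx.values hm with h1 | h1 <;> rcases hy.values hm with h2 | h2 <;>
      rw [h1.2, h2.2] at hz <;> rw [h1.1, h2.1]
    · exact ⟨0, by norm_num⟩
    · exact absurd (by linarith) (key z)
    · exact absurd (by linarith) (key z)
    · exact ⟨1, by norm_num⟩
  rw [mirrorMap]
  split_ifs with hG
  · dsimp only at hG ⊢
    refine ⟨hm.transpose, (hD.mem_right h).2 (Or.inl hK), (hD.transpose.perp_iff γ).2 ⟨?_, hsum⟩⟩
    exact ((hD.dual.mem_left γ).1 hG).2
  · dsimp only at hG ⊢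
    -- Switching at the squares brings the sector back into `G` and moves the form vector into the
    -- coset of the involution in `K'`.
    have hG2 := ((hD.mem_left γ).1 hγ).resolve_left hG
    rw [← cls_replaceAt hx hy hm] at hG2
    refine ⟨(hm.replaceAt hx hy).transpose, ?_, (hD.transpose.perp_iff _).2 ⟨?_, z, ?_⟩⟩
    · rw [cls_replaceAt hx.transpose hy.transpose hm.transpose, cls_add]
      exact K'.add_mem ((hD.mem_right h).2 (Or.inl hK)) hD.transpose.cls_halfAt_mem
    · exact ((hD.dual.mem_left _).1 hG2).2
    · rw [replaceAt_of_mem _ _ (Or.inl rfl), replaceAt_of_mem _ _ (Or.inr rfl), hz]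

/-- As `h` lies in `K` and the involution does not, the image has its sector in `K` exactly when no
switch was made; the return map thus repeats the same case. -/
theorem mirrorMap_mirrorMap (hD : D.IsExtended x y G K G' K') {p : (ι → ℚ) × (ι → ℚ)}
    (hp : D.MirrorPair p.1 p.2 ∧ cls p.1 ∈ G' ∧ D.Perp G' p.2) :
    mirrorMap x y K (mirrorMap x y G p) = p := by
  obtain ⟨γ, h⟩ := p
  obtain ⟨hm, hγ, hh⟩ := hp
  dsimp only at hm hγ hh
  have hK : cls h ∈ K :=
    (hD.dual.mem_right h).2 ⟨hm.right_int, ((hD.perp_iff h).1 hh).1⟩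
  by_cases hG : cls γ ∈ G
  · rw [mirrorMap, mirrorMap, if_pos hG, if_pos hK]
  · have h1 : cls (replaceAt x y h γ) ∉ K := by
      rw [cls_replaceAt hD.square_left.transpose hD.square_right.transpose hm.transpose, cls_add]
      exact fun h2 => hD.notMem_right ((K.add_mem_cancel_left hK).1 h2)
    rw [mirrorMap, mirrorMap, if_neg hG, if_neg h1, replaceAt_replaceAt, replaceAt_replaceAt]

/-- The mirror bijection. -/
def mirrorEquiv (hD : D.IsExtended x y G K G' K') :
    D.PairIndex G' ≃ D.transpose.PairIndex K' where
  toFun p := ⟨mirrorMap x y G p, hD.mirrorMap_mem p.2⟩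
  invFun p := ⟨mirrorMap x y K p, hD.transpose.mirrorMap_mem p.2⟩
  left_inv p := Subtype.ext (hD.mirrorMap_mirrorMap p.2)
  right_inv p := Subtype.ext (hD.transpose.mirrorMap_mirrorMap p.2)

theorem pairDegB_mirrorEquiv (hD : D.IsExtended x y G K G' K') (p : D.PairIndex G') :
    pairDegB (hD.mirrorEquiv p).1.1 (hD.mirrorEquiv p).1.2 = pairDegA p.1.1 p.1.2 := by
  obtain ⟨⟨γ, h⟩, hm, hp⟩ := p
  change pairDegB (mirrorMap x y G (γ, h)).1 (mirrorMap x y G (γ, h)).2 = pairDegA γ h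
  dsimp only at hm
  rw [mirrorMap]
  split_ifs
  · exact hm.pairDegB_swap
  · have hx := hD.square_left
    have hy := hD.square_right
    exact (hm.replaceAt hx hy).pairDegB_swap.trans (pairDegA_replaceAt hx hy hm)

end IsExtended
end mirrorMap
end ChainLoop

namespace ChainLoop

/-! ### Relabelling the variables -/

section relabel

variable {ι : Type}

/-- The shape in the variables permuted by `π`. -/
def relabel (D : ChainLoop ι) (π : ι ≃ ι) : ChainLoop ι where
  exp i := D.exp (π i)
  next :=
    { toFun := fun i => (D.next (π i)).map π.symm
      invFun := fun i => (D.next.symm (π i)).map π.symm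
      inv := fun i j => by
        simp only [Option.map_eq_some_iff, Equiv.symm_apply_eq,
          exists_eq_right, D.next.eq_some_iff] }
  two_le i := D.two_le (π i)
  next_ne i h := by
    change (D.next (π i)).map π.symm = some i at h
    simp only [Option.map_eq_some_iff, Equiv.symm_apply_eq, exists_eq_right] at h
    exact D.next_ne _ h

theorem relabel_next (D : ChainLoop ι) (π : ι ≃ ι) (i : ι) :
    (D.relabel π).next i = (D.next (π i)).map π.symm := rfl

theorem relabel_next_eq_some (D : ChainLoop ι) (π : ι ≃ ι) {i j : ι} :
    (D.relabel π).next i = some j ↔ D.next (π i) = some (π j) := by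
  simp only [relabel_next, Option.map_eq_some_iff, Equiv.symm_apply_eq, exists_eq_right]

theorem relabel_transpose (D : ChainLoop ι) (π : ι ≃ ι) :
    (D.relabel π).transpose = D.transpose.relabel π := rfl

theorem relabel_mul (D : ChainLoop ι) (π : ι ≃ ι) (v : ι → ℚ) (i : ι) :
    (D.relabel π).mul (v ∘ π) i = D.mul v (π i) := by
  rw [mul_apply, mul_apply]
  congr 1
  rw [relabel_next]
  rcases D.next (π i) with _ | j <;> simp

theorem relabel_mirrorPair (D : ChainLoop ι) (π : ι ≃ ι) {γ h : ι → ℚ} :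
    (D.relabel π).MirrorPair (γ ∘ π) (h ∘ π) ↔ D.MirrorPair γ h := by
  constructor
  · intro hp
    refine ⟨π.surjective.forall.2 hp.left_nonneg, π.surjective.forall.2 hp.left_le_one,
      π.surjective.forall.2 hp.right_nonneg, π.surjective.forall.2 hp.right_le_one,
      π.surjective.forall.2 hp.support, π.surjective.forall.2 fun i => ?_,
      π.surjective.forall.2 fun i => ?_, π.surjective.forall.2 fun i hi => ?_,
      π.surjective.forall.2 fun i hi => ?_⟩
    · rw [← relabel_mul]
      exact hp.left_int i
    · rw [← relabel_mul]
      exact hp.right_int i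
    · obtain ⟨j, hj, h1⟩ := hp.right_eq_one i hi
      exact ⟨π j, (D.relabel_next_eq_some π).1 hj, h1⟩
    · obtain ⟨j, hj, h1⟩ := hp.left_eq_one i hi
      exact ⟨π j, (D.relabel_next_eq_some π).1 hj, h1⟩
  · intro hp
    refine ⟨fun i => hp.left_nonneg _, fun i => hp.left_le_one _, fun i => hp.right_nonneg _,
      fun i => hp.right_le_one _, fun i => hp.support _, fun i => ?_, fun i => ?_,
      fun i hi => ?_, fun i hi => ?_⟩
    · rw [relabel_mul]
      exact hp.left_int _
    · rw [relabel_transpose, relabel_mul]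
      exact hp.right_int _
    · obtain ⟨j, hj, h1⟩ := hp.right_eq_one _ hi
      refine ⟨π.symm j, (D.relabel_next_eq_some π).2 ?_, ?_⟩ <;> simpa
    · obtain ⟨j, hj, h1⟩ := hp.left_eq_one _ hi
      refine ⟨π.symm j, (D.relabel_next_eq_some π).2 ?_, ?_⟩ <;> simpa

/-- The group of symmetries in the original variables. -/
def relabelGroup (π : ι ≃ ι) (G : AddSubgroup (ι → QZ)) : AddSubgroup (ι → QZ) :=
  G.comap (LinearMap.funLeft ℤ QZ π).toAddMonoidHom

theorem mem_relabelGroup {π : ι ≃ ι} {G : AddSubgroup (ι → QZ)} {g : ι → QZ} :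
    g ∈ relabelGroup π G ↔ g ∘ π ∈ G := Iff.rfl

variable [Fintype ι]

theorem relabel_perp (D : ChainLoop ι) (π : ι ≃ ι) (G : AddSubgroup (ι → QZ)) {h : ι → ℚ} :
    (D.relabel π).Perp G (h ∘ π) ↔ D.Perp (relabelGroup π G) h := by
  have key : ∀ u : ι → ℚ, ∑ i, (D.relabel π).transpose.mul (h ∘ π) i * (u ∘ π) i =
      ∑ i, D.transpose.mul h i * u i := by
    intro u
    simp only [relabel_transpose, relabel_mul]
    exact Equiv.sum_comp π fun i => D.transpose.mul h i * u i
  constructor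
  · intro hp u hu
    rw [← key]
    exact hp _ hu
  · intro hp u hu
    obtain ⟨v, rfl⟩ : ∃ v : ι → ℚ, u = v ∘ π := ⟨u ∘ π.symm, by ext; simp⟩
    rw [key]
    exact hp v hu

/-- Relabelling the pairs which index a basis of the state space. -/
def relabelPairEquiv (D : ChainLoop ι) (π : ι ≃ ι) (G : AddSubgroup (ι → QZ)) :
    D.PairIndex (relabelGroup π G) ≃ (D.relabel π).PairIndex G :=
  Equiv.subtypeEquiv ((π.symm.arrowCongr (Equiv.refl ℚ)).prodCongr
    (π.symm.arrowCongr (Equiv.refl ℚ))) fun p => by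
      change _ ↔ (D.relabel π).MirrorPair (p.1 ∘ π) (p.2 ∘ π) ∧ cls (p.1 ∘ π) ∈ G ∧
        (D.relabel π).Perp G (p.2 ∘ π)
      rw [relabel_mirrorPair, relabel_perp]
      exact Iff.rfl

theorem pairDegB_relabelPairEquiv (D : ChainLoop ι) (π : ι ≃ ι) (G : AddSubgroup (ι → QZ))
    (p : D.PairIndex (relabelGroup π G)) :
    pairDegB (D.relabelPairEquiv π G p).1.1 (D.relabelPairEquiv π G p).1.2 =
      pairDegB p.1.1 p.1.2 := by
  classical
  change pairDegB (p.1.1 ∘ π) (p.1.2 ∘ π) = _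
  rw [pairDegB, pairDegB, Prod.mk.injEq]
  exact ⟨Equiv.sum_comp π fun i => p.1.2 i + p.1.1 i - if p.1.1 i = 1 then 1 else 0,
    Equiv.sum_comp π fun i => p.1.2 i + (if p.1.1 i = 0 then 0 else 1) - p.1.1 i⟩

theorem sum_weight_relabel (D : ChainLoop ι) (π : ι ≃ ι) :
    ∑ i, (D.relabel π).weight i = ∑ i, D.weight i := by
  have h1 : (D.relabel π).weight = D.weight ∘ π := by
    apply (D.relabel π).mul_injective
    ext i
    rw [mul_weight, relabel_mul, mul_weight]
    rfl
  rw [h1]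
  exact Equiv.sum_comp π D.weight

/-- The mirror polynomial has the transposed shape. -/
theorem mirrorPoly_eq (D : ChainLoop ι) (π : ι ≃ ι) {A : Matrix ι ι ℕ}
    (hA : ∀ i, A i = D.row (π i)) : mirrorPoly A = (D.transpose.relabel π).poly 1 := by
  classical
  rw [mirrorPoly, poly, ← Equiv.sum_comp π]
  refine Finset.sum_congr rfl fun i _ => ?_
  rw [monomial_eq, Finsupp.prod_fintype _ _ fun _ => pow_zero _, Pi.one_apply, C_1, one_mul]
  refine Finset.prod_congr rfl fun j _ => ?_
  congr 1
  rw [hA]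
  by_cases hij : j = i
  · subst hij
    rw [row_self, row_self]
    rfl
  · rw [row_of_ne _ hij, row_of_ne _ fun e => hij (π.injective e).symm, tail_apply, tail_apply]
    simp only [relabel_next_eq_some, transpose_next]

/-- Since `A v` is integral for every lift `v` of an element of `G`, the pairing modulo integers
depends only on the class of `h`, and the lift provided by the definition can be replaced by `h`. -/
theorem cls_mem_mirrorGroup (D : ChainLoop ι) (π : ι ≃ ι) {A : Matrix ι ι ℕ}
    (hA : ∀ i, A i = D.row (π i)) {G : AddSubgroup (ι → QZ)}
    (hG : ∀ v : ι → ℚ, cls v ∈ G → ∀ i, ∃ z : ℤ, D.mul v i = z) (h : ι → ℚ) :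
    cls h ∈ relabelGroup π (mirrorGroup A G) ↔
      (∀ i, ∃ z : ℤ, D.transpose.mul h i = z) ∧ D.Perp G h := by
  have hmax : cls (h ∘ π) ∈ Gmax (mirrorPoly A) ↔ ∀ i, ∃ z : ℤ, D.transpose.mul h i = z := by
    rw [D.mirrorPoly_eq π hA, cls_mem_Gmax (c := 1) fun _ => one_ne_zero]
    simp only [relabel_mul]
    exact (π.surjective.forall (p := fun i => ∃ z : ℤ, D.transpose.mul h i = z)).symm
  have key : ∀ a b : ι → ℚ, ∑ i, ∑ j, (a ∘ π) i * (A i j : ℚ) * b j =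
      ∑ i, a i * D.mul b i := by
    intro a b
    rw [← Equiv.sum_comp π fun i => a i * D.mul b i]
    refine Finset.sum_congr rfl fun i _ => ?_
    rw [← sum_row_mul, Finset.mul_sum]
    refine Finset.sum_congr rfl fun j _ => ?_
    rw [hA, mul_assoc, Function.comp_apply]
  constructor
  · rintro ⟨h1, a', ha', h2⟩
    refine ⟨hmax.1 h1, fun v hv => ?_⟩
    obtain ⟨a, rfl⟩ : ∃ a : ι → ℚ, a' = a ∘ π := ⟨a' ∘ π.symm, by ext; simp⟩
    obtain ⟨k, hk⟩ := h2 _ hv v fun _ => rfl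
    rw [key] at hk
    rw [sum_mul_transpose, ← coe_eq_zero_iff]
    have h3 : ((∑ i, a i * D.mul v i : ℚ) : QZ) = 0 := coe_eq_zero_iff.2 ⟨k, hk⟩
    rw [← h3, coe_sum, coe_sum]
    refine Finset.sum_congr rfl fun i _ => ?_
    obtain ⟨z, hz⟩ := hG v hv i
    have h4 : (a i : QZ) = h i := by
      have := ha' (π.symm i)
      simpa [cls] using this
    rw [hz, mul_comm, mul_comm (a i), ← zsmul_eq_mul, ← zsmul_eq_mul, AddCircle.coe_zsmul,
      AddCircle.coe_zsmul, h4]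
  · rintro ⟨h1, h2⟩
    refine ⟨hmax.2 h1, h ∘ π, fun _ => rfl, fun g hg b hb => ?_⟩
    rw [key, ← sum_mul_transpose]
    refine h2 b ?_
    rwa [show cls b = g from funext hb]

end relabel

/-! ### Sums in disjoint sets of variables -/

section sum

variable {α β : Type} (D₁ : ChainLoop α) (D₂ : ChainLoop β)

/-- The shape of a sum of polynomials in disjoint sets of variables. -/
def sum : ChainLoop (α ⊕ β) where
  exp := Sum.elim D₁.exp D₂.exp
  next :=
    { toFun := Sum.elim (fun i => (D₁.next i).map Sum.inl) fun j => (D₂.next j).map Sum.inr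
      invFun := Sum.elim (fun i => (D₁.next.symm i).map Sum.inl)
        fun j => (D₂.next.symm j).map Sum.inr
      inv := by
        rintro (i | i) (j | j) <;> simp [PEquiv.eq_some_iff] }
  two_le := by
    rintro (i | i)
    exacts [D₁.two_le i, D₂.two_le i]
  next_ne := by
    rintro (i | i) h
    · exact D₁.next_ne i (by simpa using h)
    · exact D₂.next_ne i (by simpa using h)

theorem sum_next_inl (i : α) : (D₁.sum D₂).next (Sum.inl i) = (D₁.next i).map Sum.inl := rfl

theorem sum_next_inr (i : β) : (D₁.sum D₂).next (Sum.inr i) = (D₂.next i).map Sum.inr := rfl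

theorem sum_transpose : (D₁.sum D₂).transpose = D₁.transpose.sum D₂.transpose := rfl

theorem sum_row_inl (i : α) : (D₁.sum D₂).row (Sum.inl i) = (D₁.row i).mapDomain Sum.inl := by
  rw [row, row, Finsupp.mapDomain_add, Finsupp.mapDomain_single, tail, tail, sum_next_inl]
  congr 1
  rcases D₁.next i with _ | j <;> simp [Finsupp.mapDomain_single]

theorem sum_row_inr (i : β) : (D₁.sum D₂).row (Sum.inr i) = (D₂.row i).mapDomain Sum.inr := by
  rw [row, row, Finsupp.mapDomain_add, Finsupp.mapDomain_single, tail, tail, sum_next_inr]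
  congr 1
  rcases D₂.next i with _ | j <;> simp [Finsupp.mapDomain_single]

theorem sum_mul_inl (v : α → ℚ) (w : β → ℚ) (i : α) :
    (D₁.sum D₂).mul (Sum.elim v w) (Sum.inl i) = D₁.mul v i := by
  rw [mul_apply, mul_apply, sum_next_inl]
  congr 1
  rcases D₁.next i with _ | j <;> rfl

theorem sum_mul_inr (v : α → ℚ) (w : β → ℚ) (i : β) :
    (D₁.sum D₂).mul (Sum.elim v w) (Sum.inr i) = D₂.mul w i := by
  rw [mul_apply, mul_apply, sum_next_inr]
  congr 1
  rcases D₂.next i with _ | j <;> rfl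

variable {D₁ D₂} in
theorem IsSquare.inl {x : α} (hx : D₁.IsSquare x) : (D₁.sum D₂).IsSquare (Sum.inl x) where
  exp_eq := hx.exp_eq
  next_eq := by rw [sum_next_inl, hx.next_eq]; rfl
  transpose_next_eq := by rw [sum_transpose, sum_next_inl, hx.transpose_next_eq]; rfl

variable {D₁ D₂} in
theorem IsSquare.inr {x : β} (hx : D₂.IsSquare x) : (D₁.sum D₂).IsSquare (Sum.inr x) where
  exp_eq := hx.exp_eq
  next_eq := by rw [sum_next_inr, hx.next_eq]; rfl
  transpose_next_eq := by rw [sum_transpose, sum_next_inr, hx.transpose_next_eq]; rfl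

theorem disjointSum_poly [Fintype α] [Fintype β] (c₁ : α → ℂ) (c₂ : β → ℂ) :
    disjointSum (D₁.poly c₁) (D₂.poly c₂) = (D₁.sum D₂).poly (Sum.elim c₁ c₂) := by
  simp only [disjointSum, poly, map_sum, rename_monomial, Fintype.sum_sum_type, Sum.elim_inl,
    Sum.elim_inr, sum_row_inl, sum_row_inr]

theorem disjointSumMatrix_eq {A₁ : Matrix α α ℕ} {A₂ : Matrix β β ℕ} {π₁ : α ≃ α} {π₂ : β ≃ β}
    (h₁ : ∀ i, A₁ i = D₁.row (π₁ i)) (h₂ : ∀ i, A₂ i = D₂.row (π₂ i)) (i : α ⊕ β) :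
    disjointSumMatrix A₁ A₂ i = (D₁.sum D₂).row (Equiv.sumCongr π₁ π₂ i) := by
  rcases i with i | i
  · rw [Equiv.sumCongr_apply, Sum.map_inl, sum_row_inl]
    ext (j | j)
    · rw [Finsupp.mapDomain_apply Sum.inl_injective, ← h₁]
      rfl
    · rw [Finsupp.mapDomain_of_notMem_range _ _ (by simp)]
      rfl
  · rw [Equiv.sumCongr_apply, Sum.map_inr, sum_row_inr]
    ext (j | j)
    · rw [Finsupp.mapDomain_of_notMem_range _ _ (by simp)]
      rfl
    · rw [Finsupp.mapDomain_apply Sum.inr_injective, ← h₂]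
      rfl

end sum

end ChainLoop

/-! ### The involution `σ` -/

section sigma

variable {n m : ℕ}

open ChainLoop

theorem sigma_eq : sigma n m = cls (halfAt (Sum.inl 0) (Sum.inr 0)) := by
  ext (i | i) <;> by_cases hi : i = 0 <;> simp [sigma, cls, halfAt, hi]

theorem two_nsmul_sigma : sigma n m + sigma n m = 0 := by
  rw [sigma_eq, ← cls_add]
  ext i
  rw [cls, Pi.zero_apply, coe_eq_zero_iff, Pi.add_apply]
  by_cases hi : i = Sum.inl 0 ∨ i = Sum.inr 0
  · exact ⟨1, by rw [halfAt_of_mem hi]; norm_num⟩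
  · exact ⟨0, by rw [halfAt_of_notMem hi]; norm_num⟩

theorem mem_withSigma {G : AddSubgroup (Fin (n + 1) ⊕ Fin (m + 1) → QZ)}
    {g : Fin (n + 1) ⊕ Fin (m + 1) → QZ} : g ∈ withSigma G ↔ g ∈ G ∨ g + sigma n m ∈ G := by
  constructor
  · intro hg
    obtain ⟨a, ha, b, hb, rfl⟩ := AddSubgroup.mem_sup.1 hg
    obtain ⟨k, rfl⟩ := AddSubgroup.mem_zmultiples_iff.1 hb
    have h2 : (2 : ℤ) • sigma n m = 0 := by rw [two_zsmul, two_nsmul_sigma]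
    rcases Int.even_or_odd' k with ⟨l, rfl | rfl⟩
    · left
      rw [mul_comm, mul_zsmul, h2, zsmul_zero, add_zero]
      exact ha
    · right
      rw [add_zsmul, mul_comm, mul_zsmul, h2, zsmul_zero, zero_add, one_zsmul, add_assoc,
        two_nsmul_sigma, add_zero]
      exact ha
  · have hs : sigma n m ∈ withSigma G :=
      AddSubgroup.mem_sup_right (AddSubgroup.mem_zmultiples _)
    rintro (hg | hg)
    · exact AddSubgroup.mem_sup_left hg
    · exact ((withSigma G).add_mem_cancel_right hs).1 (AddSubgroup.mem_sup_left hg)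

theorem sigma_comp_sumCongr {π₁ : Fin (n + 1) ≃ Fin (n + 1)} {π₂ : Fin (m + 1) ≃ Fin (m + 1)}
    (h₁ : π₁ 0 = 0) (h₂ : π₂ 0 = 0) : sigma n m ∘ Equiv.sumCongr π₁ π₂ = sigma n m := by
  have h₁' : ∀ i, π₁ i = 0 ↔ i = 0 := fun i => by
    conv_lhs => rw [← h₁, π₁.injective.eq_iff]
  have h₂' : ∀ i, π₂ i = 0 ↔ i = 0 := fun i => by
    conv_lhs => rw [← h₂, π₂.injective.eq_iff]
  ext (i | i) <;> simp [sigma, Pi.single_apply, h₁', h₂']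

theorem cls_mem_relabelGroup_withSigma {π₁ : Fin (n + 1) ≃ Fin (n + 1)}
    {π₂ : Fin (m + 1) ≃ Fin (m + 1)} (h₁ : π₁ 0 = 0) (h₂ : π₂ 0 = 0)
    {K : AddSubgroup (Fin (n + 1) ⊕ Fin (m + 1) → QZ)} {v : Fin (n + 1) ⊕ Fin (m + 1) → ℚ} :
    cls v ∈ relabelGroup (Equiv.sumCongr π₁ π₂) (withSigma K) ↔
      cls v ∈ relabelGroup (Equiv.sumCongr π₁ π₂) K ∨
        cls (v + halfAt (Sum.inl 0) (Sum.inr 0)) ∈ relabelGroup (Equiv.sumCongr π₁ π₂) K := by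
  have key : (cls v + sigma n m) ∘ Equiv.sumCongr π₁ π₂ =
      cls v ∘ Equiv.sumCongr π₁ π₂ + sigma n m := by
    conv_rhs => rw [← sigma_comp_sumCongr h₁ h₂]
    rfl
  rw [cls_add, ← sigma_eq, mem_relabelGroup, mem_relabelGroup, mem_relabelGroup, mem_withSigma, key]

theorem coe_half_ne_zero : (((1 / 2 : ℚ) : ℚ) : QZ) ≠ 0 := by
  rw [Ne, coe_eq_zero_iff]
  rintro ⟨z, hz⟩
  have h2 : (1 : ℚ) = ((2 * z : ℤ) : ℚ) := by push_cast; linarith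
  have h3 : (1 : ℤ) = 2 * z := by exact_mod_cast h2
  omega

/-- Restricted to the first set of variables, the involution has determinant `-1`. -/
theorem sigma_notMem_of_le_SL {W₁ : MvPolynomial (Fin (n + 1)) ℂ}
    {W₂ : MvPolynomial (Fin (m + 1)) ℂ} {G : AddSubgroup (Fin (n + 1) ⊕ Fin (m + 1) → QZ)}
    (hG : G ≤ prodGroup (SL W₁) (SL W₂)) : sigma n m ∉ G := by
  intro hs
  have h1 : ∏ i : Fin (n + 1), expQZ (sigma n m (Sum.inl i)) = 1 := (hG hs).1.2
  rw [← expQZ_sum, expQZ_eq_one] at h1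
  simp only [sigma, Sum.elim_inl, Finset.sum_pi_single', Finset.mem_univ, if_true] at h1
  exact coe_half_ne_zero h1

end sigma

end BVLG

end

/-! ### Assembly -/

theorem theorem1 {n m : ℕ}
    (f₁ : MvPolynomial (Fin n) ℂ) (f₂ : MvPolynomial (Fin m) ℂ)
    (hW₁ : BVLG.IsInvertible (BVLG.squarePlus f₁))
    (hW₂ : BVLG.IsInvertible (BVLG.squarePlus f₂))
    (hCY₁ : BVLG.CalabiYau (BVLG.squarePlus f₁))
    (hCY₂ : BVLG.CalabiYau (BVLG.squarePlus f₂))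
    (A₁ : Matrix (Fin (n + 1)) (Fin (n + 1)) ℕ) (A₂ : Matrix (Fin (m + 1)) (Fin (m + 1)) ℕ)
    (hA₁ : BVLG.IsExponentMatrix (BVLG.squarePlus f₁) A₁) (hA₁0 : A₁ 0 = Pi.single 0 2)
    (hA₂ : BVLG.IsExponentMatrix (BVLG.squarePlus f₂) A₂) (hA₂0 : A₂ 0 = Pi.single 0 2)
    (G : AddSubgroup (Fin (n + 1) ⊕ Fin (m + 1) → BVLG.QZ))
    (hJG : BVLG.prodGroup (BVLG.J (BVLG.squarePlus f₁)) (BVLG.J (BVLG.squarePlus f₂)) ≤ G)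
    (hGSL : G ≤ BVLG.prodGroup (BVLG.SL (BVLG.squarePlus f₁)) (BVLG.SL (BVLG.squarePlus f₂))) :
    BVLG.IsInvertible (BVLG.mirrorPoly (BVLG.disjointSumMatrix A₁ A₂)) ∧
    ∃ e : BVLG.StateSpace (BVLG.disjointSum (BVLG.squarePlus f₁) (BVLG.squarePlus f₂))
          (BVLG.withSigma G) ≃ₗ[ℂ]
        BVLG.StateSpace (BVLG.mirrorPoly (BVLG.disjointSumMatrix A₁ A₂))
          (BVLG.withSigma (BVLG.mirrorGroup (BVLG.disjointSumMatrix A₁ A₂) G)),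
      ∀ r : ℚ × ℚ,
        (BVLG.pieceA (BVLG.disjointSum (BVLG.squarePlus f₁) (BVLG.squarePlus f₂))
            (BVLG.withSigma G) r).map e.toLinearMap =
          BVLG.pieceB (BVLG.mirrorPoly (BVLG.disjointSumMatrix A₁ A₂))
            (BVLG.withSigma (BVLG.mirrorGroup (BVLG.disjointSumMatrix A₁ A₂) G)) r := by
  obtain ⟨D₁, c₁, π₁, hc₁, hD₁, hπ₁, hz₁, he₁, hn₁, ht₁⟩ :=
    BVLG.exists_shape_squarePlus hW₁ hCY₁ hA₁ hA₁0
  obtain ⟨D₂, c₂, π₂, hc₂, hD₂, hπ₂, hz₂, he₂, hn₂, ht₂⟩ :=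
    BVLG.exists_shape_squarePlus hW₂ hCY₂ hA₂ hA₂0
  have hA := D₁.disjointSumMatrix_eq D₂ hπ₁ hπ₂
  have hx : (D₁.sum D₂).IsSquare (Sum.inl 0) := BVLG.ChainLoop.IsSquare.inl ⟨he₁, hn₁, ht₁⟩
  have hy : (D₁.sum D₂).IsSquare (Sum.inr 0) := BVLG.ChainLoop.IsSquare.inr ⟨he₂, hn₂, ht₂⟩
  have hW := D₁.disjointSum_poly D₂ c₁ c₂
  have hc : ∀ i, Sum.elim c₁ c₂ i ≠ 0 := by
    rintro (i | i)
    exacts [hc₁ i, hc₂ i]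
  rw [← hD₁, ← hD₂] at hW
  have hint : ∀ v, BVLG.cls v ∈ G → ∀ i, ∃ z : ℤ, (D₁.sum D₂).mul v i = z := by
    intro v hv
    obtain ⟨v₁, v₂, rfl⟩ : ∃ v₁ v₂, v = Sum.elim v₁ v₂ :=
      ⟨v ∘ Sum.inl, v ∘ Sum.inr, (Sum.elim_comp_inl_inr v).symm⟩
    have hm := hGSL hv
    have h₁ : BVLG.cls v₁ ∈ BVLG.Gmax (BVLG.squarePlus f₁) := hm.1.1
    have h₂ : BVLG.cls v₂ ∈ BVLG.Gmax (BVLG.squarePlus f₂) := hm.2.1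
    rw [hD₁, BVLG.ChainLoop.cls_mem_Gmax hc₁] at h₁
    rw [hD₂, BVLG.ChainLoop.cls_mem_Gmax hc₂] at h₂
    rintro (i | i)
    · rw [BVLG.ChainLoop.sum_mul_inl]
      exact h₁ i
    · rw [BVLG.ChainLoop.sum_mul_inr]
      exact h₂ i
  set D := D₁.sum D₂
  set π := Equiv.sumCongr π₁ π₂
  set A := BVLG.disjointSumMatrix A₁ A₂
  have hmir := D.mirrorPoly_eq π hA
  have hone : ∀ i : Fin (n + 1) ⊕ Fin (m + 1), (1 : Fin (n + 1) ⊕ Fin (m + 1) → ℂ) i ≠ 0 :=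
    fun _ => one_ne_zero
  have hdual := BVLG.ChainLoop.isDual_of_mem_right hint (D.cls_mem_mirrorGroup π hA hint)
  have hext : D.IsExtended (Sum.inl 0) (Sum.inr 0) G
      (BVLG.ChainLoop.relabelGroup π (BVLG.mirrorGroup A G)) (BVLG.withSigma G)
      (BVLG.ChainLoop.relabelGroup π (BVLG.withSigma (BVLG.mirrorGroup A G))) :=
    { ne := Sum.inl_ne_inr
      square_left := hx
      square_right := hy
      dual := hdual
      notMem_left := BVLG.sigma_eq (n := n) (m := m) ▸ BVLG.sigma_notMem_of_le_SL hGSL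
      notMem_right := by
        intro hmem
        -- The grading operator of the first summand alone lies in `G`, and pairs with the
        -- involution to its weight `1/2` at `x₀`; the product of the grading operators would pair
        -- to an integer.
        have hu : BVLG.cls (Sum.elim D₁.weight 0) ∈ G := by
          refine hJG ⟨?_, ?_⟩
          · have h1 : BVLG.expGrading (BVLG.squarePlus f₁) = BVLG.cls D₁.weight := by
              ext i
              rw [hD₁, BVLG.expGrading, D₁.weights_poly c₁ hc₁, BVLG.cls]
            change BVLG.cls D₁.weight ∈ BVLG.J _
            rw [← h1]
            exact AddSubgroup.mem_zmultiples _
          · exact (BVLG.J _).zero_mem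
        obtain ⟨z, hz⟩ := ((hdual.mem_right _).1 hmem).2 _ hu
        refine BVLG.coe_half_ne_zero (BVLG.coe_eq_zero_iff.2 ⟨z, ?_⟩)
        rw [← hz, BVLG.ChainLoop.sum_mul_transpose]
        have h2 := BVLG.ChainLoop.sum_mul_halfAt hx hy Sum.inl_ne_inr (Sum.elim D₁.weight 0)
        have h3 : D₁.weight 0 = 1 / 2 := by
          have h4 := congrFun D₁.mul_weight 0
          rw [(⟨he₁, hn₁, ht₁⟩ : D₁.IsSquare 0).mul_apply, Pi.one_apply] at h4
          linarith
        simp only [Sum.elim_inl, Sum.elim_inr, Pi.zero_apply, add_zero, h3] at h2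
        rw [← h2]
        exact Finset.sum_congr rfl fun i _ => mul_comm _ _
      mem_left := fun v => by
        rw [BVLG.mem_withSigma, BVLG.ChainLoop.cls_add, BVLG.sigma_eq]
      mem_right := fun _ => BVLG.cls_mem_relabelGroup_withSigma hz₁ hz₂ }
  have hG : BVLG.withSigma G ≤ BVLG.Gmax
      (BVLG.disjointSum (BVLG.squarePlus f₁) (BVLG.squarePlus f₂)) := by
    intro g hg
    obtain ⟨v, rfl⟩ := BVLG.exists_cls_eq g
    rw [hW, BVLG.ChainLoop.cls_mem_Gmax hc]
    exact hext.int_of_mem hg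
  have hG' : BVLG.withSigma (BVLG.mirrorGroup A G) ≤ BVLG.Gmax (BVLG.mirrorPoly A) := by
    intro g hg
    obtain ⟨v, rfl⟩ := BVLG.exists_cls_eq g
    obtain ⟨u, rfl⟩ : ∃ u : _ → ℚ, v = u ∘ π := ⟨v ∘ π.symm, by ext; simp⟩
    rw [hmir, BVLG.ChainLoop.cls_mem_Gmax hone]
    intro i
    rw [BVLG.ChainLoop.relabel_mul]
    exact hext.transpose.int_of_mem hg (π i)
  refine ⟨by rw [hmir]; exact (D.transpose.relabel π).isInvertible_poly 1 hone, ?_⟩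
  refine BVLG.ChainLoop.exists_equiv_of_pairEquiv hc hW hG hone hmir hG' ?_
    (hext.mirrorEquiv.trans (D.transpose.relabelPairEquiv π _)) fun p => ?_
  · rw [BVLG.ChainLoop.sum_weight_relabel, BVLG.ChainLoop.sum_weight_transpose]
  · rw [Equiv.trans_apply, BVLG.ChainLoop.pairDegB_relabelPairEquiv, hext.pairDegB_mirrorEquiv]
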